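/- Let $M$ be a free abelian group of finite rank with dual $N=\operatorname{Hom}(M,\mathbb Z)$, put $N_{\mathbb R}=N\otimes\mathbb R=\operatorname{Hom}(M,\mathbb R)$ with the pairing $\langle\cdot,\cdot\rangle$, and let $\mathbb T_N=\operatorname{Spec}\mathbb C[M]$ be the torus with character lattice $M$. Let $X\subset\mathbb T_N$ be the closed subscheme (for instance a subvariety) defined by an ideal $I\subset\mathbb C[M]$. For $w\in N_{\mathbb R}$ the initial form $\operatorname{in}_wf$ of $f=\sum c_m\xi^m$ is the sum of those terms $c_m\xi^m$, $c_m\neq0$, for which $\langle m,w\rangle$ is minimal; $\operatorname{in}_wI$ is the ideal generated by all $\operatorname{in}_wf$, $f\in I$, and $\operatorname{in}_wX\subset\mathbb T_N$ is the closed subscheme it defines. Let $\Sigma$ be a rational polyhedral fan in $N_{\mathbb R}$ (closed under taking faces, any two cones meeting in a common face, containing the cone $\{0\}$, so that all its cones are strongly convex) such that $\operatorname{in}_uI=\operatorname{in}_wI$ whenever $u,w$ lie in the relative interior of the same cone of $\Sigma$; for instance, such a fan structure on the tropical variety of $X$. For $\sigma\in\Sigma$ let $\operatorname{in}_\sigma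 X$ be the common scheme $\operatorname{in}_wX$ for $w$ in the relative interior of $\sigma$. Let $\sigma^\vee$ and $\sigma^\perp$ be the sets of $m\in M$ with $\langle m,\cdot\rangle\ge0$, respectively $\langle m,\cdot\rangle=0$, on $\sigma$; let $Y_\Sigma$ be the toric variety glued from the affine charts $V_\sigma=\operatorname{Spec}\mathbb C[\sigma^\vee]$, and let $\mathcal O_\sigma=\operatorname{Spec}\mathbb C[\sigma^\perp]\hookrightarrow V_\sigma\subset Y_\Sigma$ be the torus orbit of $\sigma$, embedded by the map $\mathbb C[\sigma^\vee]\to\mathbb C[\sigma^\perp]$ that is the identity on $\sigma^\perp$ and sends $\xi^m$ to $0$ for $m\in\sigma^\vee\setminus\sigma^\perp$. Let $\overline X$ be the (scheme-theoretic) closure of $X\subset\mathbb T_N=V_{\{0\}}$ in $Y_\Sigma$. Finally let $\langle\sigma\rangle\subset N$ be the subgroup generated by $\sigma\cap N$ and $\mathbb T_{\langle\sigma\rangle}=\operatorname{Spec}\mathbb C[\operatorname{Hom}(\langle\sigma\rangle,\mathbb Z)]$, which maps to $\mathbb T_N$. Then for every cone $\sigma\in\Sigma$ the group $\mathbb T_{\langle\sigma\rangle}$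 acts on $\operatorname{in}_\sigma X$ by translation, the action is free (the morphism $\mathbb T_{\langle\sigma\rangle}\times\operatorname{in}_\sigma X\to\operatorname{in}_\sigma X\times\operatorname{in}_\sigma X$, $(t,x)\mapsto(tx,x)$, is a closed immersion), and its quotient is the scheme-theoretic intersection of $\overline X$ with the orbit: \[ \operatorname{in}_\sigma X/\mathbb T_{\langle\sigma\rangle}\;=\;\overline X\cap\mathcal O_\sigma . \] That is, the projection $\mathbb T_N\to\mathcal O_\sigma=\mathbb T_N/\mathbb T_{\langle\sigma\rangle}$ induced by $\sigma^\perp\subset M$ restricts to a morphism $\operatorname{in}_\sigma X\to\overline X\cap\mathcal O_\sigma$ which is a principal $\mathbb T_{\langle\sigma\rangle}$-bundle (faithfully flat and quasi-compact, with $\mathbb T_{\langle\sigma\rangle}\times\operatorname{in}_\sigma X\cong\operatorname{in}_\sigma X\times_{\overline X\cap\mathcal O_\sigma}\operatorname{in}_\sigma X$) and the categorical quotient by the action. -/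

import Mathlib

open AlgebraicGeometry CategoryTheory Limits MonoidalCategory CartesianMonoidalCategory

noncomputable section

namespace TropicalToric

/-! ### Cones and fans

`M` is a lattice, `N = Hom(M, ℤ)` is its dual lattice `M →+ ℤ`, and the real vector space
`N ⊗ ℝ = Hom(M, ℝ)` is `M →+ ℝ`. The pairing `⟨m, w⟩` is the evaluation `w m`. -/

section Cones

variable {M : Type} [AddCommGroup M]

/-- The inclusion of the lattice `N = Hom(M, ℤ)` into `N ⊗ ℝ = Hom(M, ℝ)`. -/
def latticeToReal (n : M →+ ℤ) : M →+ ℝ := (Int.castAddHom ℝ).comp n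

/-- A rational polyhedral cone: the set of non-negative real combinations of finitely many
lattice vectors. -/
def IsRationalPolyhedral (σ : PointedCone ℝ (M →+ ℝ)) : Prop :=
  ∃ s : Finset (M →+ ℤ), σ = PointedCone.hull ℝ (latticeToReal '' (s : Set (M →+ ℤ)))

/-- `σ^∨`, the monoid of lattice points `m ∈ M` that are non-negative on `σ`. -/
def dualMonoid (σ : PointedCone ℝ (M →+ ℝ)) : AddSubmonoid M where
  carrier := {m | ∀ w ∈ σ, 0 ≤ w m}
  zero_mem' := fun w _ => by simp
  add_mem' := fun ha hb w hw => by
    rw [map_add]; exact add_nonneg (ha w hw) (hb w hw)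

/-- `σ^⊥`, the group of lattice points `m ∈ M` that vanish on `σ`. -/
def perp (σ : PointedCone ℝ (M →+ ℝ)) : AddSubgroup M where
  carrier := {m | ∀ w ∈ σ, w m = 0}
  zero_mem' := fun w _ => by simp
  add_mem' := fun ha hb w hw => by rw [map_add, ha w hw, hb w hw, add_zero]
  neg_mem' := fun ha w hw => by rw [map_neg, ha w hw, neg_zero]

/-- `τ` is a face of `σ` (possibly `σ` itself): `τ = σ ∩ m^⊥` for some `m ∈ σ^∨`. -/
def IsFace (τ σ : PointedCone ℝ (M →+ ℝ)) : Prop :=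
  ∃ m ∈ dualMonoid σ, ∀ w, w ∈ τ ↔ w ∈ σ ∧ w m = 0

/-- The relative interior of a cone: its points that lie in no proper face. -/
def relInterior (σ : PointedCone ℝ (M →+ ℝ)) : Set (M →+ ℝ) :=
  {w | w ∈ σ ∧ ∀ τ, IsFace τ σ → w ∈ τ → τ = σ}

variable (M) in
/-- A rational polyhedral fan in `N ⊗ ℝ`. As the zero cone belongs to the fan, it is a face of every
cone of the fan by `inter_isFace`, so that all the cones are strongly convex. -/
structure Fan where
  cones : Set (PointedCone ℝ (M →+ ℝ))
  rational : ∀ σ ∈ cones, IsRationalPolyhedral σ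
  zero_mem : ⊥ ∈ cones
  face_mem : ∀ σ ∈ cones, ∀ τ, IsFace τ σ → τ ∈ cones
  inter_isFace : ∀ σ ∈ cones, ∀ τ ∈ cones, IsFace (σ ⊓ τ) σ

/-- `⟨σ⟩`, the subgroup of `N` generated by the lattice points of `σ`. -/
def latticeSpan (σ : PointedCone ℝ (M →+ ℝ)) : AddSubgroup (M →+ ℤ) :=
  AddSubgroup.closure {n | latticeToReal n ∈ σ}

/-- The restriction map `M → Hom(⟨σ⟩, ℤ)`, `m ↦ (n ↦ ⟨m, n⟩)`. -/
def restrictSpan (σ : PointedCone ℝ (M →+ ℝ)) : M →+ (latticeSpan σ →+ ℤ) where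
  toFun m := (AddMonoidHom.eval m).comp (latticeSpan σ).subtype
  map_zero' := by ext n; simp
  map_add' a b := by ext n; simp

end Cones

/-! ### Initial ideals -/

section Initial

variable {M : Type} [AddCommGroup M]

open Classical in
/-- The initial form `in_w f`: the sum of the terms of `f` on which `⟨·, w⟩` is minimal among the
exponents of `f`. -/
def initialForm (w : M →+ ℝ) (f : AddMonoidAlgebra ℂ M) : AddMonoidAlgebra ℂ M :=
  .ofCoeff (f.coeff.filter fun m => ∀ m' ∈ f.coeff.support, w m ≤ w m')

/-- The initial ideal `in_w I`, generated by the initial forms of all the elements of `I`. -/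
def initialIdeal (w : M →+ ℝ) (I : Ideal (AddMonoidAlgebra ℂ M)) :
    Ideal (AddMonoidAlgebra ℂ M) :=
  Ideal.span (initialForm w '' (I : Set (AddMonoidAlgebra ℂ M)))

end Initial

/-! ### The affine toric charts, and their gluing -/

section Toric

variable {M : Type} [AddCommGroup M]

lemma dualMonoid_anti {σ τ : PointedCone ℝ (M →+ ℝ)} (h : σ ≤ τ) :
    dualMonoid τ ≤ dualMonoid σ := fun _ hm w hw => hm w (h hw)

/-- The inclusion `ℂ[τ^∨] → ℂ[σ^∨]` for `σ ⊆ τ`. -/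
def chartRingMap {σ τ : PointedCone ℝ (M →+ ℝ)} (h : σ ≤ τ) :
    AddMonoidAlgebra ℂ (dualMonoid τ) →ₐ[ℂ] AddMonoidAlgebra ℂ (dualMonoid σ) :=
  AddMonoidAlgebra.mapDomainAlgHom ℂ ℂ (AddSubmonoid.inclusion (dualMonoid_anti h))

/-- The affine toric variety `V_σ = Spec ℂ[σ^∨]`. -/
abbrev chart (σ : PointedCone ℝ (M →+ ℝ)) : Scheme.{0} :=
  Spec (.of (AddMonoidAlgebra ℂ (dualMonoid σ)))

/-- The morphism `V_σ → V_τ` for `σ ⊆ τ`. -/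
def chartMap {σ τ : PointedCone ℝ (M →+ ℝ)} (h : σ ≤ τ) : chart σ ⟶ chart τ :=
  Spec.map (CommRingCat.ofHom (chartRingMap h).toRingHom)

lemma chartRingMap_single {σ τ : PointedCone ℝ (M →+ ℝ)} (h : σ ≤ τ) (m : dualMonoid τ) (c : ℂ) :
    chartRingMap h (.single m c) = .single (AddSubmonoid.inclusion (dualMonoid_anti h) m) c := by
  simp [chartRingMap]

lemma chartRingMap_injective {σ τ : PointedCone ℝ (M →+ ℝ)} (h : σ ≤ τ) :
    Function.Injective (chartRingMap h) := by
  have := AddMonoidAlgebra.mapDomain_injective (R := ℂ)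
    (AddSubmonoid.inclusion_injective (dualMonoid_anti h))
  exact this

lemma mem_dualMonoid_hull (s : Set (M →+ ℤ)) (m : M) (hm : ∀ n ∈ s, 0 ≤ n m) :
    m ∈ dualMonoid (PointedCone.hull ℝ (latticeToReal '' s)) := by
  intro w hw
  refine Submodule.span_induction (p := fun w _ => 0 ≤ w m) ?_ ?_ ?_ ?_ hw
  · rintro _ ⟨n, hn, rfl⟩
    simpa [latticeToReal] using hm n hn
  · simp
  · intro x y _ _ hx hy
    simpa using add_nonneg hx hy
  · intro a x _ hx
    exact mul_nonneg a.2 hx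

/-- If `τ = σ ∩ m^⊥` with `m ∈ σ^∨`, then `τ^∨ = σ^∨ + ℕ(-m)`. -/
lemma exists_nsmul_add_mem {σ τ : PointedCone ℝ (M →+ ℝ)} (hσ : IsRationalPolyhedral σ) {m : M}
    (hm : m ∈ dualMonoid σ) (hτ : ∀ w, w ∈ τ ↔ w ∈ σ ∧ w m = 0) {a : M} (ha : a ∈ dualMonoid τ) :
    ∃ k₀ : ℕ, ∀ k ≥ k₀, k • m + a ∈ dualMonoid σ := by
  obtain ⟨s, rfl⟩ := hσ
  refine ⟨∑ n ∈ s, (n a).natAbs, fun k hk => mem_dualMonoid_hull _ _ fun n hn => ?_⟩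
  have hns : latticeToReal n ∈ PointedCone.hull ℝ (latticeToReal '' (s : Set (M →+ ℤ))) :=
    Submodule.subset_span ⟨n, hn, rfl⟩
  have h0 : 0 ≤ n m := by simpa [latticeToReal] using hm _ hns
  have hk' : (n a).natAbs ≤ k :=
    (Finset.single_le_sum (f := fun n : M →+ ℤ => (n a).natAbs) (fun _ _ => Nat.zero_le _) hn).trans
      hk
  rcases h0.eq_or_lt with h | h
  · have : latticeToReal n ∈ τ := (hτ _).2 ⟨hns, by simp [latticeToReal, ← h]⟩
    have := ha _ this
    simpa [latticeToReal, ← h] using this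
  · have h1 : (k : ℤ) * 1 ≤ k * n m := by gcongr; omega
    simp only [map_add, map_nsmul, nsmul_eq_mul]
    omega

lemma isLocalization_chartRingMap {σ τ : PointedCone ℝ (M →+ ℝ)} (hσ : IsRationalPolyhedral σ)
    {m : M} (hm : m ∈ dualMonoid σ) (hτ : ∀ w, w ∈ τ ↔ w ∈ σ ∧ w m = 0) (h : τ ≤ σ) :
    letI := (chartRingMap h).toRingHom.toAlgebra
    IsLocalization.Away (AddMonoidAlgebra.single (⟨m, hm⟩ : dualMonoid σ) (1 : ℂ))
      (AddMonoidAlgebra ℂ (dualMonoid τ)) := by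
  let _ := (chartRingMap h).toRingHom.toAlgebra
  have halg : ∀ x, algebraMap (AddMonoidAlgebra ℂ (dualMonoid σ))
      (AddMonoidAlgebra ℂ (dualMonoid τ)) x = chartRingMap h x := fun x => rfl
  have hneg : -m ∈ dualMonoid τ := fun w hw => by simp [((hτ w).1 hw).2]
  have hpow : ∀ k : ℕ, algebraMap (AddMonoidAlgebra ℂ (dualMonoid σ))
      (AddMonoidAlgebra ℂ (dualMonoid τ)) (.single (⟨m, hm⟩ : dualMonoid σ) (1 : ℂ)) ^ k =
      .single (k • (⟨m, dualMonoid_anti h hm⟩ : dualMonoid τ)) 1 := fun k => by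
    rw [halg, chartRingMap_single, AddMonoidAlgebra.single_pow, one_pow]; rfl
  have hsurj : ∀ x : AddMonoidAlgebra ℂ (dualMonoid τ), ∃ k₀ : ℕ, ∀ k ≥ k₀, ∃ a,
      x * algebraMap (AddMonoidAlgebra ℂ (dualMonoid σ)) (AddMonoidAlgebra ℂ (dualMonoid τ))
        (.single (⟨m, hm⟩ : dualMonoid σ) (1 : ℂ)) ^ k =
      algebraMap (AddMonoidAlgebra ℂ (dualMonoid σ)) (AddMonoidAlgebra ℂ (dualMonoid τ)) a := by
    intro x
    induction x using AddMonoidAlgebra.induction_linear with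
    | zero => exact ⟨0, fun k _ => ⟨0, by simp⟩⟩
    | add f g hf hg =>
      obtain ⟨k, hk⟩ := hf
      obtain ⟨l, hl⟩ := hg
      refine ⟨max k l, fun j hj => ?_⟩
      obtain ⟨a, ha⟩ := hk j (le_trans (le_max_left _ _) hj)
      obtain ⟨b, hb⟩ := hl j (le_trans (le_max_right _ _) hj)
      exact ⟨a + b, by rw [add_mul, ha, hb, map_add]⟩
    | single a c =>
      obtain ⟨k₀, hk₀⟩ := exists_nsmul_add_mem hσ hm hτ a.2
      refine ⟨k₀, fun k hk => ⟨.single ⟨_, hk₀ k hk⟩ c, ?_⟩⟩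
      rw [hpow, halg, chartRingMap_single, AddMonoidAlgebra.single_mul_single, mul_one]
      congr 1
      ext
      simp [add_comm]
  refine IsLocalization.Away.mk _ ?_ ?_ ?_
  · rw [halg, chartRingMap_single]
    refine IsUnit.of_mul_eq_one (.single ⟨-m, hneg⟩ 1) ?_
    rw [AddMonoidAlgebra.single_mul_single, AddMonoidAlgebra.one_def, mul_one]
    congr 1
    ext
    simp
  · intro x
    obtain ⟨k, hk⟩ := hsurj x
    obtain ⟨a, ha⟩ := hk k le_rfl
    exact ⟨k, a, ha⟩
  · intro a b hab
    exact ⟨0, by rw [chartRingMap_injective h hab]⟩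

lemma isOpenImmersion_chartMap {σ τ : PointedCone ℝ (M →+ ℝ)} (hσ : IsRationalPolyhedral σ)
    (hτ : IsFace τ σ) (h : τ ≤ σ) : IsOpenImmersion (chartMap h) := by
  obtain ⟨m, hm, hτ⟩ := hτ
  let _ := (chartRingMap h).toRingHom.toAlgebra
  have := isLocalization_chartRingMap hσ hm hτ h
  exact IsOpenImmersion.of_isLocalization
    (AddMonoidAlgebra.single (⟨m, hm⟩ : dualMonoid σ) (1 : ℂ))

lemma range_chartMap {σ τ : PointedCone ℝ (M →+ ℝ)} (hσ : IsRationalPolyhedral σ)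
    {m : M} (hm : m ∈ dualMonoid σ) (hτ : ∀ w, w ∈ τ ↔ w ∈ σ ∧ w m = 0) (h : τ ≤ σ) :
    Set.range (chartMap h) =
      (PrimeSpectrum.basicOpen (AddMonoidAlgebra.single (⟨m, hm⟩ : dualMonoid σ) (1 : ℂ)) :
        Set (PrimeSpectrum (AddMonoidAlgebra ℂ (dualMonoid σ)))) := by
  let _ := (chartRingMap h).toRingHom.toAlgebra
  have := isLocalization_chartRingMap hσ hm hτ h
  exact PrimeSpectrum.localization_away_comap_range (AddMonoidAlgebra ℂ (dualMonoid τ))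
    (AddMonoidAlgebra.single (⟨m, hm⟩ : dualMonoid σ) (1 : ℂ))

lemma chartMap_refl (σ : PointedCone ℝ (M →+ ℝ)) : chartMap (le_refl σ) = 𝟙 (chart σ) := by
  have : chartRingMap (le_refl σ) = AlgHom.id ℂ _ := AddMonoidAlgebra.mapDomainAlgHom_id ..
  rw [chartMap, this]
  exact Spec.map_id _

lemma chartMap_comp {σ τ ρ : PointedCone ℝ (M →+ ℝ)} (h : σ ≤ τ) (h' : τ ≤ ρ) :
    chartMap h ≫ chartMap h' = chartMap (h.trans h') := by
  have : chartRingMap (h.trans h') = (chartRingMap h).comp (chartRingMap h') :=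
    AddMonoidAlgebra.mapDomainAlgHom_comp (R := ℂ) (A := ℂ)
      (AddSubmonoid.inclusion (dualMonoid_anti h')) (AddSubmonoid.inclusion (dualMonoid_anti h))
  rw [chartMap, chartMap, chartMap, this, ← Spec.map_comp, ← CommRingCat.ofHom_comp]
  rfl

/-- The diagram of the affine toric varieties `V_σ`, `σ ∈ Σ`, with the morphisms `V_σ → V_τ` for
`σ ⊆ τ`. -/
def chartDiagram (F : Fan M) : F.cones ⥤ Scheme.{0} where
  obj σ := chart σ.1
  map f := chartMap (leOfHom f)
  map_id σ := chartMap_refl σ.1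
  map_comp f g := (chartMap_comp (leOfHom f) (leOfHom g)).symm

lemma Fan.isFace_of_le (F : Fan M) {σ τ : F.cones} (h : τ ≤ σ) : IsFace τ.1 σ.1 := by
  have := F.inter_isFace σ σ.2 τ τ.2
  rwa [inf_eq_right.2 (show τ.1 ≤ σ.1 from h)] at this

instance (F : Fan M) {σ τ : F.cones} (f : σ ⟶ τ) : IsOpenImmersion ((chartDiagram F).map f) :=
  isOpenImmersion_chartMap (F.rational _ τ.2) (F.isFace_of_le (leOfHom f)) _

instance (F : Fan M) : (chartDiagram F ⋙ Scheme.forget).IsLocallyDirected where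
  cond := by
    intro σ σ' τ f f' x x' hx
    obtain ⟨m, hm, h⟩ := F.isFace_of_le (leOfHom f)
    obtain ⟨m', hm', h'⟩ := F.isFace_of_le (leOfHom f')
    have hmem : σ.1 ⊓ σ'.1 ∈ F.cones := F.face_mem σ σ.2 _ (F.inter_isFace σ σ.2 σ' σ'.2)
    let ρ : F.cones := ⟨σ.1 ⊓ σ'.1, hmem⟩
    have hρσ : ρ ≤ σ := show σ.1 ⊓ σ'.1 ≤ σ.1 from inf_le_left
    have hρσ' : ρ ≤ σ' := show σ.1 ⊓ σ'.1 ≤ σ'.1 from inf_le_right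
    have hρ : ∀ w, w ∈ ρ.1 ↔ w ∈ τ.1 ∧ w (m + m') = 0 := by
      intro w
      rw [show w ∈ ρ.1 ↔ w ∈ σ.1 ∧ w ∈ σ'.1 from Submodule.mem_inf, h, h', map_add]
      constructor
      · rintro ⟨⟨h1, h2⟩, -, h3⟩
        exact ⟨h1, by rw [h2, h3, add_zero]⟩
      · rintro ⟨h1, h2⟩
        have h3 := hm w h1
        have h4 := hm' w h1
        exact ⟨⟨h1, by linarith⟩, h1, by linarith⟩
    have hy : (chartMap (leOfHom f)) x ∈ Set.range (chartMap (hρσ.trans (leOfHom f))) := by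
      rw [range_chartMap (F.rational _ τ.2) (add_mem hm hm') hρ]
      have h1 : (chartMap (leOfHom f)) x ∈ Set.range (chartMap (leOfHom f)) := ⟨x, rfl⟩
      have h2 : (chartMap (leOfHom f)) x ∈ Set.range (chartMap (leOfHom f')) := ⟨x', hx.symm⟩
      rw [range_chartMap (F.rational _ τ.2) hm h] at h1
      rw [range_chartMap (F.rational _ τ.2) hm' h'] at h2
      have h3 : (AddMonoidAlgebra.single (⟨m + m', add_mem hm hm'⟩ : dualMonoid τ.1) (1 : ℂ)) =
          .single (⟨m, hm⟩ : dualMonoid τ.1) 1 * .single (⟨m', hm'⟩ : dualMonoid τ.1) 1 := by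
        rw [AddMonoidAlgebra.single_mul_single, mul_one]; rfl
      rw [h3, PrimeSpectrum.basicOpen_mul]
      exact ⟨h1, h2⟩
    obtain ⟨y, hy⟩ := hy
    refine ⟨ρ, homOfLE hρσ, homOfLE hρσ', y, ?_, ?_⟩
    · apply ((chartDiagram F).map f).isOpenEmbedding.injective
      refine Eq.trans ?_ hy
      rw [← chartMap_comp hρσ (leOfHom f)]
      rfl
    · apply ((chartDiagram F).map f').isOpenEmbedding.injective
      refine Eq.trans ?_ hx
      refine Eq.trans ?_ hy
      rw [← chartMap_comp hρσ' (leOfHom f')]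
      rfl

/-- The toric variety `Y_Σ`: the affine toric varieties `V_σ`, `σ ∈ Σ`, glued along the open
immersions `V_σ → V_τ` for `σ ⊆ τ`. -/
def toricVariety (F : Fan M) : Scheme.{0} := colimit (chartDiagram F)

/-- The open immersion `V_σ → Y_Σ`. -/
def chartToToric (F : Fan M) (σ : F.cones) : chart σ.1 ⟶ toricVariety F :=
  colimit.ι (chartDiagram F) σ

end Toric

/-! ### Tori, orbits, and subschemes -/

section Schemes

/-- `Spec ℂ`. -/
abbrev base : Scheme.{0} := Spec (.of ℂ)

/-- `Spec A` as a scheme over `ℂ`. -/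
abbrev affine (A : Type) [CommRing A] [Algebra ℂ A] : Over base := (Spec (.of A)).asOver base

/-- The morphism `Spec B → Spec A` over `ℂ` given by a homomorphism of `ℂ`-algebras `A → B`. -/
def affineMap {A B : Type} [CommRing A] [Algebra ℂ A] [CommRing B] [Algebra ℂ B] (f : A →ₐ[ℂ] B) :
    affine B ⟶ affine A :=
  (Spec.map (CommRingCat.ofHom f.toRingHom)).asOver base

/-- The group scheme `Spec ℂ[L]` for an abelian group `L`; its group structure over `ℂ`
comes from the Hopf algebra structure of `ℂ[L]`, in which the elements of `L` are group-like. -/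
abbrev torus (L : Type) [AddCommGroup L] : Over base := affine (AddMonoidAlgebra ℂ L)

/-- The homomorphism `Spec ℂ[L'] → Spec ℂ[L]` given by `L → L'`. -/
def torusMap {L L' : Type} [AddCommGroup L] [AddCommGroup L'] (f : L →+ L') : torus L' ⟶ torus L :=
  affineMap (AddMonoidAlgebra.mapDomainAlgHom ℂ ℂ f)

variable {M : Type} [AddCommGroup M]

/-- The torus `T_⟨σ⟩`, with character lattice `Hom(⟨σ⟩, ℤ)`. -/
abbrev subtorus (σ : PointedCone ℝ (M →+ ℝ)) : Over base := torus (latticeSpan σ →+ ℤ)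

/-- The homomorphism `T_⟨σ⟩ → T_N`, where `T_N = Spec ℂ[M]`, induced by `⟨σ⟩ ⊆ N`. -/
def subtorusι (σ : PointedCone ℝ (M →+ ℝ)) : subtorus σ ⟶ torus M := torusMap (restrictSpan σ)

/-- The torus orbit `O_σ = Spec ℂ[σ^⊥]`. -/
abbrev orbit (σ : PointedCone ℝ (M →+ ℝ)) : Over base := torus (perp σ)

/-- The quotient homomorphism `T_N → O_σ = T_N / T_⟨σ⟩`, induced by `σ^⊥ ⊆ M`. -/
def torusToOrbit (σ : PointedCone ℝ (M →+ ℝ)) : torus M ⟶ orbit σ := torusMap (perp σ).subtype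

open Classical in
/-- The map `ℂ[σ^∨] → ℂ[σ^⊥]` that sends `m` to `m` if `m ∈ σ^⊥` and to `0` otherwise. -/
def orbitRingMap (σ : PointedCone ℝ (M →+ ℝ)) :
    AddMonoidAlgebra ℂ (dualMonoid σ) →ₐ[ℂ] AddMonoidAlgebra ℂ (perp σ) :=
  AddMonoidAlgebra.lift ℂ _ _
    { toFun := fun m => if h : (m.toAdd : M) ∈ perp σ then .single ⟨m.toAdd, h⟩ 1 else 0
      map_one' := by
        rw [dif_pos (by simp)]
        rfl
      map_mul' := by
        intro a b
        have key : ((a * b).toAdd : M) ∈ perp σ ↔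
            (a.toAdd : M) ∈ perp σ ∧ (b.toAdd : M) ∈ perp σ := by
          constructor
          · intro h
            refine ⟨fun w hw => ?_, fun w hw => ?_⟩ <;>
            · have h1 := h w hw
              have h2 := a.toAdd.2 w hw
              have h3 := b.toAdd.2 w hw
              simp only [toAdd_mul, AddSubmonoid.coe_add, map_add] at h1
              linarith
          · rintro ⟨h1, h2⟩
            exact add_mem h1 h2
        by_cases ha : (a.toAdd : M) ∈ perp σ
        · by_cases hb : (b.toAdd : M) ∈ perp σ
          · rw [dif_pos (key.2 ⟨ha, hb⟩), dif_pos ha, dif_pos hb,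
              AddMonoidAlgebra.single_mul_single, mul_one]
            rfl
          · rw [dif_neg (fun h => hb (key.1 h).2), dif_neg hb, mul_zero]
        · rw [dif_neg (fun h => ha (key.1 h).1), dif_neg ha, zero_mul] }

/-- The inclusion `O_σ → V_σ → Y_Σ`. -/
def orbitToToric (F : Fan M) (σ : F.cones) : (orbit σ.1).left ⟶ toricVariety F :=
  Spec.map (CommRingCat.ofHom (orbitRingMap σ.1).toRingHom) ≫ chartToToric F σ

/-- The inclusion `T_N = V_0 → Y_Σ`. -/
def torusToToric (F : Fan M) : (torus M).left ⟶ toricVariety F :=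
  Spec.map (CommRingCat.ofHom
    (AddMonoidAlgebra.mapDomainAlgHom ℂ ℂ
      (dualMonoid (⊥ : PointedCone ℝ (M →+ ℝ))).subtype).toRingHom) ≫
    chartToToric F ⟨⊥, F.zero_mem⟩

/-- The closed subscheme of `T_N` defined by an ideal of `ℂ[M]`. -/
abbrev subscheme (I : Ideal (AddMonoidAlgebra ℂ M)) : Over base := affine (AddMonoidAlgebra ℂ M ⧸ I)

/-- The inclusion into `T_N` of the closed subscheme defined by an ideal. -/
def subschemeι (I : Ideal (AddMonoidAlgebra ℂ M)) : subscheme I ⟶ torus M :=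
  affineMap (Ideal.Quotient.mkₐ ℂ I)

/-- The initial scheme `in_w X ⊆ T_N` of the subscheme `X` of `T_N` defined by `I`. -/
abbrev initialScheme (w : M →+ ℝ) (I : Ideal (AddMonoidAlgebra ℂ M)) : Over base :=
  subscheme (initialIdeal w I)

/-- The inclusion of `X` into `Y_Σ`, where `X` is the subscheme of `T_N` defined by `I`. -/
def subschemeToToric (F : Fan M) (I : Ideal (AddMonoidAlgebra ℂ M)) :
    (subscheme I).left ⟶ toricVariety F :=
  (subschemeι I).left ≫ torusToToric F

/-- The closure `X̄` of `X` in `Y_Σ`, that is, the scheme-theoretic image of `X → Y_Σ`. -/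
def toricClosure (F : Fan M) (I : Ideal (AddMonoidAlgebra ℂ M)) : Scheme.{0} :=
  (subschemeToToric F I).image

/-- The closed immersion `X̄ → Y_Σ`. -/
def toricClosureι (F : Fan M) (I : Ideal (AddMonoidAlgebra ℂ M)) :
    toricClosure F I ⟶ toricVariety F :=
  (subschemeToToric F I).imageι

/-- The scheme-theoretic intersection `X̄ ∩ O_σ = X̄ ×_{Y_Σ} O_σ`. -/
def closureInterOrbit (F : Fan M) (I : Ideal (AddMonoidAlgebra ℂ M)) (σ : F.cones) : Over base :=
  Over.mk (pullback.snd (toricClosureι F I) (orbitToToric F σ) ≫ (orbit σ.1).hom)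

/-- The inclusion `X̄ ∩ O_σ → O_σ`. -/
def closureInterOrbitι (F : Fan M) (I : Ideal (AddMonoidAlgebra ℂ M)) (σ : F.cones) :
    closureInterOrbit F I σ ⟶ orbit σ.1 :=
  Over.homMk (pullback.snd (toricClosureι F I) (orbitToToric F σ))

end Schemes

/-! ### Free actions and quotients -/

section Quotients

variable (G X : Over base) [GrpObj G] [ModObj G X]

/-- The action morphism `G × X → X`. -/
abbrev actionMap : G ⊗ X ⟶ X := ModObj.smul (M := G) (X := X)

/-- A group scheme acts freely if `G × X → X × X`, `(g, x) ↦ (g x, x)`, is a closed immersion; in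
particular, it is then a monomorphism, that is, `G(S)` acts freely on `X(S)` for all `S`. -/
def IsFreeAction : Prop := IsClosedImmersion (lift (actionMap G X) (snd G X)).left

variable {X} {Q : Over base}

/-- `q : X → Q` exhibits `Q` as the quotient `X / G` by a free action: `q` is a principal
`G`-bundle (it is faithfully flat and quasi-compact, and `G × X → X ×_Q X`, `(g, x) ↦ (g x, x)` is
an isomorphism), and it is the categorical quotient (the coequalizer of the action and the
projection). -/
structure IsFreeQuotient (q : X ⟶ Q) : Prop where
  flat : Flat q.left
  surjective : Surjective q.left
  quasiCompact : QuasiCompact q.left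
  isPullback : IsPullback (actionMap G X) (snd G X) q q
  isCoequalizer : Nonempty (IsColimit (Cofork.ofπ q isPullback.w))

end Quotients

end TropicalToric

end

open TropicalToric

/-
Let `J` be the common initial ideal of `I` over the relative interior of `σ`. The key point is that
`J` is generated by the orbit parts (the sums of the terms with exponents in `σ^⊥`) of the elements
of `I ∩ ℂ[σ^∨]`. Then `in_σ X` is the preimage of `X̄ ∩ O_σ` under `T_N → O_σ`, and since `σ^⊥` is a
direct summand of `M` with complement `Hom(⟨σ⟩, ℤ)`, we have `T_N ≅ T_⟨σ⟩ × O_σ` and the bundle is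
trivial.

For the key point, `J` has generators with exponents in `σ^⊥`, and each of them has to be completed
to an element of `I` by terms with exponents in `σ^∨ ∖ σ^⊥`. As the space of orders on `M` is
compact, there is a finite `U ⊆ I` whose initial forms generate every `in_u I`. If no difference of
exponents of an element of `U` changes sign on the cone, dividing the elements of `U` by their least
monomials gives the completions. Otherwise cut the cone by the hyperplane on which the difference
vanishes and complete the generators over the two halves. The two completions differ, modulo
elements of `I` positive on one of the halves, by something that vanishes to arbitrarily high order
along the section. Modulo those elements only a finite module is left, so Krull's intersection
theorem shows that the completions can be corrected to agree.
-/

noncomputable section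

namespace TropicalToric

open scoped AddMonoidAlgebra
open AddMonoidAlgebra (single)

/-! ### Laurent polynomials and their initial forms -/

section Support

variable {R M : Type*} [Semiring R]

/-- The elements of the monoid algebra all of whose exponents lie in `S`, the counterpart of
`Finsupp.supported`. -/
def supportedIn (S : Set M) : Submodule R R[M] where
  carrier := {f | ∀ m, f.coeff m ≠ 0 → m ∈ S}
  zero_mem' := by simp
  add_mem' := by
    intro f g hf hg m hm
    by_cases h : f.coeff m = 0
    · exact hg m fun h' => hm (by simp [h, h'])
    · exact hf m h
  smul_mem' := by
    intro c f hf m hm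
    exact hf m fun h => hm (by simp [h])

lemma supportedIn_mono {S T : Set M} (h : S ⊆ T) :
    (supportedIn S : Submodule R R[M]) ≤ supportedIn T :=
  fun _ hf m hm => h (hf m hm)

lemma mem_supportedIn_univ (f : R[M]) : f ∈ supportedIn Set.univ := fun _ _ => trivial

lemma single_mem_supportedIn {S : Set M} {m : M} (hm : m ∈ S) (c : R) :
    single m c ∈ supportedIn S := by
  classical
  intro m' hm'
  rw [AddMonoidAlgebra.coeff_single, Finsupp.single_apply] at hm'
  split_ifs at hm' with h
  · exact h ▸ hm
  · exact absurd rfl hm'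

lemma mem_of_forall_single_mem {W : AddSubmonoid R[M]} {f : R[M]}
    (h : ∀ m, f.coeff m ≠ 0 → single m (f.coeff m) ∈ W) : f ∈ W := by
  rw [← AddMonoidAlgebra.sum_coeff_single f]
  exact sum_mem fun m hm => h m (Finsupp.mem_support_iff.1 hm)

open Classical in
/-- The sum of the terms whose exponents lie in `S`, the counterpart of `Finsupp.filter`. -/
def part (S : Set M) : R[M] →ₗ[R] R[M] where
  toFun f := .ofCoeff (f.coeff.filter (· ∈ S))
  map_add' f g := by
    ext m
    simp [Finsupp.filter_add]
  map_smul' c f := by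
    ext m
    simp [Finsupp.filter_smul]

open Classical in
lemma coeff_part (S : Set M) (f : R[M]) (m : M) :
    (part S f).coeff m = if m ∈ S then f.coeff m else 0 :=
  Finsupp.filter_apply _ _ _

lemma coeff_part_ne_zero {S : Set M} {f : R[M]} {m : M} :
    (part S f).coeff m ≠ 0 ↔ m ∈ S ∧ f.coeff m ≠ 0 := by
  simp [coeff_part]

lemma part_add_part_compl (S : Set M) (f : R[M]) : part S f + part Sᶜ f = f := by
  ext m
  by_cases hm : m ∈ S <;> simp [coeff_part, hm]

lemma part_congr {S T : Set M} {f : R[M]} (h : ∀ m, f.coeff m ≠ 0 → (m ∈ S ↔ m ∈ T)) :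
    part S f = part T f := by
  ext m
  by_cases hm : f.coeff m = 0
  · simp [coeff_part, hm]
  · by_cases hS : m ∈ S
    · simp [coeff_part, hS, (h m hm).1 hS]
    · simp [coeff_part, hS, mt (h m hm).2 hS]

lemma part_eq_self {S : Set M} {f : R[M]} (h : f ∈ supportedIn S) : part S f = f := by
  ext m
  by_cases hm : f.coeff m = 0
  · simp [coeff_part, hm]
  · simp [coeff_part, h m hm]

lemma part_eq_zero {S T : Set M} {f : R[M]} (h : f ∈ supportedIn T) (hST : Disjoint T S) :
    part S f = 0 := by
  ext m
  by_contra hm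
  obtain ⟨hS, hf⟩ := coeff_part_ne_zero.1 hm
  exact Set.disjoint_left.1 hST (h m hf) hS

lemma part_mem_supportedIn {S T : Set M} {f : R[M]} (h : f ∈ supportedIn T) :
    part S f ∈ supportedIn (T ∩ S) := fun m hm =>
  ⟨h m (coeff_part_ne_zero.1 hm).2, (coeff_part_ne_zero.1 hm).1⟩

lemma sub_part_mem_supportedIn {R : Type*} [Ring R] {S T : Set M} {f : R[M]}
    (h : f ∈ supportedIn T) : f - part S f ∈ supportedIn (T \ S) := by
  rw [sub_eq_of_eq_add' (part_add_part_compl S f).symm]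
  exact part_mem_supportedIn h

lemma mul_mem_supportedIn [Add M] {S T W : Set M} {f g : R[M]} (hf : f ∈ supportedIn S)
    (hg : g ∈ supportedIn T) (h : ∀ a ∈ S, ∀ b ∈ T, a + b ∈ W) : f * g ∈ supportedIn W := by
  classical
  intro m hm
  obtain ⟨a, ha, b, hb, rfl⟩ := Finset.mem_add.1
    (AddMonoidAlgebra.support_coeff_mul_subset f g (Finsupp.mem_support_iff.2 hm))
  exact h a (hf a (Finsupp.mem_support_iff.1 ha)) b (hg b (Finsupp.mem_support_iff.1 hb))

lemma part_mul [Add M] {S P : Set M} {c g : R[M]} (hg : g ∈ supportedIn P)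
    (hS : ∀ m, ∀ p ∈ P, m + p ∈ S ↔ m ∈ S) : part S (c * g) = part S c * g := by
  have inside : part S c * g ∈ supportedIn S :=
    mul_mem_supportedIn (part_mem_supportedIn (mem_supportedIn_univ c)) hg
      fun a ha b hb => (hS a b hb).2 ha.2
  have outside : part Sᶜ c * g ∈ supportedIn Sᶜ :=
    mul_mem_supportedIn (part_mem_supportedIn (mem_supportedIn_univ c)) hg
      fun a ha b hb h => ha.2 ((hS a b hb).1 h)
  conv_lhs => rw [← part_add_part_compl S c, add_mul, map_add, part_eq_self inside,
    part_eq_zero outside disjoint_compl_left, add_zero]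

lemma coeff_single_mul [AddCommGroup M] (m a : M) (c : R) (f : R[M]) :
    (single m c * f).coeff a = c * f.coeff (a - m) := by
  rw [AddMonoidAlgebra.coeff_single_mul_apply, neg_add_eq_sub]

end Support

section InitialForm

variable {M : Type} [AddCommGroup M] {w : M →+ ℝ} {f : ℂ[M]}

lemma initialForm_zero (w : M →+ ℝ) : initialForm w (0 : ℂ[M]) = 0 := by
  ext; simp [initialForm]

lemma initialForm_eq_part {m₀ : M} (h₀ : f.coeff m₀ ≠ 0) (h : ∀ m, f.coeff m ≠ 0 → w m₀ ≤ w m) :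
    initialForm w f = part {m | w m = w m₀} f := by
  classical
  ext m
  rw [coeff_part, initialForm, AddMonoidAlgebra.coeff_ofCoeff, Finsupp.filter_apply]
  by_cases hm : f.coeff m = 0
  · simp [hm]
  · refine if_congr ⟨fun H => le_antisymm (H m₀ (by simpa using h₀)) (h m hm), fun H m' hm' => ?_⟩
      rfl rfl
    rw [show w m = w m₀ from H]
    exact h m' (by simpa using hm')

lemma exists_initialForm_eq_part (w : M →+ ℝ) (hf : f ≠ 0) :
    ∃ m₀, f.coeff m₀ ≠ 0 ∧ (∀ m, f.coeff m ≠ 0 → w m₀ ≤ w m) ∧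
      initialForm w f = part {m | w m = w m₀} f := by
  have hne : f.coeff.support.Nonempty := by simpa [Finsupp.support_nonempty_iff] using hf
  obtain ⟨m₀, hm₀, h⟩ := Finset.exists_min_image _ w hne
  have h₀ : f.coeff m₀ ≠ 0 := by simpa using hm₀
  have hmin : ∀ m, f.coeff m ≠ 0 → w m₀ ≤ w m := fun m hm => h m (by simpa using hm)
  exact ⟨m₀, h₀, hmin, initialForm_eq_part h₀ hmin⟩

lemma initialForm_single_mul (w : M →+ ℝ) (a : M) {c : ℂ} (hc : c ≠ 0) (f : ℂ[M]) :
    initialForm w (single a c * f) = single a c * initialForm w f := by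
  by_cases hf : f = 0
  · simp [hf, initialForm_zero]
  obtain ⟨m₀, h₀, hmin, hinit⟩ := exists_initialForm_eq_part w hf
  have h₀' : (single a c * f).coeff (a + m₀) ≠ 0 := by simpa [coeff_single_mul, hc] using h₀
  rw [hinit, initialForm_eq_part h₀' fun m hm => ?_]
  · ext m
    simp only [coeff_single_mul, coeff_part, Set.mem_ofPred_eq, map_add, map_sub,
      sub_eq_iff_eq_add', mul_ite, mul_zero]
  · rw [coeff_single_mul] at hm
    have := hmin _ (right_ne_zero_of_mul hm)
    rw [map_sub] at this
    rw [map_add]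
    linarith

lemma part_level_eq_zero_or_initialForm {c : ℝ} (h : ∀ m, f.coeff m ≠ 0 → c ≤ w m) :
    part {m | w m = c} f = 0 ∨ part {m | w m = c} f = initialForm w f := by
  by_cases hc : ∃ m, f.coeff m ≠ 0 ∧ w m = c
  · obtain ⟨m, hm, rfl⟩ := hc
    exact Or.inr (initialForm_eq_part hm h).symm
  · push Not at hc
    exact Or.inl (part_eq_zero (T := {m | f.coeff m ≠ 0}) (fun m hm => hm)
      (Set.disjoint_left.2 hc))

lemma part_level_mem_initialIdeal {I : Ideal ℂ[M]} (hf : f ∈ I) {c : ℝ}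
    (h : ∀ m, f.coeff m ≠ 0 → c ≤ w m) : part {m | w m = c} f ∈ initialIdeal w I := by
  rcases part_level_eq_zero_or_initialForm h with h | h
  · rw [h]
    exact zero_mem _
  · rw [h]
    exact Ideal.subset_span ⟨f, hf, rfl⟩

end InitialForm

/-! ### Orders on the exponents and universal bases -/

section Orders

variable {K M : Type*} [Field K] [AddCommGroup M]

/-- `p` is the indicator function of the set of positive elements of a total group order on `M`.
Orders are encoded by functions to `Bool` because `M → Bool` is a compact space. -/
structure IsPositiveCone (p : M → Bool) : Prop where
  not_zero : p 0 = false
  add : ∀ a b, p a = true → p b = true → p (a + b) = true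
  total : ∀ a, a = 0 ∨ p a = true ∨ p (-a) = true

/-- `m` is the smallest exponent of `f` for the order with positive cone `p`. -/
def IsLeading (p : M → Bool) (f : K[M]) (m : M) : Prop :=
  f.coeff m ≠ 0 ∧ ∀ m', f.coeff m' ≠ 0 → m' = m ∨ p (m' - m) = true

/-- The smallest exponents of the non-zero elements of a subspace, for the order with positive
cone `p`. -/
def leadingSet (p : M → Bool) (V : Submodule K K[M]) : Set M :=
  {m | ∃ f ∈ V, IsLeading p f m}

lemma isCompact_setOf_isPositiveCone : IsCompact {p : M → Bool | IsPositiveCone p} := by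
  have h : {p : M → Bool | IsPositiveCone p} =
      {p | p 0 = false} ∩ (⋂ a, ⋂ b, {p | p a = true → p b = true → p (a + b) = true}) ∩
        ⋂ a, {p | a = 0 ∨ p a = true ∨ p (-a) = true} := by
    ext p
    simp only [Set.mem_inter_iff, Set.mem_iInter, Set.mem_ofPred_eq]
    exact ⟨fun h => ⟨⟨h.1, h.2⟩, h.3⟩, fun h => ⟨h.1.1, h.1.2, h.2⟩⟩
  rw [h]
  refine IsClosed.isCompact (IsClosed.inter (IsClosed.inter ?_ ?_) ?_)
  · exact (isClosed_discrete {b : Bool | b = false}).preimage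
      (f := fun p : M → Bool => p 0) (by fun_prop)
  · refine isClosed_iInter fun a => isClosed_iInter fun b => ?_
    exact (isClosed_discrete
      {x : Bool × Bool × Bool | x.1 = true → x.2.1 = true → x.2.2 = true}).preimage
      (f := fun p : M → Bool => (p a, p b, p (a + b))) (by fun_prop)
  · refine isClosed_iInter fun a => ?_
    exact (isClosed_discrete {x : Bool × Bool | a = 0 ∨ x.1 = true ∨ x.2 = true}).preimage
      (f := fun p : M → Bool => (p a, p (-a))) (by fun_prop)

lemma IsPositiveCone.isStrictOrder {p : M → Bool} (hp : IsPositiveCone p) :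
    IsStrictOrder M fun a b => p (b - a) = true where
  irrefl a h := by simp [hp.not_zero] at h
  trans a b c hab hbc := by simpa using hp.add _ _ hbc hab

lemma IsPositiveCone.exists_min {p : M → Bool} (hp : IsPositiveCone p) {s : Finset M}
    (hs : s.Nonempty) : ∃ m ∈ s, ∀ m' ∈ s, m' = m ∨ p (m' - m) = true := by
  have := hp.isStrictOrder
  obtain ⟨a, ha⟩ := hs
  obtain ⟨⟨m, hm⟩, -, hmin⟩ := (s.finite_toSet.wellFoundedOn
    (r := fun a b => p (b - a) = true)).has_min Set.univ ⟨⟨a, ha⟩, trivial⟩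
  refine ⟨m, hm, fun m' hm' => ?_⟩
  rcases hp.total (m' - m) with h | h | h
  · exact Or.inl (sub_eq_zero.1 h)
  · exact Or.inr h
  · exact absurd (by simpa using h) (hmin ⟨m', hm'⟩ trivial)

lemma IsPositiveCone.exists_isLeading {p : M → Bool} (hp : IsPositiveCone p) {f : K[M]}
    (hf : f ≠ 0) : ∃ m, IsLeading p f m := by
  have hne : f.coeff.support.Nonempty := by simpa [Finsupp.support_nonempty_iff] using hf
  obtain ⟨m, hm, h⟩ := hp.exists_min hne
  exact ⟨m, by simpa using hm, fun m' hm' => h m' (by simpa using hm')⟩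

lemma IsLeading.single_mul {p : M → Bool} {f : K[M]} {m : M} (h : IsLeading p f m) (a : M) {c : K}
    (hc : c ≠ 0) : IsLeading p (single a c * f) (a + m) := by
  refine ⟨by simpa [coeff_single_mul, hc] using h.1, fun m' hm' => ?_⟩
  rw [coeff_single_mul] at hm'
  rcases h.2 (m' - a) (right_ne_zero_of_mul hm') with h | h
  · exact Or.inl (by rw [← h, add_sub_cancel])
  · exact Or.inr (by rwa [← sub_sub])

lemma leadingSet_subset {p : M → Bool} {V : Submodule K K[M]} {S : Set M}
    (hV : V ≤ supportedIn S) : leadingSet p V ⊆ S := by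
  rintro m ⟨f, hf, h⟩
  exact hV hf m h.1

lemma IsPositiveCone.linearIndependent_of_isLeading {p : M → Bool} (hp : IsPositiveCone p)
    {ι : Type*} [Finite ι] {f : ι → K[M]} {m : ι → M} (hm : Function.Injective m)
    (hf : ∀ i, IsLeading p (f i) (m i)) : LinearIndependent K f := by
  classical
  have := hp.isStrictOrder
  have := Fintype.ofFinite ι
  rw [Fintype.linearIndependent_iff]
  intro c hc
  by_contra! ⟨i₁, hi₁⟩
  obtain ⟨_, hmem, hmin⟩ := hp.exists_min (s := (Finset.univ.filter fun i => c i ≠ 0).image m)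
    ⟨m i₁, Finset.mem_image_of_mem m (by simpa using hi₁)⟩
  obtain ⟨i, hi, rfl⟩ := Finset.mem_image.1 hmem
  have coeff_sum : ∑ k, c k * (f k).coeff (m i) = 0 := by
    simpa [AddMonoidAlgebra.coeff_sum, Finsupp.finsetSum_apply] using
      congrArg (fun g : K[M] => g.coeff (m i)) hc
  rw [Finset.sum_eq_single i _ (by simp)] at coeff_sum
  · exact mul_ne_zero (Finset.mem_filter.1 hi).2 (hf i).1 coeff_sum
  · intro k _ hk
    by_contra hne
    have hk_mem : m k ∈ (Finset.univ.filter fun i => c i ≠ 0).image m :=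
      Finset.mem_image_of_mem m (by simpa using left_ne_zero_of_mul hne)
    have hik : p (m k - m i) = true := (hmin _ hk_mem).resolve_left fun h => hk (hm h)
    have hki : p (m i - m k) = true :=
      ((hf k).2 _ (right_ne_zero_of_mul hne)).resolve_left fun h => hk (hm h.symm)
    exact asymm (r := fun a b => p (b - a) = true) hik hki

lemma IsPositiveCone.ncard_leadingSet {p : M → Bool} (hp : IsPositiveCone p)
    {V : Submodule K K[M]} {S : Set M} (hS : S.Finite) (hV : V ≤ supportedIn S) :
    (leadingSet p V).ncard = Module.finrank K V := by
  have hfin : (leadingSet p V).Finite := hS.subset (leadingSet_subset hV)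
  have : Fintype (leadingSet p V) := hfin.fintype
  let φ : V →ₗ[K] (leadingSet p V → K) :=
    { toFun := fun f m => f.1.coeff m.1
      map_add' := fun f g => by ext; simp
      map_smul' := fun c f => by ext; simp }
  have hφ : Function.Injective φ := by
    rw [← LinearMap.ker_eq_bot, LinearMap.ker_eq_bot']
    intro f hf
    by_contra hne
    obtain ⟨m, hm⟩ := hp.exists_isLeading (f := f.1) (fun h => hne (Subtype.ext h))
    exact hm.1 (congrFun hf ⟨m, f.1, f.2, hm⟩)
  have : FiniteDimensional K V := FiniteDimensional.of_injective φ hφ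
  choose F hFV hF using fun m : leadingSet p V => m.2
  have hli : LinearIndependent K fun m => (⟨F m, hFV m⟩ : V) :=
    .of_comp V.subtype (hp.linearIndependent_of_isLeading Subtype.val_injective hF)
  rw [Set.ncard_eq_toFinset_card', Set.toFinset_card]
  exact le_antisymm hli.fintype_card_le_finrank
    (by simpa using LinearMap.finrank_le_finrank_of_injective hφ)

lemma leadingSet_eq_of_subset {p p' : M → Bool} (hp : IsPositiveCone p) (hp' : IsPositiveCone p')
    {V : Submodule K K[M]} {S : Set M} (hS : S.Finite) (hV : V ≤ supportedIn S)
    (h : leadingSet p V ⊆ leadingSet p' V) : leadingSet p V = leadingSet p' V :=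
  Set.eq_of_subset_of_ncard_le h
    (by rw [hp.ncard_leadingSet hS hV, hp'.ncard_leadingSet hS hV])
    (hS.subset (leadingSet_subset hV))

end Orders

section SumsOf

variable {M : Type*} [AddCommMonoid M] {ι : Type*} [Fintype ι]

/-- The sum of the generators `e i`, each taken `a i` times. -/
def combination (e : ι → M) (a : ι → ℕ) : M := ∑ i, a i • e i

/-- The sums of exactly `d` of the generators `e i`: the exponents of degree `d` for the grading
of the polynomial ring with one variable for each generator. -/
def sumsOf (e : ι → M) (d : ℕ) : Set M := {m | ∃ a : ι → ℕ, ∑ i, a i = d ∧ combination e a = m}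

lemma combination_add (e : ι → M) (a b : ι → ℕ) :
    combination e (a + b) = combination e a + combination e b := by
  simp [combination, add_smul, Finset.sum_add_distrib]

lemma sumsOf_finite (e : ι → M) (d : ℕ) : (sumsOf e d).Finite := by
  classical
  have : ((Set.Iic (fun _ : ι => d)).image (combination e)).Finite := (Set.finite_Iic _).image _
  refine this.subset ?_
  rintro _ ⟨a, rfl, rfl⟩
  exact ⟨a, fun i => Finset.single_le_sum (fun _ _ => Nat.zero_le _) (Finset.mem_univ i), rfl⟩

lemma mem_sumsOf_one (e : ι → M) (i : ι) : e i ∈ sumsOf e 1 := by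
  classical
  exact ⟨Pi.single i 1, by simp [Finset.sum_pi_single'], by simp [combination, Pi.single_apply]⟩

lemma add_mem_sumsOf {e : ι → M} {d d' : ℕ} {m m' : M} (h : m ∈ sumsOf e d)
    (h' : m' ∈ sumsOf e d') : m + m' ∈ sumsOf e (d + d') := by
  obtain ⟨a, rfl, rfl⟩ := h
  obtain ⟨b, rfl, rfl⟩ := h'
  exact ⟨a + b, by simp [Finset.sum_add_distrib], combination_add e a b⟩

lemma monotone_sumsOf {e : ι → M} {i : ι} (hi : e i = 0) : Monotone (sumsOf e) :=
  monotone_nat_of_le_succ fun _ m hm => by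
    simpa [hi] using add_mem_sumsOf hm (mem_sumsOf_one e i)

lemma exists_mem_sumsOf {e : ι → M} (he : AddSubmonoid.closure (Set.range e) = ⊤) (m : M) :
    ∃ d, m ∈ sumsOf e d := by
  have hm : m ∈ AddSubmonoid.closure (Set.range e) := he ▸ AddSubmonoid.mem_top m
  induction hm using AddSubmonoid.closure_induction with
  | mem x hx =>
    obtain ⟨i, rfl⟩ := hx
    exact ⟨1, mem_sumsOf_one e i⟩
  | zero => exact ⟨0, 0, by simp, by simp [combination]⟩
  | add x y _ _ hx hy =>
    obtain ⟨d, hd⟩ := hx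
    obtain ⟨d', hd'⟩ := hy
    exact ⟨_, add_mem_sumsOf hd hd'⟩

lemma exists_forall_mem_supportedIn_sumsOf (R : Type*) [Semiring R] (M : Type) [AddCommMonoid M]
    [AddMonoid.FG M] :
    ∃ (ι : Type) (_ : Fintype ι) (e : ι → M), ∀ f : R[M], ∃ d, f ∈ supportedIn (sumsOf e d) := by
  obtain ⟨S, hS⟩ := AddMonoid.fg_def.1 ‹AddMonoid.FG M›
  let e : Option S → M := fun i => i.elim 0 Subtype.val
  have he : AddSubmonoid.closure (Set.range e) = ⊤ :=
    top_le_iff.1 (hS.ge.trans (AddSubmonoid.closure_mono fun m hm => ⟨some ⟨m, hm⟩, rfl⟩))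
  choose D hD using exists_mem_sumsOf he
  refine ⟨Option S, inferInstance, e, fun f => ⟨∑ m ∈ f.coeff.support, D m, fun m hm => ?_⟩⟩
  exact monotone_sumsOf (i := none) rfl
    (Finset.single_le_sum (fun _ _ => Nat.zero_le _) (by simpa using hm)) (hD m)

end SumsOf

section OrderBasis

variable {K M ι : Type*} [Field K] [AddCommGroup M] [Fintype ι] {e : ι → M} {I : Ideal K[M]}
  {p p' : M → Bool} {G G' : Set K[M]}

/-- The elements of `I` whose exponents are sums of `d` of the generators `e i`. -/
def idealOfDegree (e : ι → M) (I : Ideal K[M]) (d : ℕ) : Submodule K K[M] :=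
  supportedIn (sumsOf e d) ⊓ I.restrictScalars K

/-- A graded analogue of a Gröbner basis for the order with positive cone `p`: the smallest
exponents of the elements of `G` generate all the smallest exponents of elements of `I`, compatibly
with the degrees. The degrees are needed because the order need not be a well-order. -/
def IsOrderBasis (e : ι → M) (I : Ideal K[M]) (p : M → Bool) (G : Set K[M]) : Prop :=
  ∀ d, ∀ m ∈ leadingSet p (idealOfDegree e I d), ∃ g ∈ G, ∃ d₁ d₂ m₁ m₂,
    g ∈ idealOfDegree e I d₁ ∧ IsLeading p g m₁ ∧ m₂ ∈ sumsOf e d₂ ∧ d₂ + d₁ = d ∧ m₂ + m₁ = m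

lemma single_mul_mem_idealOfDegree {d d' : ℕ} {f : K[M]} (hf : f ∈ idealOfDegree e I d) {m : M}
    (hm : m ∈ sumsOf e d') (c : K) : single m c * f ∈ idealOfDegree e I (d' + d) :=
  ⟨mul_mem_supportedIn (single_mem_supportedIn hm c) hf.1 fun _ h _ h' => add_mem_sumsOf h h',
    I.mul_mem_left _ hf.2⟩

lemma IsOrderBasis.mono (h : IsOrderBasis e I p G) (hG : G ⊆ G') : IsOrderBasis e I p G' := by
  intro d m hm
  obtain ⟨g, hg, h⟩ := h d m hm
  exact ⟨g, hG hg, h⟩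

-- Dickson's lemma, applied to the vectors `a : ι → ℕ` for which `combination e a` is leading.
lemma exists_finset_isOrderBasis (e : ι → M) (I : Ideal K[M]) (p : M → Bool) :
    ∃ G : Finset K[M], (G : Set K[M]) ⊆ I ∧ IsOrderBasis e I p G := by
  classical
  let L : Set (ι → ℕ) := {a | combination e a ∈ leadingSet p (idealOfDegree e I (∑ i, a i))}
  have hfin : {a | Minimal (· ∈ L) a}.Finite :=
    (setOfPred_minimal_antichain _).finite_of_partiallyWellOrderedOn
      (Set.isPWO_of_wellQuasiOrderedLE _)
  have hex : ∀ a : {a | Minimal (· ∈ L) a}, ∃ f ∈ idealOfDegree e I (∑ i, a.1 i),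
      IsLeading p f (combination e a.1) := fun a => a.2.1
  choose F hFV hF using hex
  have : Fintype {a | Minimal (· ∈ L) a} := hfin.fintype
  refine ⟨Finset.univ.image F, ?_, ?_⟩
  · intro f hf
    obtain ⟨a, -, rfl⟩ := Finset.mem_image.1 (Finset.mem_coe.1 hf)
    exact (hFV a).2
  · rintro d m ⟨f, hf, hm⟩
    obtain ⟨a, rfl, rfl⟩ := hf.1 m hm.1
    have haL : a ∈ L := ⟨f, hf, hm⟩
    obtain ⟨b, hba, hb⟩ := exists_minimal_le_of_wellFoundedLT (· ∈ L) a haL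
    refine ⟨F ⟨b, hb⟩, by simp, ∑ i, b i, ∑ i, (a - b) i, _, combination e (a - b), hFV ⟨b, hb⟩,
      hF ⟨b, hb⟩, ⟨_, rfl, rfl⟩, ?_, ?_⟩
    · rw [← Finset.sum_add_distrib]
      exact Finset.sum_congr rfl fun i _ => Nat.sub_add_cancel (hba i)
    · rw [← combination_add, tsub_add_cancel_of_le hba]

lemma IsOrderBasis.of_agree (hp : IsPositiveCone p) (hp' : IsPositiveCone p')
    (h : IsOrderBasis e I p G) (hG : ∀ g ∈ G, ∀ m m', g.coeff m ≠ 0 → g.coeff m' ≠ 0 →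
      p (m' - m) = p' (m' - m)) : IsOrderBasis e I p' G := by
  have hlead : ∀ g ∈ G, ∀ m, IsLeading p g m → IsLeading p' g m := fun g hg m hm =>
    ⟨hm.1, fun m' hm' => (hm.2 m' hm').imp_right fun h => by rw [← hG g hg m m' hm.1 hm', h]⟩
  have hsub : ∀ d, leadingSet p (idealOfDegree e I d) ⊆ leadingSet p' (idealOfDegree e I d) := by
    intro d m hm
    obtain ⟨g, hg, d₁, d₂, m₁, m₂, h1, h2, h3, rfl, rfl⟩ := h d m hm
    exact ⟨_, single_mul_mem_idealOfDegree h1 h3 1, (hlead g hg _ h2).single_mul _ one_ne_zero⟩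
  intro d m hm
  rw [← leadingSet_eq_of_subset hp hp' (sumsOf_finite e d)
    (V := idealOfDegree e I d) inf_le_left (hsub d)] at hm
  obtain ⟨g, hg, d₁, d₂, m₁, m₂, h1, h2, h3⟩ := h d m hm
  exact ⟨g, hg, d₁, d₂, m₁, m₂, h1, hlead g hg _ h2, h3⟩

-- An order basis for `p` is one for all the orders near `p`; the space of orders is compact.
lemma exists_finset_forall_isOrderBasis (e : ι → M) (I : Ideal K[M]) :
    ∃ U : Finset K[M], (U : Set K[M]) ⊆ I ∧ ∀ p, IsPositiveCone p → IsOrderBasis e I p U := by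
  classical
  choose G hGI hG using exists_finset_isOrderBasis e I
  let N : (M → Bool) → Set (M → Bool) := fun p =>
    ⋂ g ∈ G p, ⋂ m ∈ g.coeff.support, ⋂ m' ∈ g.coeff.support, {p' | p (m' - m) = p' (m' - m)}
  have hN : ∀ p, N p ∈ nhds p := fun p =>
    (Filter.biInter_finset_mem _).2 fun g _ => (Filter.biInter_finset_mem _).2 fun m _ =>
      (Filter.biInter_finset_mem _).2 fun m' _ =>
        ((isOpen_discrete {b | p (m' - m) = b}).preimage
          (continuous_apply (m' - m))).mem_nhds rfl
  obtain ⟨t, ht, hcov⟩ := isCompact_setOf_isPositiveCone.elim_nhds_subcover N fun p _ => hN p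
  refine ⟨t.biUnion G, ?_, fun p' hp' => ?_⟩
  · intro f hf
    obtain ⟨p, -, hf⟩ := Finset.mem_biUnion.1 (Finset.mem_coe.1 hf)
    exact hGI p hf
  · obtain ⟨p, hpt, hp⟩ := Set.mem_iUnion₂.1 (hcov hp')
    refine ((hG p).of_agree (ht p hpt) hp' fun g hg m m' hm hm' => ?_).mono
      (Finset.coe_subset.2 (Finset.subset_biUnion_of_mem G hpt))
    simp only [N, Set.mem_iInter] at hp
    exact hp g hg m (by simpa using hm) m' (by simpa using hm')

lemma IsOrderBasis.exists_sub_single_mul (hG : IsOrderBasis e I p G)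
    {d : ℕ} {f : K[M]} (hf : f ∈ idealOfDegree e I d) {m₀ : M} (hm₀ : IsLeading p f m₀) :
    ∃ g ∈ G, ∃ a, ∃ c ≠ 0, IsLeading p (single a c * g) m₀ ∧
      f - single a c * g ∈ idealOfDegree e I d ∧
      ∀ m, (f - single a c * g).coeff m ≠ 0 → p (m - m₀) = true := by
  obtain ⟨g, hg, d₁, d₂, m₁, a, hgd, hlead, ha, rfl, rfl⟩ := hG d m₀ ⟨f, hf, hm₀⟩
  have hc : f.coeff (a + m₁) / g.coeff m₁ ≠ 0 := div_ne_zero hm₀.1 hlead.1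
  have hlead' := hlead.single_mul a hc
  refine ⟨g, hg, a, _, hc, hlead', sub_mem hf (single_mul_mem_idealOfDegree hgd ha _),
    fun m hm => ?_⟩
  have hne : m ≠ a + m₁ := by
    rintro rfl
    simp [div_mul_cancel₀ _ hlead.1] at hm
  by_cases hfm : f.coeff m = 0
  · exact (hlead'.2 m fun h => hm (by simp [hfm, h])).resolve_left hne
  · exact (hm₀.2 m hfm).resolve_left hne

end OrderBasis

section UniversalBasis

variable {M : Type} [AddCommGroup M] {ι : Type*} [Fintype ι]

lemma IsLeading.weight_le {p : M → Bool} {w : M →+ ℝ} (hw : ∀ m, p m = true → 0 ≤ w m) {f : ℂ[M]}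
    {m₀ : M} (h : IsLeading p f m₀) {m : M} (hm : f.coeff m ≠ 0) : w m₀ ≤ w m := by
  rcases h.2 m hm with rfl | h
  · exact le_rfl
  · simpa using hw _ h

-- Division by `G`: each step raises the smallest exponent, which ranges in a finite set because
-- the degree is fixed.
lemma IsOrderBasis.initialForm_mem {e : ι → M} {I : Ideal ℂ[M]} {p : M → Bool}
    (hp : IsPositiveCone p) {G : Set ℂ[M]} (hG : IsOrderBasis e I p G) {w : M →+ ℝ}
    (hw : ∀ m, p m = true → 0 ≤ w m) {d : ℕ} {f : ℂ[M]} (hf : f ∈ idealOfDegree e I d) :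
    initialForm w f ∈ Ideal.span (initialForm w '' G) := by
  have := hp.isStrictOrder
  have wf : (sumsOf e d).WellFoundedOn (Function.swap fun a b => p (b - a) = true) :=
    (sumsOf_finite e d).wellFoundedOn
  suffices key : ∀ m₀ ∈ sumsOf e d, ∀ f ∈ idealOfDegree e I d, IsLeading p f m₀ →
      initialForm w f ∈ Ideal.span (initialForm w '' G) by
    by_cases hf0 : f = 0
    · simp [hf0, initialForm_zero]
    · obtain ⟨m₀, hm₀⟩ := hp.exists_isLeading hf0
      exact key m₀ (hf.1 m₀ hm₀.1) f hf hm₀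
  intro m₀ hm₀
  apply wf.induction hm₀
  intro m₀ _ ih f hf hlead
  obtain ⟨g, hg, a, c, hc, hglead, hr, hrlt⟩ := hG.exists_sub_single_mul hf hlead
  set r := f - single a c * g
  have hr_weight : ∀ m, r.coeff m ≠ 0 → w m₀ ≤ w m := fun m hm => by simpa using hw _ (hrlt m hm)
  have hsplit : initialForm w f = part {m | w m = w m₀} r + single a c * initialForm w g := by
    rw [← initialForm_single_mul w a hc, initialForm_eq_part hlead.1 fun m => hlead.weight_le hw,
      initialForm_eq_part hglead.1 fun m => hglead.weight_le hw, ← map_add, sub_add_cancel]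
  rw [hsplit]
  refine add_mem ?_ (Ideal.mul_mem_left _ _ (Ideal.subset_span ⟨g, hg, rfl⟩))
  rcases part_level_eq_zero_or_initialForm hr_weight with h | h
  · rw [h]
    exact zero_mem _
  rw [h]
  by_cases hr0 : r = 0
  · simp [hr0, initialForm_zero]
  · obtain ⟨m₁, hm₁⟩ := hp.exists_isLeading hr0
    exact ih m₁ (hr.1 m₁ hm₁.1) (hrlt m₁ hm₁.1) r hr hm₁

-- Powers of a transcendental number are linearly independent over `ℤ`.
lemma exists_pos_forall_sum_mul_eq_zero (s : Finset (M →+ ℤ)) :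
    ∃ c : (M →+ ℤ) → ℝ, (∀ n, 0 < c n) ∧
      ∀ m, ∑ n ∈ s, c n * n m = 0 → ∀ n ∈ s, n m = 0 := by
  obtain ⟨x, hx : Transcendental ℤ x, hx0 : 0 < x⟩ :=
    ((Algebraic.countable ℤ ℝ).dense_compl ℝ).exists_mem_open isOpen_Ioi
      ⟨1, Set.mem_Ioi.2 one_pos⟩
  obtain ⟨idx, hidx⟩ := Set.countable_iff_exists_injOn.1 s.countable_toSet
  refine ⟨fun n => x ^ idx n, fun n => pow_pos hx0 _, fun m hm n hn => ?_⟩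
  have hpoly : (∑ n ∈ s, Polynomial.monomial (idx n) (n m) : Polynomial ℤ) = 0 := by
    by_contra hne
    refine hx ⟨_, hne, ?_⟩
    rw [map_sum, ← hm]
    refine Finset.sum_congr rfl fun n _ => ?_
    rw [Polynomial.aeval_monomial, mul_comm]
    simp
  have := congrArg (fun q => Polynomial.coeff q (idx n)) hpoly
  simp only [Polynomial.finsetSum_coeff, Polynomial.coeff_monomial, Polynomial.coeff_zero] at this
  rw [Finset.sum_eq_single n] at this
  · simpa using this
  · intro k hk hkn
    rw [if_neg fun h => hkn (hidx hk hn h)]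
  · exact fun h => absurd hn h

lemma exists_injective_weight (M : Type) [AddCommGroup M] [Module.Free ℤ M] [Module.Finite ℤ M] :
    ∃ u : M →+ ℝ, Function.Injective u := by
  classical
  let b := Module.Free.chooseBasis ℤ M
  let s : Finset (M →+ ℤ) := Finset.univ.image fun i => (b.coord i).toAddMonoidHom
  obtain ⟨c, -, hc⟩ := exists_pos_forall_sum_mul_eq_zero s
  refine ⟨∑ n ∈ s, (AddMonoidHom.mulLeft (c n)).comp (latticeToReal n), ?_⟩
  rw [injective_iff_map_eq_zero]
  intro m hm
  have h := hc m (by simpa [latticeToReal] using hm)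
  refine b.ext_elem fun i => ?_
  simpa using h _ (Finset.mem_image_of_mem _ (Finset.mem_univ i))

lemma exists_isPositiveCone_of_weight [Module.Free ℤ M] [Module.Finite ℤ M] (w : M →+ ℝ) :
    ∃ p : M → Bool, IsPositiveCone p ∧ ∀ m, p m = true → 0 ≤ w m := by
  classical
  obtain ⟨u, hu⟩ := exists_injective_weight M
  refine ⟨fun m => decide (0 < w m ∨ w m = 0 ∧ 0 < u m), ⟨by simp, fun a b => ?_, fun a => ?_⟩,
    fun m => ?_⟩
  · simp only [decide_eq_true_eq, map_add]
    grind
  · simp only [decide_eq_true_eq, map_neg, ← hu.eq_iff, map_zero]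
    grind
  · simp only [decide_eq_true_eq]
    grind

theorem exists_finset_forall_initialIdeal_eq_span [Module.Free ℤ M] [Module.Finite ℤ M]
    (I : Ideal ℂ[M]) :
    ∃ U : Finset ℂ[M], (U : Set ℂ[M]) ⊆ I ∧
      ∀ w : M →+ ℝ, initialIdeal w I = Ideal.span (initialForm w '' U) := by
  have : AddMonoid.FG M := AddGroup.fg_iff_addMonoid_fg.1 (Module.Finite.iff_addGroup_fg.1 ‹_›)
  obtain ⟨ι, _, e, he⟩ := exists_forall_mem_supportedIn_sumsOf ℂ M
  obtain ⟨U, hUI, hU⟩ := exists_finset_forall_isOrderBasis e I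
  refine ⟨U, hUI, fun w => le_antisymm (Ideal.span_le.2 ?_) (Ideal.span_mono (Set.image_mono hUI))⟩
  rintro _ ⟨f, hf, rfl⟩
  obtain ⟨p, hp, hpw⟩ := exists_isPositiveCone_of_weight w
  obtain ⟨d, hd⟩ := he f
  exact (hU p hp).initialForm_mem hp hpw (d := d) ⟨hd, hf⟩

end UniversalBasis

/-! ### Cutting cones by hyperplanes -/

section Cut

variable {M : Type*} [AddCommGroup M]

/-- The lattice points of the dual of the cone generated by `s`. -/
def nonnegOn (s : Finset (M →+ ℤ)) : AddSubmonoid M where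
  carrier := {m | ∀ n ∈ s, 0 ≤ n m}
  zero_mem' := by simp
  add_mem' := fun ha hb n hn => by rw [map_add]; exact add_nonneg (ha n hn) (hb n hn)

/-- The lattice points orthogonal to the cone generated by `s`. -/
def zeroOn (s : Finset (M →+ ℤ)) : AddSubgroup M where
  carrier := {m | ∀ n ∈ s, n m = 0}
  zero_mem' := by simp
  add_mem' := fun ha hb n hn => by rw [map_add, ha n hn, hb n hn, add_zero]
  neg_mem' := fun ha n hn => by rw [map_neg, ha n hn, neg_zero]

/-- The exponents of the monomials that vanish on the closed orbit of the affine toric variety of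
the cone generated by `s`. -/
def posOn (s : Finset (M →+ ℤ)) : Set M := nonnegOn s \ zeroOn s

variable {s t : Finset (M →+ ℤ)} {m m₀ z : M}

lemma mem_nonnegOn : m ∈ nonnegOn s ↔ ∀ n ∈ s, 0 ≤ n m := Iff.rfl

lemma zeroOn_subset_nonnegOn : (zeroOn s : Set M) ⊆ nonnegOn s := fun _ h n hn => (h n hn).ge

lemma add_mem_zeroOn_iff (hz : z ∈ zeroOn s) : m + z ∈ zeroOn s ↔ m ∈ zeroOn s :=
  (zeroOn s).add_mem_cancel_right hz

lemma add_mem_nonnegOn_iff (hz : z ∈ zeroOn s) : m + z ∈ nonnegOn s ↔ m ∈ nonnegOn s := by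
  simp only [mem_nonnegOn, map_add]
  exact forall₂_congr fun n hn => by rw [hz n hn, add_zero]

lemma add_mem_posOn (hm : m ∈ nonnegOn s) (hz : z ∈ posOn s) : m + z ∈ posOn s := by
  refine ⟨add_mem hm hz.1, fun h => hz.2 fun n hn => ?_⟩
  have hsum := h n hn
  rw [map_add] at hsum
  have := hm n hn
  have := hz.1 n hn
  omega

lemma sum_apply_nonneg (hm : m ∈ nonnegOn s) : 0 ≤ (∑ n ∈ s, n) m := by
  rw [AddMonoidHom.finsetSum_apply]
  exact Finset.sum_nonneg hm

lemma sum_apply_eq_zero_iff (hm : m ∈ nonnegOn s) : (∑ n ∈ s, n) m = 0 ↔ m ∈ zeroOn s := by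
  rw [AddMonoidHom.finsetSum_apply, Finset.sum_eq_zero_iff_of_nonneg hm]
  rfl

lemma sum_apply_eq_zero (hm : m ∈ zeroOn s) : (∑ n ∈ s, n) m = 0 :=
  (sum_apply_eq_zero_iff (zeroOn_subset_nonnegOn hm)).2 hm

lemma sum_apply_pos (hm : m ∈ posOn s) : 0 < (∑ n ∈ s, n) m :=
  (sum_apply_nonneg hm.1).lt_of_ne' (mt (sum_apply_eq_zero_iff hm.1).1 hm.2)

lemma nonnegOn_anti (h : (t : Set (M →+ ℤ)) ⊆ AddSubmonoid.closure (s : Set (M →+ ℤ))) :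
    nonnegOn s ≤ nonnegOn t := fun m hm n hn => by
  replace hn := h hn
  induction hn using AddSubmonoid.closure_induction with
  | mem n hn => exact hm n hn
  | zero => exact le_rfl
  | add a b _ _ ha hb => exact add_nonneg ha hb

lemma zeroOn_anti (h : (t : Set (M →+ ℤ)) ⊆ AddSubmonoid.closure (s : Set (M →+ ℤ))) :
    zeroOn s ≤ zeroOn t := fun m hm n hn => by
  replace hn := h hn
  induction hn using AddSubmonoid.closure_induction with
  | mem n hn => exact hm n hn
  | zero => rfl
  | add a b _ _ ha hb => rw [AddMonoidHom.add_apply, ha, hb, add_zero]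

open Classical in
/-- Generators of the section of the cone generated by `s` by the hyperplane `m₀ = 0`. As in
Fourier–Motzkin elimination, they are the generators on the hyperplane together with the points of
the hyperplane on the segments between generators on its two sides. -/
def middleCut (s : Finset (M →+ ℤ)) (m₀ : M) : Finset (M →+ ℤ) :=
  s.filter (fun n => n m₀ = 0) ∪
    ((s.filter fun n => 0 < n m₀) ×ˢ s.filter fun n => n m₀ < 0).image
      fun x => x.1 m₀ • x.2 - x.2 m₀ • x.1

open Classical in
/-- Generators of the part of the cone generated by `s` on which `m₀ ≥ 0`. -/
def upperCut (s : Finset (M →+ ℤ)) (m₀ : M) : Finset (M →+ ℤ) :=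
  s.filter (fun n => 0 < n m₀) ∪ middleCut s m₀

/-- The hyperplane `m₀ = 0` has points of `s` on both sides. -/
def IsCut (s : Finset (M →+ ℤ)) (m₀ : M) : Prop :=
  (∃ n ∈ s, 0 < n m₀) ∧ ∃ n ∈ s, n m₀ < 0

lemma IsCut.neg (h : IsCut s m₀) : IsCut s (-m₀) := by
  simpa [IsCut] using And.intro h.2 h.1

variable {a b n : M →+ ℤ}

lemma mem_middleCut : n ∈ middleCut s m₀ ↔ (n ∈ s ∧ n m₀ = 0) ∨
    ∃ a ∈ s, ∃ b ∈ s, 0 < a m₀ ∧ b m₀ < 0 ∧ a m₀ • b - b m₀ • a = n := by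
  simp only [middleCut, Finset.mem_union, Finset.mem_image, Finset.mem_product, Finset.mem_filter,
    Prod.exists]
  grind

lemma mem_upperCut : n ∈ upperCut s m₀ ↔ (n ∈ s ∧ 0 < n m₀) ∨ n ∈ middleCut s m₀ := by
  simp [upperCut]

lemma crossing_mem_middleCut (ha : a ∈ s) (hb : b ∈ s) (ha₀ : 0 < a m₀) (hb₀ : b m₀ < 0) :
    a m₀ • b - b m₀ • a ∈ middleCut s m₀ :=
  mem_middleCut.2 (Or.inr ⟨a, ha, b, hb, ha₀, hb₀, rfl⟩)

lemma middleCut_neg : middleCut s (-m₀) = middleCut s m₀ := by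
  ext n
  simp only [mem_middleCut, map_neg, neg_eq_zero, neg_pos, neg_lt_zero, neg_smul, sub_neg_eq_add]
  refine or_congr_right ⟨?_, ?_⟩ <;>
  · rintro ⟨a, ha, b, hb, ha₀, hb₀, rfl⟩
    exact ⟨b, hb, a, ha, hb₀, ha₀, by abel⟩

lemma middleCut_subset_upperCut : middleCut s m₀ ⊆ upperCut s m₀ := fun _ h =>
  mem_upperCut.2 (Or.inr h)

lemma mem_upperCut_of_mem (hn : n ∈ s) (hn₀ : 0 ≤ n m₀) : n ∈ upperCut s m₀ := by
  rcases hn₀.eq_or_lt' with h | h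
  · exact middleCut_subset_upperCut (mem_middleCut.2 (Or.inl ⟨hn, h⟩))
  · exact mem_upperCut.2 (Or.inl ⟨hn, h⟩)

lemma middleCut_subset_closure :
    (middleCut s m₀ : Set (M →+ ℤ)) ⊆ AddSubmonoid.closure (s : Set (M →+ ℤ)) := by
  intro n hn
  rcases mem_middleCut.1 hn with h | ⟨a, ha, b, hb, ha₀, hb₀, rfl⟩
  · exact AddSubmonoid.subset_closure h.1
  · obtain ⟨k, hk⟩ := Int.eq_ofNat_of_zero_le ha₀.le
    obtain ⟨l, hl⟩ := Int.eq_ofNat_of_zero_le (neg_nonneg.2 hb₀.le)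
    rw [sub_eq_add_neg, ← neg_smul, hk, hl]
    exact add_mem (by simpa using nsmul_mem (AddSubmonoid.subset_closure hb) k)
      (by simpa using nsmul_mem (AddSubmonoid.subset_closure ha) l)

lemma upperCut_subset_closure :
    (upperCut s m₀ : Set (M →+ ℤ)) ⊆ AddSubmonoid.closure (s : Set (M →+ ℤ)) := by
  intro n hn
  rcases mem_upperCut.1 hn with h | h
  · exact AddSubmonoid.subset_closure h.1
  · exact middleCut_subset_closure h

lemma nonnegOn_le_upperCut : nonnegOn s ≤ nonnegOn (upperCut s m₀) :=
  nonnegOn_anti upperCut_subset_closure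

variable (s m₀) in
lemma nonnegOn_le_middleCut : nonnegOn s ≤ nonnegOn (middleCut s m₀) :=
  nonnegOn_anti middleCut_subset_closure

lemma zeroOn_le_upperCut : zeroOn s ≤ zeroOn (upperCut s m₀) :=
  zeroOn_anti upperCut_subset_closure

lemma zeroOn_le_middleCut : zeroOn s ≤ zeroOn (middleCut s m₀) :=
  zeroOn_anti middleCut_subset_closure

lemma nonnegOn_upperCut_le_middleCut : nonnegOn (upperCut s m₀) ≤ nonnegOn (middleCut s m₀) :=
  fun _ hm n hn => hm n (middleCut_subset_upperCut hn)

lemma mem_nonnegOn_of_upperCut (h : m ∈ nonnegOn (upperCut s m₀))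
    (h' : m ∈ nonnegOn (upperCut s (-m₀))) : m ∈ nonnegOn s := by
  intro n hn
  rcases le_total 0 (n m₀) with h₀ | h₀
  · exact h n (mem_upperCut_of_mem hn h₀)
  · exact h' n (mem_upperCut_of_mem hn (by simpa using h₀))

lemma mem_nonnegOn_upperCut_or (h : m ∈ nonnegOn (middleCut s m₀)) :
    m ∈ nonnegOn (upperCut s m₀) ∨ m ∈ nonnegOn (upperCut s (-m₀)) := by
  by_contra! hcon
  simp only [mem_nonnegOn, not_forall, mem_upperCut, middleCut_neg, not_le] at hcon
  obtain ⟨⟨a, ha, ham⟩, b, hb, hbm⟩ := hcon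
  obtain ⟨ha, ha₀⟩ := ha.resolve_right fun ha => ham.not_ge (h a ha)
  obtain ⟨hb, hb₀⟩ := hb.resolve_right fun hb => hbm.not_ge (h b hb)
  rw [map_neg, neg_pos] at hb₀
  have := h _ (crossing_mem_middleCut ha hb ha₀ hb₀)
  simp only [AddMonoidHom.sub_apply, AddMonoidHom.smul_apply, smul_eq_mul] at this
  nlinarith

lemma self_mem_zeroOn_middleCut : m₀ ∈ zeroOn (middleCut s m₀) := by
  intro n hn
  rcases mem_middleCut.1 hn with h | ⟨a, -, b, -, -, -, rfl⟩
  · exact h.2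
  · simp [mul_comm]

lemma IsCut.mul_eq_mul (h : IsCut s m₀) (hm : m ∈ zeroOn (middleCut s m₀)) (ha : a ∈ s)
    (hb : b ∈ s) : a m₀ * b m = b m₀ * a m := by
  have crossing : ∀ a ∈ s, ∀ b ∈ s, 0 < a m₀ → b m₀ < 0 → a m₀ * b m = b m₀ * a m := by
    intro a ha b hb ha₀ hb₀
    have := hm _ (crossing_mem_middleCut ha hb ha₀ hb₀)
    simp only [AddMonoidHom.sub_apply, AddMonoidHom.smul_apply, smul_eq_mul] at this
    linarith
  obtain ⟨⟨p, hp, hp₀⟩, q, hq, hq₀⟩ := h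
  have ratio : ∀ n ∈ s, p m₀ * n m = n m₀ * p m := by
    intro n hn
    rcases lt_trichotomy (n m₀) 0 with h₀ | h₀ | h₀
    · exact crossing p hp n hn hp₀ h₀
    · rw [hm n (mem_middleCut.2 (Or.inl ⟨hn, h₀⟩)), h₀, mul_zero, zero_mul]
    · refine mul_left_cancel₀ hq₀.ne ?_
      linear_combination p m₀ * crossing n hn q hq h₀ hq₀ * -1 +
        n m₀ * crossing p hp q hq hp₀ hq₀
  refine mul_left_cancel₀ hp₀.ne' ?_
  linear_combination a m₀ * ratio b hb - b m₀ * ratio a ha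

lemma IsCut.mem_zeroOn (h : IsCut s m₀) (hm : m ∈ zeroOn (middleCut s m₀)) (ha : a ∈ s)
    (ha₀ : a m₀ ≠ 0) (ham : a m = 0) : m ∈ zeroOn s := by
  intro n hn
  have := h.mul_eq_mul hm ha hn
  rw [ham, mul_zero] at this
  exact (mul_eq_zero.1 this).resolve_left ha₀

lemma IsCut.zeroOn_upperCut_le (h : IsCut s m₀) : zeroOn (upperCut s m₀) ≤ zeroOn s := by
  intro m hm
  obtain ⟨n, hn, hn₀⟩ := h.1
  exact h.mem_zeroOn (fun n hn => hm n (middleCut_subset_upperCut hn)) hn hn₀.ne'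
    (hm n (mem_upperCut_of_mem hn hn₀.le))

lemma IsCut.mem_zeroOn_of_mem_nonnegOn (h : IsCut s m₀) (hm : m ∈ nonnegOn s)
    (hm₀ : m ∈ zeroOn (middleCut s m₀)) : m ∈ zeroOn s := by
  obtain ⟨⟨a, ha, ha₀⟩, b, hb, hb₀⟩ := id h
  refine h.mem_zeroOn hm₀ ha ha₀.ne' ?_
  have := h.mul_eq_mul hm₀ ha hb
  have := hm a ha
  have := hm b hb
  nlinarith

lemma IsCut.eventually_add_zsmul_mem_posOn_upperCut (h : IsCut s m₀)
    (hm : m ∈ nonnegOn (middleCut s m₀)) :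
    ∀ᶠ b : ℤ in Filter.atTop, m + b • m₀ ∈ posOn (upperCut s m₀) := by
  have hpos : ∀ᶠ b : ℤ in Filter.atTop, ∀ n ∈ s, 0 < n m₀ → 0 < n (m + b • m₀) := by
    rw [Filter.eventually_all_finset]
    intro n _
    filter_upwards [Filter.eventually_gt_atTop (-n m), Filter.eventually_ge_atTop 0] with b hb hb₀
    intro hn₀
    rw [map_add, map_zsmul, smul_eq_mul]
    nlinarith
  filter_upwards [hpos] with b hb
  constructor
  · intro n hn
    rcases mem_upperCut.1 hn with hn | hn
    · exact (hb n hn.1 hn.2).le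
    · rw [map_add, map_zsmul, self_mem_zeroOn_middleCut n hn, smul_zero, add_zero]
      exact hm n hn
  · obtain ⟨n, hn, hn₀⟩ := h.1
    exact fun h0 => (hb n hn hn₀).ne' (h0 n (mem_upperCut_of_mem hn hn₀.le))

lemma IsCut.exists_nsmul_sub_zsmul_mem_nonnegOn (h : IsCut s m₀)
    (hm : m ∈ nonnegOn (middleCut s m₀)) :
    ∃ c : ℕ, 0 < c ∧ ∃ b : ℤ, c • m - b • m₀ ∈ nonnegOn s := by
  obtain ⟨p, hp, hp₀⟩ := h.1
  -- Subtract the multiple of `m₀` given by the smallest slope `n m / n m₀`.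
  obtain ⟨a, ha, hmin⟩ := Finset.exists_min_image (s.filter fun n => 0 < n m₀)
    (fun n => (n m : ℚ) / n m₀) ⟨p, by simp [hp, hp₀]⟩
  simp only [Finset.mem_filter] at ha hmin
  refine ⟨(a m₀).toNat, by omega, a m, fun n hn => ?_⟩
  rw [← natCast_zsmul, Int.toNat_of_nonneg ha.2.le]
  simp only [map_sub, map_zsmul, smul_eq_mul]
  rcases lt_trichotomy (n m₀) 0 with h₀ | h₀ | h₀
  · have := hm _ (crossing_mem_middleCut ha.1 hn ha.2 h₀)
    simp only [AddMonoidHom.sub_apply, AddMonoidHom.smul_apply, smul_eq_mul] at this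
    linarith
  · rw [h₀, mul_zero, sub_zero]
    exact mul_nonneg ha.2.le (hm n (mem_middleCut.2 (Or.inl ⟨hn, h₀⟩)))
  · have hslope := hmin n ⟨hn, h₀⟩
    rw [div_le_div_iff₀ (by exact_mod_cast ha.2) (by exact_mod_cast h₀)] at hslope
    norm_cast at hslope
    linarith

variable [Module.Finite ℤ M]

-- `nonnegOn s` is the image of the solutions of `n (φ x) = y n`, `n ∈ s`, in natural numbers.
lemma nonnegOn_fg (s : Finset (M →+ ℤ)) : (nonnegOn s).FG := by
  have : Module.Finite ℕ M := Module.Finite.iff_addMonoid_fg.2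
    (AddGroup.fg_iff_addMonoid_fg.1 (Module.Finite.iff_addGroup_fg.1 ‹_›))
  obtain ⟨k, φ, hφ⟩ := Module.Finite.exists_fin' ℕ M
  let pairing : (Fin k → ℕ) × (s → ℕ) →+ (s → ℤ) :=
    (AddMonoidHom.pi fun n : s => n.1.comp φ.toAddMonoidHom).comp (AddMonoidHom.fst _ _)
  let slack : (Fin k → ℕ) × (s → ℕ) →+ (s → ℤ) :=
    ((Nat.castAddMonoidHom ℤ).compLeft s).comp (AddMonoidHom.snd _ _)
  have himage : (pairing.eqLocusM slack).map
      (φ.toAddMonoidHom.comp (AddMonoidHom.fst _ (s → ℕ))) = nonnegOn s := by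
    ext m
    constructor
    · rintro ⟨x, hx, rfl⟩ n hn
      exact (Int.natCast_nonneg (x.2 ⟨n, hn⟩)).trans_eq (congrFun hx ⟨n, hn⟩).symm
    · intro hm
      obtain ⟨x, rfl⟩ := hφ m
      exact ⟨(x, fun n => (n.1 (φ x)).toNat),
        funext fun n => (Int.toNat_of_nonneg (hm n.1 n.2)).symm, rfl⟩
  exact himage ▸ (AddSubmonoid.fg_eqLocusM pairing slack).map _

lemma IsCut.exists_finset_middleCut (h : IsCut s m₀) :
    ∃ R : Finset M, (∀ r ∈ R, r ∈ nonnegOn (middleCut s m₀)) ∧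
      ∀ m ∈ nonnegOn (middleCut s m₀), ∃ r ∈ R, ∃ k ∈ nonnegOn s, ∃ b : ℤ,
        m = k + (r + b • m₀) := by
  classical
  obtain ⟨T, hT⟩ := nonnegOn_fg (middleCut s m₀)
  have hTmem : ∀ t : T, t.1 ∈ nonnegOn (middleCut s m₀) := fun t =>
    hT ▸ AddSubmonoid.subset_closure t.2
  choose c hc b hcb using fun t : T => h.exists_nsmul_sub_zsmul_mem_nonnegOn (hTmem t)
  refine ⟨(Fintype.piFinset fun t : T => Finset.range (c t)).image fun a => ∑ t, a t • t.1,
    ?_, fun m hm => ?_⟩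
  · intro r hr
    obtain ⟨a, -, rfl⟩ := Finset.mem_image.1 hr
    exact sum_mem fun t _ => nsmul_mem (hTmem t) _
  · obtain ⟨a, rfl⟩ := AddSubmonoid.mem_closure_finset'.1 (hT.symm ▸ hm)
    refine ⟨_, Finset.mem_image.2 ⟨fun t => a t % c t, by
      simpa using fun t ht => Nat.mod_lt _ (hc ⟨t, ht⟩), rfl⟩,
      ∑ t, (a t / c t) • (c t • t.1 - b t • m₀), sum_mem fun t _ => nsmul_mem (hcb t) _,
      ∑ t, ((a t / c t : ℕ) : ℤ) * b t, ?_⟩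
    rw [Finset.sum_smul]
    simp only [← Finset.sum_add_distrib]
    refine Finset.sum_congr rfl fun t _ => ?_
    conv_lhs => rw [← Nat.div_add_mod' (a t) (c t)]
    rw [smul_sub, mul_smul, natCast_zsmul, ← mul_smul, add_smul]
    abel

end Cut

/-! ### Lifting generators of the initial ideal -/

section Krull

lemma exists_smul_eq_of_forall_mem_pow_smul {R V : Type*} [CommRing R] [IsNoetherianRing R]
    [AddCommGroup V] [Module R V] (𝔫 : Ideal R) (P : Submodule R V) [Module.Finite R P] {x : V}
    (hx : ∀ N : ℕ, x ∈ 𝔫 ^ N • P) : ∃ r ∈ 𝔫, r • x = x := by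
  have hxP : x ∈ P := by simpa using hx 0
  have hmem : (⟨x, hxP⟩ : P) ∈ (⨅ i : ℕ, 𝔫 ^ i • ⊤ : Submodule R P) := by
    rw [Submodule.mem_iInf]
    intro N
    have hmap : (𝔫 ^ N • (⊤ : Submodule R P)).map P.subtype = 𝔫 ^ N • P := by
      rw [Submodule.map_smul'', Submodule.map_top, Submodule.range_subtype]
    obtain ⟨y, hy, rfl⟩ := hmap.symm ▸ hx N
    exact hy
  obtain ⟨r, hr⟩ := (Ideal.mem_iInf_smul_pow_eq_bot_iff 𝔫 _).1 hmem
  exact ⟨r, r.2, congrArg Subtype.val hr⟩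

lemma exists_sub_smul_mem_of_forall_pow {R S : Type*} [CommRing R] [CommRing S] [Algebra R S]
    [IsNoetherianRing R] [IsNoetherianRing S] (𝔫 : Ideal R) (𝔞 : Ideal S) (L : Submodule R S)
    {G : Set S} (hG : G.Finite) (hfg : 𝔞.restrictScalars R ≤ L ⊔ Submodule.span R G) {p : S}
    (hp : ∀ N : ℕ, ∃ p' ∈ 𝔞 ⊓ (𝔫.map (algebraMap R S)) ^ N, p - p' ∈ L) :
    ∃ r ∈ 𝔫, p - r • p ∈ L := by
  set P : Submodule R (S ⧸ L) := (𝔞.restrictScalars R).map L.mkQ with hP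
  have hP_le : P ≤ Submodule.span R (L.mkQ '' G) := by
    rw [← Submodule.map_span]
    refine (Submodule.map_mono hfg).trans ?_
    rw [Submodule.map_sup, Submodule.mkQ_map_self, bot_sup_eq]
  have : IsNoetherian R (Submodule.span R (L.mkQ '' G)) :=
    isNoetherian_span_of_finite R (hG.image _)
  have : IsNoetherian R P := isNoetherian_of_le hP_le
  obtain ⟨k, artinRees⟩ := Ideal.exists_pow_inf_eq_pow_smul (𝔫.map (algebraMap R S))
    (𝔞 : Submodule S S)
  have hpow : ∀ N : ℕ, L.mkQ p ∈ 𝔫 ^ N • P := by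
    intro N
    obtain ⟨p', ⟨hp'𝔞, hp'𝔫⟩, hpp'⟩ := hp (N + k)
    rw [show L.mkQ p = L.mkQ p' from (Submodule.Quotient.eq L).2 hpp', hP, ← Submodule.map_smul'']
    refine Submodule.mem_map_of_mem ?_
    rw [← Ideal.smul_restrictScalars, Submodule.restrictScalars_mem, Ideal.map_pow]
    have hmem : p' ∈ (𝔫.map (algebraMap R S)) ^ (N + k) • (⊤ : Submodule S S) ⊓ 𝔞 :=
      ⟨by simpa using hp'𝔫, hp'𝔞⟩
    rw [artinRees (N + k) (by omega), Nat.add_sub_cancel] at hmem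
    exact Submodule.smul_mono le_rfl inf_le_right hmem
  obtain ⟨r, hr, hrp⟩ := exists_smul_eq_of_forall_mem_pow_smul 𝔫 P hpow
  exact ⟨r, hr, (Submodule.Quotient.eq L).1 hrp.symm⟩

end Krull

section MonoidSubalgebra

variable {R M : Type*} [AddCommMonoid M]

section CommSemiring

variable [CommSemiring R]

variable (R) in
/-- The elements of the monoid algebra whose exponents lie in the submonoid `D`, as a subalgebra. -/
def monoidSubalgebra (D : AddSubmonoid M) : Subalgebra R R[M] where
  carrier := (supportedIn (D : Set M) : Submodule R R[M])
  mul_mem' := fun hf hg => mul_mem_supportedIn hf hg fun _ ha _ hb => add_mem ha hb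
  add_mem' := add_mem
  algebraMap_mem' := fun c => by
    rw [AddMonoidAlgebra.coe_algebraMap]
    exact single_mem_supportedIn (zero_mem D) c

lemma monoidSubalgebra_mono {D D' : AddSubmonoid M} (h : D ≤ D') :
    monoidSubalgebra R D ≤ monoidSubalgebra R D' := supportedIn_mono h

lemma range_mapDomainAlgHom_subtype (D : AddSubmonoid M) :
    (AddMonoidAlgebra.mapDomainAlgHom R R D.subtype).range = monoidSubalgebra R D := by
  apply le_antisymm
  · rintro _ ⟨f, rfl⟩
    change (AddMonoidAlgebra.mapDomainAlgHom R R D.subtype) f ∈ monoidSubalgebra R D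
    induction f using AddMonoidAlgebra.induction_linear with
    | zero => simp
    | add f g hf hg => rw [map_add]; exact add_mem hf hg
    | single a c =>
      rw [AddMonoidAlgebra.mapDomainAlgHom_apply, AddMonoidAlgebra.mapDomain_single]
      exact single_mem_supportedIn a.2 c
  · exact fun f hf => mem_of_forall_single_mem
      (W := (AddMonoidAlgebra.mapDomainAlgHom R R D.subtype).range.toAddSubmonoid)
      fun m hm => ⟨single ⟨m, hf m hm⟩ (f.coeff m), by simp⟩

/-- The term `c ξ^m` as an element of the algebra of a monoid of exponents. -/
def termIn {D : AddSubmonoid M} {m : M} (hm : m ∈ D) (c : R) : monoidSubalgebra R D :=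
  ⟨single m c, single_mem_supportedIn hm c⟩

lemma termIn_add {D : AddSubmonoid M} {a b : M} (ha : a ∈ D) (hb : b ∈ D) (c d : R) :
    termIn (add_mem ha hb) (c * d) = termIn ha c * termIn hb d :=
  Subtype.ext (AddMonoidAlgebra.single_mul_single ..).symm

lemma mem_of_forall_termIn_mem {D : AddSubmonoid M} (W : AddSubmonoid (monoidSubalgebra R D))
    (f : monoidSubalgebra R D)
    (h : ∀ m (hm : m ∈ D), f.1.coeff m ≠ 0 → termIn hm (f.1.coeff m) ∈ W) : f ∈ W := by
  obtain ⟨y, hy, hyf⟩ := mem_of_forall_single_mem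
    (W := W.map (monoidSubalgebra R D).val.toAddMonoidHom) (f := f.1) fun m hm =>
      ⟨_, h m (f.2 m hm) hm, rfl⟩
  exact Subtype.ext hyf ▸ hy

end CommSemiring

lemma isNoetherianRing_monoidSubalgebra [CommRing R] [IsNoetherianRing R] {D : AddSubmonoid M}
    (hD : D.FG) : IsNoetherianRing (monoidSubalgebra R D) := by
  have : AddMonoid.FG D := (AddMonoid.fg_iff_addSubmonoid_fg D).2 hD
  have : IsNoetherianRing R[D] := Algebra.FiniteType.isNoetherianRing R _
  rw [← range_mapDomainAlgHom_subtype]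
  exact isNoetherianRing_of_surjective _ _ _
    (AddMonoidAlgebra.mapDomainAlgHom R R D.subtype).rangeRestrict_surjective

end MonoidSubalgebra

section RelInt

variable {M : Type} [AddCommGroup M] {s t : Finset (M →+ ℤ)} {m₀ : M}

/-- The relative interior of the cone generated by `s`. -/
def relInt (s : Finset (M →+ ℤ)) : Set (M →+ ℝ) :=
  {u | u ∈ PointedCone.hull ℝ (latticeToReal '' (s : Set (M →+ ℤ))) ∧
    ∀ m ∈ nonnegOn s, u m = 0 → m ∈ zeroOn s}

lemma latticeToReal_zero : latticeToReal (0 : M →+ ℤ) = 0 := AddMonoidHom.comp_zero _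

lemma latticeToReal_add (a b : M →+ ℤ) :
    latticeToReal (a + b) = latticeToReal a + latticeToReal b :=
  AddMonoidHom.comp_add _ _ _

lemma latticeToReal_mem_hull {n : M →+ ℤ} (hn : n ∈ AddSubmonoid.closure (s : Set (M →+ ℤ))) :
    latticeToReal n ∈ PointedCone.hull ℝ (latticeToReal '' (s : Set (M →+ ℤ))) := by
  induction hn using AddSubmonoid.closure_induction with
  | mem n hn => exact Submodule.subset_span ⟨n, hn, rfl⟩
  | zero =>
    rw [latticeToReal_zero]
    exact zero_mem _
  | add a b _ _ ha hb =>
    rw [latticeToReal_add]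
    exact add_mem ha hb

lemma latticeToReal_sum_mem_relInt (s : Finset (M →+ ℤ)) : latticeToReal (∑ n ∈ s, n) ∈ relInt s :=
  ⟨latticeToReal_mem_hull (sum_mem fun _ hn => AddSubmonoid.subset_closure hn), fun _ hm h =>
    (sum_apply_eq_zero_iff hm).1 (Int.cast_eq_zero.1 h)⟩

lemma relInt_subset (h : (t : Set (M →+ ℤ)) ⊆ AddSubmonoid.closure (s : Set (M →+ ℤ)))
    (hzero : ∀ m ∈ nonnegOn s, m ∈ zeroOn t → m ∈ zeroOn s) : relInt t ⊆ relInt s := by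
  rintro u ⟨hu, hu'⟩
  refine ⟨Submodule.span_le.2 ?_ hu, fun m hm hum =>
    hzero m hm (hu' m (nonnegOn_anti h hm) hum)⟩
  rintro _ ⟨n, hn, rfl⟩
  exact latticeToReal_mem_hull (h hn)

lemma IsCut.relInt_upperCut_subset (h : IsCut s m₀) : relInt (upperCut s m₀) ⊆ relInt s :=
  relInt_subset upperCut_subset_closure fun _ _ hm => h.zeroOn_upperCut_le hm

lemma IsCut.relInt_middleCut_subset (h : IsCut s m₀) : relInt (middleCut s m₀) ⊆ relInt s :=
  relInt_subset middleCut_subset_closure fun _ hm => h.mem_zeroOn_of_mem_nonnegOn hm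

end RelInt

section Lifts

variable {M : Type} [AddCommGroup M] {κ : Type*} {I : Ideal ℂ[M]} {g : κ → ℂ[M]}
  {s : Finset (M →+ ℤ)} {m₀ : M}

/-- Every `g i` is, up to terms with exponents in `T`, an element of `I`. -/
def HasLifts (I : Ideal ℂ[M]) (g : κ → ℂ[M]) (T : Set M) : Prop :=
  ∀ i, ∃ f ∈ I, f - g i ∈ supportedIn T

lemma HasLifts.mono {S T : Set M} (h : HasLifts I g S) (hST : S ⊆ T) : HasLifts I g T := fun i => by
  obtain ⟨f, hf, hfg⟩ := h i
  exact ⟨f, hf, supportedIn_mono hST hfg⟩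

lemma exists_coefficients [Fintype κ] (hg : ∀ i, g i ∈ supportedIn (zeroOn s : Set M)) {S : Set M}
    (hS : ∀ m, ∀ z ∈ zeroOn s, m + z ∈ S ↔ m ∈ S) {q : ℂ[M]} (hq : q ∈ Ideal.span (Set.range g))
    (hqS : q ∈ supportedIn S) :
    ∃ c : κ → ℂ[M], (∀ i, c i ∈ supportedIn S) ∧ q = ∑ i, c i * g i := by
  obtain ⟨c, hc⟩ := Ideal.mem_span_range_iff_exists_fun.1 hq
  refine ⟨fun i => part S (c i), fun i =>
    supportedIn_mono Set.inter_subset_right (part_mem_supportedIn (mem_supportedIn_univ (c i))), ?_⟩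
  rw [← part_eq_self hqS, ← hc, map_sum]
  exact Finset.sum_congr rfl fun i _ => part_mul (hg i) hS

lemma part_level_sum_mem {J : Ideal ℂ[M]} (hconst : ∀ u ∈ relInt s, initialIdeal u I = J)
    {f : ℂ[M]} (hf : f ∈ I) {c : ℤ} (h : ∀ m, f.coeff m ≠ 0 → c ≤ (∑ n ∈ s, n) m) :
    part {m | (∑ n ∈ s, n) m = c} f ∈ J := by
  rw [← hconst _ (latticeToReal_sum_mem_relInt s)]
  convert part_level_mem_initialIdeal (w := latticeToReal (∑ n ∈ s, n)) hf
    fun m hm => Int.cast_le.2 (h m hm) using 1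
  exact part_congr fun m _ => (Int.cast_inj (α := ℝ)).symm

lemma part_zeroOn_mem {J : Ideal ℂ[M]} (hconst : ∀ u ∈ relInt s, initialIdeal u I = J)
    {f : ℂ[M]} (hf : f ∈ I) (hfs : f ∈ supportedIn (nonnegOn s : Set M)) :
    part (zeroOn s : Set M) f ∈ J := by
  convert part_level_sum_mem hconst hf fun m hm => sum_apply_nonneg (hfs m hm) using 1
  exact part_congr fun m hm => (sum_apply_eq_zero_iff (hfs m hm)).symm

lemma mem_supportedIn_nonnegOn_of_sub {S : Set M} (hg : ∀ i, g i ∈ supportedIn (zeroOn s : Set M))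
    (hS : S ⊆ nonnegOn s) {f : ℂ[M]} {i : κ} (hf : f - g i ∈ supportedIn S) :
    f ∈ supportedIn (nonnegOn s : Set M) := by
  rw [← sub_add_cancel f (g i)]
  exact add_mem (supportedIn_mono hS hf) (supportedIn_mono zeroOn_subset_nonnegOn (hg i))

lemma sub_sum_mul_mem_supportedIn [Fintype κ] {P Q T C W : Set M} {p : ℂ[M]} {c F : κ → ℂ[M]}
    (hp : p ∈ supportedIn T) (hpart : part Q p = ∑ j, c j * g j)
    (hc : ∀ j, c j ∈ supportedIn C) (hF : ∀ j, F j - g j ∈ supportedIn W) (hT : T \ Q ⊆ P)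
    (hCW : ∀ a ∈ C, ∀ b ∈ W, a + b ∈ P) : p - ∑ j, c j * F j ∈ supportedIn P := by
  have hsplit : p - ∑ j, c j * F j = (p - part Q p) - ∑ j, c j * (F j - g j) := by
    rw [hpart]
    simp only [mul_sub, Finset.sum_sub_distrib]
    abel
  rw [hsplit]
  exact sub_mem (supportedIn_mono hT (sub_part_mem_supportedIn hp))
    (sum_mem fun j _ => mul_mem_supportedIn (hc j) (hF j) hCW)

/-- The positive exponents on the upper half of a cone that are of order at least `B` along `ν` if
they vanish on the hyperplane section. -/
def raisedOn (s : Finset (M →+ ℤ)) (m₀ : M) (ν : M →+ ℤ) (B : ℤ) : Set M :=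
  {m | m ∈ posOn (upperCut s m₀) ∧ (m ∈ zeroOn (middleCut s m₀) → B ≤ ν m)}

variable {ν : M →+ ℤ}

lemma add_mem_raisedOn_inter_iff (hν : ν ∈ s) {B : ℤ} {m z : M} (hz : z ∈ zeroOn s) :
    m + z ∈ raisedOn s m₀ ν B ∩ zeroOn (middleCut s m₀) ↔
      m ∈ raisedOn s m₀ ν B ∩ zeroOn (middleCut s m₀) := by
  simp only [raisedOn, posOn, Set.mem_inter_iff, Set.mem_ofPred_eq, Set.mem_sdiff, SetLike.mem_coe,
    add_mem_zeroOn_iff (zeroOn_le_upperCut hz), add_mem_zeroOn_iff (zeroOn_le_middleCut hz),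
    add_mem_nonnegOn_iff (zeroOn_le_upperCut hz), map_add, hz ν hν, add_zero]

lemma exists_coefficients_raisedOn [Fintype κ] (hg : ∀ i, g i ∈ supportedIn (zeroOn s : Set M))
    (hconst : ∀ u ∈ relInt (middleCut s m₀), initialIdeal u I = Ideal.span (Set.range g))
    (hν : ν ∈ s) {B : ℤ} {f : ℂ[M]} (hf : f ∈ I) {i : κ}
    (hfg : f - g i ∈ supportedIn (raisedOn s m₀ ν B)) :
    ∃ c : κ → ℂ[M],
      (∀ j, c j ∈ supportedIn (raisedOn s m₀ ν B ∩ zeroOn (middleCut s m₀))) ∧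
      part (zeroOn (middleCut s m₀) : Set M) (f - g i) = ∑ j, c j * g j := by
  have hg' : ∀ i, g i ∈ supportedIn (zeroOn (middleCut s m₀) : Set M) := fun i =>
    supportedIn_mono zeroOn_le_middleCut (hg i)
  refine exists_coefficients hg (fun m z hz => add_mem_raisedOn_inter_iff hν hz) ?_
    (part_mem_supportedIn hfg)
  rw [map_sub, part_eq_self (hg' i)]
  exact sub_mem (part_zeroOn_mem hconst hf (mem_supportedIn_nonnegOn_of_sub hg'
    (fun m hm => nonnegOn_upperCut_le_middleCut hm.1.1) hfg)) (Ideal.subset_span ⟨i, rfl⟩)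

-- The terms that vanish on the section form an element of the initial ideal. Subtracting the
-- corresponding combination of lifts doubles their order.
lemma IsCut.hasLifts_raisedOn [Finite κ] (h : IsCut s m₀)
    (hg : ∀ i, g i ∈ supportedIn (zeroOn s : Set M))
    (hconst : ∀ u ∈ relInt (middleCut s m₀), initialIdeal u I = Ideal.span (Set.range g))
    (hup : HasLifts I g (posOn (upperCut s m₀))) (hν : ν ∈ s) (hν₀ : 0 < ν m₀) (B : ℕ) :
    HasLifts I g (raisedOn s m₀ ν (B + 1)) := by
  cases nonempty_fintype κ
  induction B with
  | zero =>
    refine hup.mono fun m hm => ⟨hm, fun h0 => ?_⟩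
    have hνm := hm.1 ν (mem_upperCut_of_mem hν hν₀.le)
    have hνm' : ν m ≠ 0 := fun h' => hm.2 (zeroOn_le_upperCut (h.mem_zeroOn h0 hν hν₀.ne' h'))
    push_cast
    omega
  | succ B ih =>
    intro i
    choose F hFI hF using ih
    obtain ⟨c, hc, hpart⟩ := exists_coefficients_raisedOn hg hconst hν (hFI i) (hF i)
    refine ⟨F i - ∑ j, c j * F j,
      sub_mem (hFI i) (sum_mem fun j _ => I.mul_mem_left _ (hFI j)), ?_⟩
    rw [sub_right_comm]
    refine sub_sum_mul_mem_supportedIn (hF i) hpart hc hF (fun m hm => ⟨hm.1.1, fun h => ?_⟩) ?_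
    · exact absurd h hm.2
    rintro a ⟨⟨ha, haB⟩, ha₀⟩ b ⟨hb, hbB⟩
    refine ⟨add_mem_posOn ha.1 hb, fun hab => ?_⟩
    have haν := haB ha₀
    have hbν := hbB (((zeroOn (middleCut s m₀)).add_mem_cancel_left ha₀).1 hab)
    rw [map_add]
    push_cast at haν hbν ⊢
    omega

lemma IsCut.eventually_add_mem_nonnegOn_upperCut (h : IsCut s m₀) (hν : ν ∈ s) (hν₀ : 0 < ν m₀)
    {b : M} (hb : b ∈ nonnegOn (middleCut s m₀)) :
    ∀ᶠ B : ℕ in Filter.atTop, ∀ a ∈ raisedOn s m₀ ν (B + 1) ∩ zeroOn (middleCut s m₀),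
      a + b ∈ nonnegOn (upperCut s m₀) := by
  have hbound : ∀ᶠ B : ℕ in Filter.atTop, ∀ n ∈ s, -(ν m₀ * n b) ≤ B := by
    rw [Filter.eventually_all_finset]
    exact fun n _ => tendsto_natCast_atTop_atTop.eventually_ge_atTop _
  filter_upwards [hbound] with B hB a ha n hn
  rcases mem_upperCut.1 hn with ⟨hns, hn₀⟩ | hn
  · have hνa := ha.1.2 ha.2
    have hle : 1 * ν a ≤ n m₀ * ν a := mul_le_mul_of_nonneg_right (by omega) (by omega)
    have := hB n hns
    have hnonneg : 0 ≤ ν m₀ * n (a + b) := by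
      rw [map_add, mul_add, h.mul_eq_mul ha.2 hν hns]
      omega
    exact nonneg_of_mul_nonneg_right hnonneg hν₀
  · rw [map_add, ha.2 n hn, zero_add]
    exact hb n hn

-- A lift over the upper half that is of high order on the section remains non-negative on the
-- upper half after its part on the section is removed with the help of the lifts over the section.
theorem IsCut.hasLifts_upperCut_inter [Finite κ] (h : IsCut s m₀)
    (hg : ∀ i, g i ∈ supportedIn (zeroOn s : Set M))
    (hconst : ∀ u ∈ relInt (middleCut s m₀), initialIdeal u I = Ideal.span (Set.range g))
    (hup : HasLifts I g (posOn (upperCut s m₀))) (hmid : HasLifts I g (posOn (middleCut s m₀))) :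
    HasLifts I g (nonnegOn (upperCut s m₀) ∩ posOn (middleCut s m₀)) := by
  cases nonempty_fintype κ
  intro i
  obtain ⟨ν, hν, hν₀⟩ := h.1
  choose F hFI hF using hmid
  obtain ⟨B, hB⟩ : ∃ B : ℕ, ∀ j, ∀ b ∈ (F j - g j).coeff.support,
      ∀ a ∈ raisedOn s m₀ ν (B + 1) ∩ zeroOn (middleCut s m₀),
        a + b ∈ nonnegOn (upperCut s m₀) := by
    refine Filter.Eventually.exists (f := Filter.atTop) (Filter.eventually_all.2 fun j =>
      (Filter.eventually_all_finset _).2 fun b hb => ?_)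
    exact h.eventually_add_mem_nonnegOn_upperCut hν hν₀ (hF j b (Finsupp.mem_support_iff.1 hb)).1
  obtain ⟨f, hf, hfg⟩ := h.hasLifts_raisedOn hg hconst hup hν hν₀ B i
  obtain ⟨c, hc, hpart⟩ := exists_coefficients_raisedOn hg hconst hν hf hfg
  refine ⟨f - ∑ j, c j * F j, sub_mem hf (sum_mem fun j _ => I.mul_mem_left _ (hFI j)), ?_⟩
  rw [sub_right_comm]
  refine sub_sum_mul_mem_supportedIn (W := posOn (middleCut s m₀) ∩
    {b | ∃ j, b ∈ (F j - g j).coeff.support}) hfg hpart hc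
    (fun j b hb => ⟨hF j b hb, j, Finsupp.mem_support_iff.2 hb⟩) (fun m hm => ?_) ?_
  · exact ⟨hm.1.1.1, nonnegOn_upperCut_le_middleCut hm.1.1.1, hm.2⟩
  · rintro a ha b ⟨hb, j, hbj⟩
    exact ⟨hB j b hbj a ha, add_mem_posOn (zeroOn_subset_nonnegOn ha.2) hb⟩

end Lifts

section Gluing

variable {M : Type} [AddCommGroup M] {κ : Type*} {I : Ideal ℂ[M]} {g : κ → ℂ[M]}
  {s : Finset (M →+ ℤ)} {m₀ : M}

/-- The elements of the ideal `I` with exponents in `T`. -/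
def idealOn (I : Ideal ℂ[M]) (T : Set M) : Submodule ℂ ℂ[M] :=
  I.restrictScalars ℂ ⊓ supportedIn T

lemma idealOn_mono {S T : Set M} (h : S ⊆ T) : idealOn I S ≤ idealOn I T :=
  inf_le_inf_left _ (supportedIn_mono h)

lemma mul_mem_idealOn {S T W : Set M} {c f : ℂ[M]} (hc : c ∈ supportedIn S) (hf : f ∈ idealOn I T)
    (h : ∀ a ∈ S, ∀ b ∈ T, a + b ∈ W) : c * f ∈ idealOn I W :=
  ⟨I.mul_mem_left c hf.1, mul_mem_supportedIn hc hf.2 h⟩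

/-- The sums of two elements of `I`, each of them positive on one half of a cone. -/
def cutSums (I : Ideal ℂ[M]) (s : Finset (M →+ ℤ)) (m₀ : M) : Submodule ℂ ℂ[M] :=
  idealOn I (posOn (upperCut s m₀)) ⊔ idealOn I (posOn (upperCut s (-m₀)))

/-- The exponents that are non-negative and of order at least `N` along the hyperplane section. -/
def orderedOn (s : Finset (M →+ ℤ)) (m₀ : M) (N : ℕ) : Set M :=
  {m | m ∈ (nonnegOn (middleCut s m₀) : Set M) \ zeroOn s ∧ (N : ℤ) ≤ (∑ n ∈ middleCut s m₀, n) m}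

/-- The elements of order exactly `N` among those of order at least `N`. -/
def levelOn (s : Finset (M →+ ℤ)) (m₀ : M) (N : ℕ) : Set M :=
  orderedOn s m₀ N ∩ {m | (∑ n ∈ middleCut s m₀, n) m = N}

lemma add_mem_levelOn_iff {N : ℕ} {m z : M} (hz : z ∈ zeroOn s) :
    m + z ∈ levelOn s m₀ N ↔ m ∈ levelOn s m₀ N := by
  have hz₀ : z ∈ zeroOn (middleCut s m₀) := zeroOn_le_middleCut hz
  simp only [levelOn, orderedOn, Set.mem_inter_iff, Set.mem_ofPred_eq, Set.mem_sdiff,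
    SetLike.mem_coe, add_mem_nonnegOn_iff hz₀, add_mem_zeroOn_iff hz, map_add,
    sum_apply_eq_zero hz₀, add_zero]

lemma add_mem_orderedOn_succ {N : ℕ} {a b : M} (ha : a ∈ levelOn s m₀ N)
    (hb : b ∈ posOn (middleCut s m₀)) : a + b ∈ orderedOn s m₀ (N + 1) := by
  have hb₀ := sum_apply_pos hb
  refine ⟨⟨add_mem ha.1.1.1 hb.1, fun h => ?_⟩, ?_⟩
  · have hab := sum_apply_eq_zero (zeroOn_le_middleCut (m₀ := m₀) h)
    rw [map_add, ha.2] at hab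
    omega
  · rw [map_add, ha.2]
    push_cast
    omega

lemma IsCut.mem_posOn_upperCut (h : IsCut s m₀) {m : M} (hm : m ∈ nonnegOn (upperCut s m₀))
    (hms : m ∉ zeroOn s) : m ∈ posOn (upperCut s m₀) :=
  ⟨hm, fun h₀ => hms (h.zeroOn_upperCut_le h₀)⟩

lemma mul_lift_mem_idealOn {C : Set M} {c f : ℂ[M]} {i : κ}
    (hg : ∀ i, g i ∈ supportedIn (zeroOn s : Set M)) (hc : c ∈ supportedIn C) (hf : f ∈ I)
    (hC : C ⊆ posOn s) (hfg : f - g i ∈ supportedIn (nonnegOn s : Set M)) :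
    c * f ∈ idealOn I (posOn s) :=
  mul_mem_idealOn hc ⟨hf, mem_supportedIn_nonnegOn_of_sub hg le_rfl hfg⟩ fun a ha b hb => by
    rw [add_comm]
    exact add_mem_posOn hb (hC ha)

lemma IsCut.idealOn_orderedOn_le_succ [Finite κ] (h : IsCut s m₀)
    (hg : ∀ i, g i ∈ supportedIn (zeroOn s : Set M))
    (hconst : ∀ u ∈ relInt (middleCut s m₀), initialIdeal u I = Ideal.span (Set.range g))
    (hup : HasLifts I g (nonnegOn (upperCut s m₀) ∩ posOn (middleCut s m₀)))
    (hdn : HasLifts I g (nonnegOn (upperCut s (-m₀)) ∩ posOn (middleCut s m₀))) (N : ℕ) :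
    idealOn I (orderedOn s m₀ N) ≤ cutSums I s m₀ ⊔ idealOn I (orderedOn s m₀ (N + 1)) := by
  cases nonempty_fintype κ
  rintro p ⟨hpI, hp⟩
  choose F hFI hF using hup
  choose G hGI hG using hdn
  obtain ⟨c, hc, hpart⟩ := exists_coefficients hg (fun m z => add_mem_levelOn_iff)
    (part_level_sum_mem hconst hpI fun m hm => (hp m hm).2) (part_mem_supportedIn hp)
  have hg' (i) {m' : M} : g i ∈ supportedIn (zeroOn (upperCut s m') : Set M) :=
    supportedIn_mono zeroOn_le_upperCut (hg i)
  let U : Set M := (nonnegOn (upperCut s m₀) : Set M)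
  have hup : ∑ j, part U (c j) * F j ∈ idealOn I (posOn (upperCut s m₀)) := sum_mem fun j _ =>
    mul_lift_mem_idealOn (fun i => hg' i) (part_mem_supportedIn (hc j)) (hFI j)
      (fun m hm => h.mem_posOn_upperCut hm.2 hm.1.1.1.2)
      (supportedIn_mono Set.inter_subset_left (hF j))
  have hdn : ∑ j, (c j - part U (c j)) * G j ∈ idealOn I (posOn (upperCut s (-m₀))) :=
    sum_mem fun j _ => mul_lift_mem_idealOn (fun i => hg' i) (sub_part_mem_supportedIn (hc j))
      (hGI j) (fun m hm => h.neg.mem_posOn_upperCut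
        ((mem_nonnegOn_upperCut_or hm.1.1.1.1).resolve_left hm.2) hm.1.1.1.2)
      (supportedIn_mono Set.inter_subset_left (hG j))
  rw [← add_sub_cancel (∑ j, part U (c j) * F j + ∑ j, (c j - part U (c j)) * G j) p]
  refine Submodule.add_mem_sup (Submodule.add_mem_sup hup hdn)
    ⟨sub_mem hpI (add_mem hup.1 hdn.1), ?_⟩
  have hrest := sub_sum_mul_mem_supportedIn (P := orderedOn s m₀ (N + 1)) (g := Sum.elim g g)
    (c := Sum.elim (fun j => part U (c j)) fun j => c j - part U (c j)) (F := Sum.elim F G)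
    (C := levelOn s m₀ N) (W := posOn (middleCut s m₀)) hp
    (hpart.trans (by simp [← Finset.sum_add_distrib, ← add_mul]))
    (Sum.rec (fun j => supportedIn_mono Set.inter_subset_left (part_mem_supportedIn (hc j)))
      fun j => supportedIn_mono Set.sdiff_subset (sub_part_mem_supportedIn (hc j)))
    (Sum.rec (fun j => supportedIn_mono Set.inter_subset_right (hF j))
      fun j => supportedIn_mono Set.inter_subset_right (hG j))
    (fun m hm => ⟨hm.1.1, Int.add_one_le_of_lt (hm.1.2.lt_of_ne' hm.2)⟩)
    fun a ha b hb => add_mem_orderedOn_succ ha hb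
  simpa using hrest

lemma IsCut.idealOn_le_sup_orderedOn [Finite κ] (h : IsCut s m₀)
    (hg : ∀ i, g i ∈ supportedIn (zeroOn s : Set M))
    (hconst : ∀ u ∈ relInt (middleCut s m₀), initialIdeal u I = Ideal.span (Set.range g))
    (hup : HasLifts I g (nonnegOn (upperCut s m₀) ∩ posOn (middleCut s m₀)))
    (hdn : HasLifts I g (nonnegOn (upperCut s (-m₀)) ∩ posOn (middleCut s m₀))) (N : ℕ) :
    idealOn I ((nonnegOn (middleCut s m₀) : Set M) \ zeroOn s) ≤
      cutSums I s m₀ ⊔ idealOn I (orderedOn s m₀ N) := by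
  induction N with
  | zero => exact le_sup_of_le_right (idealOn_mono fun m hm => ⟨hm, sum_apply_nonneg hm.1⟩)
  | succ N ih =>
    exact ih.trans (sup_le le_sup_left (h.idealOn_orderedOn_le_succ hg hconst hup hdn N))

end Gluing

section Merging

variable {M : Type} [AddCommGroup M] {I : Ideal ℂ[M]} {s : Finset (M →+ ℤ)} {m₀ : M}

/-- The algebra of the exponents that are non-negative on `s`: the coordinate ring of the affine
toric variety of the cone generated by `s`. -/
abbrev coneAlgebra (s : Finset (M →+ ℤ)) : Subalgebra ℂ ℂ[M] := monoidSubalgebra ℂ (nonnegOn s)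

variable (s) in
/-- The ideal of `coneAlgebra s` generated by the positive exponents. -/
def posIdeal : Ideal (coneAlgebra s) where
  carrier := {f | f.1 ∈ supportedIn (posOn s)}
  zero_mem' := zero_mem (supportedIn (posOn s))
  add_mem' := fun hf hg => (supportedIn (posOn s)).add_mem hf hg
  smul_mem' := fun c _ hf => mul_mem_supportedIn c.2 hf fun _ ha _ hb => add_mem_posOn ha hb

lemma exists_termIn_mem_posIdeal_pow [Module.Finite ℤ M] {u : M →+ ℤ}
    (hu : ∀ m ∈ zeroOn s, u m = 0) :
    ∃ C : ℕ, ∀ m (hm : m ∈ nonnegOn s), ∃ j : ℕ,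
      u m ≤ C * j ∧ ∀ c, termIn hm c ∈ posIdeal s ^ j := by
  obtain ⟨T, hT⟩ := nonnegOn_fg s
  refine ⟨T.sup fun t => (u t).toNat, fun m hm => ?_⟩
  have hmT := hm
  rw [← hT] at hmT
  induction hmT using AddSubmonoid.closure_induction with
  | mem t ht =>
    by_cases ht₀ : t ∈ zeroOn s
    · exact ⟨0, by simp [hu t ht₀], by simp⟩
    · have := Finset.le_sup (f := fun t => (u t).toNat) ht
      refine ⟨1, by push_cast; omega, fun c => ?_⟩
      rw [pow_one]
      exact single_mem_supportedIn (S := posOn s) ⟨hm, ht₀⟩ c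
  | zero => exact ⟨0, by simp, by simp⟩
  | add x y hx hy ihx ihy =>
    obtain ⟨j, hj, hjx⟩ := ihx (hT ▸ hx)
    obtain ⟨k, hk, hky⟩ := ihy (hT ▸ hy)
    refine ⟨j + k, ?_, fun c => ?_⟩
    · rw [map_add]
      push_cast at hj hk ⊢
      linarith
    · rw [← mul_one c, termIn_add (hT ▸ hx) (hT ▸ hy), pow_add]
      exact Ideal.mul_mem_mul (hjx c) (hky 1)

variable (s m₀) in
instance coneAlgebra.algebra : Algebra (coneAlgebra s) (coneAlgebra (middleCut s m₀)) :=
  (Subalgebra.inclusion (monoidSubalgebra_mono (nonnegOn_le_middleCut s m₀))).toRingHom.toAlgebra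

lemma termIn_add_eq_smul {k x : M} (hk : k ∈ nonnegOn s) (hx : x ∈ nonnegOn (middleCut s m₀))
    (hkx : k + x ∈ nonnegOn (middleCut s m₀)) (c : ℂ) :
    termIn hkx c = termIn hk c • termIn hx (1 : ℂ) :=
  Subtype.ext ((congrArg (single _) (mul_one c).symm).trans
    (AddMonoidAlgebra.single_mul_single ..).symm)

variable (I s m₀) in
/-- The sums in `cutSums` that lie in the algebra of the hyperplane section, as a module over the
algebra of the cone. -/
def cutSubmodule : Submodule (coneAlgebra s) (coneAlgebra (middleCut s m₀)) where
  carrier := {x | x.1 ∈ cutSums I s m₀}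
  zero_mem' := (cutSums I s m₀).zero_mem
  add_mem' := fun hx hy => (cutSums I s m₀).add_mem hx hy
  smul_mem' := fun r x hx => by
    obtain ⟨a, ha, b, hb, hab⟩ := Submodule.mem_sup.1 hx
    change r.1 * x.1 ∈ cutSums I s m₀
    rw [← hab, mul_add]
    exact Submodule.add_mem_sup
      (mul_mem_idealOn r.2 ha fun _ hx _ hy => add_mem_posOn (nonnegOn_le_upperCut hx) hy)
      (mul_mem_idealOn r.2 hb fun _ hx _ hy => add_mem_posOn (nonnegOn_le_upperCut hx) hy)

variable (I s m₀) in
/-- The elements of `I` that are non-negative along the hyperplane section. -/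
def middleIdeal : Ideal (coneAlgebra (middleCut s m₀)) :=
  I.comap (coneAlgebra (middleCut s m₀)).val

lemma add_zsmul_mem_nonnegOn_middleCut {r : M} (hr : r ∈ nonnegOn (middleCut s m₀)) (b : ℤ) :
    r + b • m₀ ∈ nonnegOn (middleCut s m₀) :=
  add_mem hr (zeroOn_subset_nonnegOn (zsmul_mem self_mem_zeroOn_middleCut b))

lemma IsCut.eventually_single_mul_mem_supportedIn (h : IsCut s m₀) {r : M}
    (hr : r ∈ nonnegOn (middleCut s m₀)) {p : ℂ[M]}
    (hp : p ∈ supportedIn (nonnegOn (middleCut s m₀) : Set M)) :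
    ∀ᶠ b : ℤ in Filter.atTop,
      single (r + b • m₀) 1 * p ∈ supportedIn (posOn (upperCut s m₀)) := by
  have hpos : ∀ᶠ b : ℤ in Filter.atTop, ∀ m ∈ p.coeff.support,
      (r + m) + b • m₀ ∈ posOn (upperCut s m₀) := by
    rw [Filter.eventually_all_finset]
    exact fun m hm => h.eventually_add_zsmul_mem_posOn_upperCut
      (add_mem hr (hp m (Finsupp.mem_support_iff.1 hm)))
  filter_upwards [hpos] with b hb
  intro m hm
  rw [coeff_single_mul, one_mul] at hm
  convert hb _ (Finsupp.mem_support_iff.2 hm) using 1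
  abel

lemma IsCut.finite_setOf_termIn_mul_notMem (h : IsCut s m₀) {r : M}
    (hr : r ∈ nonnegOn (middleCut s m₀)) {p : coneAlgebra (middleCut s m₀)}
    (hp : p ∈ middleIdeal I s m₀) :
    {b : ℤ | termIn (add_zsmul_mem_nonnegOn_middleCut hr b) 1 * p ∉
      cutSubmodule I s m₀}.Finite := by
  obtain ⟨B, hB⟩ := Filter.eventually_atTop.1 (h.eventually_single_mul_mem_supportedIn hr p.2)
  obtain ⟨B', hB'⟩ := Filter.eventually_atTop.1
    (h.neg.eventually_single_mul_mem_supportedIn (by rwa [middleCut_neg])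
      (p := p.1) (by rw [middleCut_neg]; exact p.2))
  refine (Set.finite_Icc (-B') B).subset fun b hb => ⟨?_, ?_⟩ <;> by_contra! hlt
  · refine hb (Submodule.mem_sup_right ⟨I.mul_mem_left _ hp, ?_⟩)
    have hmem := hB' (-b) (by omega)
    rw [neg_smul_neg] at hmem
    exact hmem
  · exact hb (Submodule.mem_sup_left ⟨I.mul_mem_left _ hp, hB b hlt.le⟩)

lemma IsCut.sub_mul_sub_mem_supportedIn (h : IsCut s m₀) {f g r a : ℂ[M]}
    (hg : g ∈ supportedIn (zeroOn s : Set M))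
    (hfg : f - g ∈ supportedIn (nonnegOn (upperCut s m₀) ∩ posOn (middleCut s m₀)))
    (hr : r ∈ supportedIn (posOn s)) (ha : a ∈ supportedIn (posOn (upperCut s m₀))) :
    f - r * f - a - g ∈ supportedIn (posOn (upperCut s m₀)) := by
  have hf : f ∈ supportedIn (nonnegOn (upperCut s m₀) : Set M) :=
    mem_supportedIn_nonnegOn_of_sub (g := fun _ : Unit => g) (i := ())
      (fun _ => supportedIn_mono zeroOn_le_upperCut hg) le_rfl
      (supportedIn_mono Set.inter_subset_left hfg)
  rw [show f - r * f - a - g = f - g - r * f - a by ring]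
  refine sub_mem (sub_mem (supportedIn_mono (fun m hm => ?_) hfg)
    (mul_mem_supportedIn hr hf fun x hx y hy => ?_)) ha
  · exact h.mem_posOn_upperCut hm.1 fun h₀ => hm.2.2 (zeroOn_le_middleCut h₀)
  · rw [add_comm]
    exact add_mem_posOn hy (h.mem_posOn_upperCut (nonnegOn_le_upperCut hx.1) hx.2)

variable [Module.Finite ℤ M]

-- Far away from the hyperplane, a multiple `ξ^(r + b m₀) p` lies on one of the two halves.
lemma IsCut.exists_finite_forall_mul_mem (h : IsCut s m₀) {p : coneAlgebra (middleCut s m₀)}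
    (hp : p ∈ middleIdeal I s m₀) :
    ∃ G : Set (coneAlgebra (middleCut s m₀)), G.Finite ∧
      ∀ c, c * p ∈ cutSubmodule I s m₀ ⊔ Submodule.span (coneAlgebra s) G := by
  obtain ⟨R, hR, hdecomp⟩ := h.exists_finset_middleCut
  refine ⟨⋃ r : R, (fun b => termIn (add_zsmul_mem_nonnegOn_middleCut (hR r r.2) b) 1 * p) '' _,
    Set.finite_iUnion fun r => (h.finite_setOf_termIn_mul_notMem (hR r r.2) hp).image _,
    fun c => ?_⟩
  set W := cutSubmodule I s m₀ ⊔ Submodule.span (coneAlgebra s) (⋃ r : R, _ '' _)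
  have hW (r) (hr : r ∈ R) (b : ℤ) :
      termIn (add_zsmul_mem_nonnegOn_middleCut (hR r hr) b) 1 * p ∈ W := by
    by_cases hb : termIn (add_zsmul_mem_nonnegOn_middleCut (hR r hr) b) 1 * p ∈
        cutSubmodule I s m₀
    · exact Submodule.mem_sup_left hb
    · exact Submodule.mem_sup_right (Submodule.subset_span
        (Set.mem_iUnion_of_mem ⟨r, hr⟩ ⟨b, hb, rfl⟩))
  refine mem_of_forall_termIn_mem (W.toAddSubmonoid.comap (AddMonoidHom.mulRight p)) c
    fun m hm _ => ?_
  obtain ⟨r, hr, k, hk, b, rfl⟩ := hdecomp m hm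
  change termIn hm _ * p ∈ W
  rw [termIn_add_eq_smul hk (add_zsmul_mem_nonnegOn_middleCut (hR r hr) b), smul_mul_assoc]
  exact W.smul_mem _ (hW r hr b)

lemma IsCut.exists_finite_middleIdeal_le (h : IsCut s m₀) :
    ∃ G : Set (coneAlgebra (middleCut s m₀)), G.Finite ∧
      (middleIdeal I s m₀).restrictScalars (coneAlgebra s) ≤
        cutSubmodule I s m₀ ⊔ Submodule.span _ G := by
  have := isNoetherianRing_monoidSubalgebra (R := ℂ) (nonnegOn_fg (middleCut s m₀))
  obtain ⟨P, hP⟩ : (middleIdeal I s m₀).FG := IsNoetherian.noetherian _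
  choose G hGfin hG using fun p : P =>
    h.exists_finite_forall_mul_mem (hP.le (Submodule.subset_span p.2))
  refine ⟨⋃ p, G p, Set.finite_iUnion hGfin, fun x hx => ?_⟩
  obtain ⟨c, -, rfl⟩ := Submodule.mem_span_finset.1 (hP.ge hx)
  refine sum_mem fun p hp => ?_
  have hle := Submodule.span_mono (R := coneAlgebra s) (Set.subset_iUnion G ⟨p, hp⟩)
  exact sup_le_sup_left hle (cutSubmodule I s m₀) (hG ⟨p, hp⟩ (c p))

lemma IsCut.exists_termIn_mem_map_posIdeal_pow (h : IsCut s m₀) :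
    ∃ C K : ℕ, ∀ m (hm : m ∈ nonnegOn (middleCut s m₀)), ∃ j : ℕ,
      (∑ n ∈ middleCut s m₀, n) m ≤ C * j + K ∧ ∀ c, termIn hm c ∈
        (posIdeal s).map (algebraMap _ (coneAlgebra (middleCut s m₀))) ^ j := by
  obtain ⟨R, hR, hdecomp⟩ := h.exists_finset_middleCut
  obtain ⟨C, hC⟩ := exists_termIn_mem_posIdeal_pow (s := s) (u := ∑ n ∈ middleCut s m₀, n)
    fun m hm => sum_apply_eq_zero (zeroOn_le_middleCut hm)
  have hm₀ : (∑ n ∈ middleCut s m₀, n) m₀ = 0 := sum_apply_eq_zero self_mem_zeroOn_middleCut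
  generalize (∑ n ∈ middleCut s m₀, n) = u at hC hm₀
  refine ⟨C, R.sup fun r => (u r).toNat, fun m hm => ?_⟩
  obtain ⟨r, hr, k, hk, b, rfl⟩ := hdecomp m hm
  obtain ⟨j, hj, hkj⟩ := hC k hk
  refine ⟨j, ?_, fun c => ?_⟩
  · have := Finset.le_sup (f := fun r => (u r).toNat) hr
    rw [map_add, map_add, map_zsmul, hm₀, smul_zero, add_zero]
    omega
  · rw [termIn_add_eq_smul hk (add_zsmul_mem_nonnegOn_middleCut (hR r hr) b), Algebra.smul_def,
      ← Ideal.map_pow]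
    exact Ideal.mul_mem_right _ _ (Ideal.mem_map_of_mem _ (hkj c))

lemma IsCut.exists_mem_map_posIdeal_pow (h : IsCut s m₀) (N : ℕ) :
    ∃ N' : ℕ, ∀ p : coneAlgebra (middleCut s m₀), p.1 ∈ supportedIn (orderedOn s m₀ N') →
      p ∈ (posIdeal s).map (algebraMap _ (coneAlgebra (middleCut s m₀))) ^ N := by
  obtain ⟨C, K, hCK⟩ := h.exists_termIn_mem_map_posIdeal_pow
  refine ⟨C * N + K + 1, fun p hp => mem_of_forall_termIn_mem
    (Submodule.toAddSubmonoid _) p fun m hm hpm => ?_⟩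
  obtain ⟨j, hj, hmj⟩ := hCK m hm
  have hlt : C * N < C * j := by
    have := (hp m hpm).2
    push_cast at this
    zify
    linarith
  exact Ideal.pow_le_pow_right (lt_of_mul_lt_mul_left hlt C.zero_le).le (hmj _)

-- Modulo the sums over the two halves, the elements along the section form a finite module, so
-- Krull's intersection theorem applies to `p`.
lemma IsCut.exists_sub_smul_mem_cutSubmodule (h : IsCut s m₀) {p : coneAlgebra (middleCut s m₀)}
    (hp : ∀ N, p.1 ∈ cutSums I s m₀ ⊔ idealOn I (orderedOn s m₀ N)) :
    ∃ r ∈ posIdeal s, p - r • p ∈ cutSubmodule I s m₀ := by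
  have := isNoetherianRing_monoidSubalgebra (R := ℂ) (nonnegOn_fg s)
  have := isNoetherianRing_monoidSubalgebra (R := ℂ) (nonnegOn_fg (middleCut s m₀))
  obtain ⟨G, hGfin, hG⟩ := h.exists_finite_middleIdeal_le (I := I)
  refine exists_sub_smul_mem_of_forall_pow (posIdeal s) _ _ hGfin hG fun N => ?_
  obtain ⟨N', hN'⟩ := h.exists_mem_map_posIdeal_pow N
  obtain ⟨q, hq, p', hp', hqp⟩ := Submodule.mem_sup.1 (hp N')
  refine ⟨⟨p', supportedIn_mono (fun m hm => hm.1.1) hp'.2⟩, ⟨hp'.1, hN' _ hp'.2⟩, ?_⟩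
  change p.1 - p' ∈ cutSums I s m₀
  rwa [← hqp, add_sub_cancel_right]

-- The difference `f₁ - f₂` of lifts over the two halves is, up to a positive multiple of itself, a
-- sum of elements of `I` that are positive on one half. This corrects `f₁` and `f₂` to the same
-- lift.
theorem IsCut.hasLifts {κ : Type*} [Finite κ] {g : κ → ℂ[M]} (h : IsCut s m₀)
    (hg : ∀ i, g i ∈ supportedIn (zeroOn s : Set M))
    (hconst : ∀ u ∈ relInt (middleCut s m₀), initialIdeal u I = Ideal.span (Set.range g))
    (hup : HasLifts I g (posOn (upperCut s m₀))) (hdn : HasLifts I g (posOn (upperCut s (-m₀))))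
    (hmid : HasLifts I g (posOn (middleCut s m₀))) : HasLifts I g (posOn s) := by
  have hup := h.hasLifts_upperCut_inter hg hconst hup hmid
  have hdn := h.neg.hasLifts_upperCut_inter hg (by rwa [middleCut_neg]) hdn (by rwa [middleCut_neg])
  rw [middleCut_neg] at hdn
  intro i
  obtain ⟨f₁, hf₁I, hf₁⟩ := hup i
  obtain ⟨f₂, hf₂I, hf₂⟩ := hdn i
  have hp : f₁ - f₂ ∈ idealOn I ((nonnegOn (middleCut s m₀) : Set M) \ zeroOn s) := by
    refine ⟨sub_mem hf₁I hf₂I, ?_⟩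
    have hpos : posOn (middleCut s m₀) ⊆ (nonnegOn (middleCut s m₀) : Set M) \ zeroOn s :=
      fun m hm => ⟨hm.1, fun h₀ => hm.2 (zeroOn_le_middleCut h₀)⟩
    rw [← sub_sub_sub_cancel_right f₁ f₂ (g i)]
    exact supportedIn_mono hpos (sub_mem (supportedIn_mono Set.inter_subset_right hf₁)
      (supportedIn_mono Set.inter_subset_right hf₂))
  obtain ⟨r, hr, hrp⟩ := h.exists_sub_smul_mem_cutSubmodule
    (p := ⟨f₁ - f₂, supportedIn_mono Set.sdiff_subset hp.2⟩)
    fun N => h.idealOn_le_sup_orderedOn hg hconst hup hdn N hp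
  obtain ⟨a, ha, b, hb, hab⟩ := Submodule.mem_sup.1 hrp
  have hab : a + b = (f₁ - f₂) - r.1 * (f₁ - f₂) := hab
  have h₁ := h.sub_mul_sub_mem_supportedIn (hg i) hf₁ hr ha.2
  have h₂ := h.neg.sub_mul_sub_mem_supportedIn (hg i) (by rwa [middleCut_neg]) hr (neg_mem hb.2)
  rw [show f₂ - r.1 * f₂ - -b - g i = f₁ - r.1 * f₁ - a - g i by linear_combination hab] at h₂
  exact ⟨f₁ - r.1 * f₁ - a, sub_mem (sub_mem hf₁I (I.mul_mem_left _ hf₁I)) ha.1, fun m hm =>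
    ⟨mem_nonnegOn_of_upperCut (h₁ m hm).1 (h₂ m hm).1,
      fun h₀ => (h₁ m hm).2 (zeroOn_le_upperCut h₀)⟩⟩

end Merging

section Existence

variable {M : Type} [AddCommGroup M] {κ : Type*} {I J : Ideal ℂ[M]} {s : Finset (M →+ ℤ)}
  {U : Finset ℂ[M]} {m m₀ : M}

lemma not_isCut_iff : ¬IsCut s m ↔ m ∈ nonnegOn s ∨ -m ∈ nonnegOn s := by
  simp only [IsCut, mem_nonnegOn, not_and_or (a := ∃ n ∈ s, 0 < n m), map_neg,
    Left.nonneg_neg_iff]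
  push Not
  exact or_comm

lemma IsCut.of_subset_closure {t : Finset (M →+ ℤ)} (h : IsCut t m)
    (hts : (t : Set (M →+ ℤ)) ⊆ AddSubmonoid.closure (s : Set (M →+ ℤ))) : IsCut s m := by
  contrapose h
  rw [not_isCut_iff] at h ⊢
  exact h.imp (fun hm => nonnegOn_anti hts hm) fun hm => nonnegOn_anti hts hm

lemma not_isCut_upperCut : ¬IsCut (upperCut s m₀) m₀ := by
  refine not_isCut_iff.2 (Or.inl fun n hn => ?_)
  rcases mem_upperCut.1 hn with h | h
  · exact h.2.le
  · exact (self_mem_zeroOn_middleCut n h).ge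

lemma not_isCut_upperCut_neg : ¬IsCut (upperCut s (-m₀)) m₀ := fun h =>
  not_isCut_upperCut h.neg

lemma not_isCut_middleCut : ¬IsCut (middleCut s m₀) m₀ :=
  not_isCut_iff.2 (Or.inl (zeroOn_subset_nonnegOn self_mem_zeroOn_middleCut))

/-- The differences of the exponents of each of the Laurent polynomials in `U`, that is, the normal
vectors of the hyperplanes along which the initial forms of the elements of `U` can change. -/
def exponentDifferences (U : Finset ℂ[M]) : Set M :=
  {a | ∃ f ∈ U, ∃ m m', f.coeff m ≠ 0 ∧ f.coeff m' ≠ 0 ∧ m - m' = a}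

lemma finite_exponentDifferences (U : Finset ℂ[M]) : (exponentDifferences U).Finite := by
  classical
  refine (Set.finite_mem_finset (U.biUnion fun f =>
    (f.coeff.support ×ˢ f.coeff.support).image fun x => x.1 - x.2)).subset ?_
  rintro _ ⟨f, hf, m, m', hm, hm', rfl⟩
  exact Finset.mem_biUnion.2 ⟨f, hf, Finset.mem_image.2 ⟨(m, m'), by simp [hm, hm'], rfl⟩⟩

-- Divide `f` by its monomial of least order along the cone.
lemma exists_single_mul_mem_supportedIn {f : ℂ[M]}
    (hsign : ∀ m m', f.coeff m ≠ 0 → f.coeff m' ≠ 0 → ¬IsCut s (m - m')) :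
    ∃ m₁, single (-m₁) 1 * f ∈ supportedIn (nonnegOn s : Set M) ∧
      initialForm (latticeToReal (∑ n ∈ s, n)) f =
        single m₁ 1 * part (zeroOn s : Set M) (single (-m₁) 1 * f) := by
  rcases eq_or_ne f 0 with rfl | hf0
  · exact ⟨0, by simp [initialForm_zero]⟩
  obtain ⟨m₁, hm₁, hmin, hin⟩ := exists_initialForm_eq_part (latticeToReal (∑ n ∈ s, n)) hf0
  have hsupp : ∀ m, f.coeff m ≠ 0 → m - m₁ ∈ nonnegOn s := by
    intro m hm
    rcases not_isCut_iff.1 (hsign _ _ hm hm₁) with h | h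
    · exact h
    · have hle : (∑ n ∈ s, n) m₁ ≤ (∑ n ∈ s, n) m := Int.cast_le.1 (hmin m hm)
      have hge := sum_apply_nonneg h
      have hzero := (sum_apply_eq_zero_iff h).1 (by rw [map_neg, map_sub] at hge ⊢; omega)
      exact zeroOn_subset_nonnegOn (neg_mem_iff.1 hzero)
  refine ⟨m₁, fun m hm => ?_, ?_⟩
  · rw [coeff_single_mul, one_mul, sub_neg_eq_add] at hm
    simpa using hsupp _ hm
  · ext m
    classical
    rw [hin, coeff_single_mul, coeff_part, coeff_part, coeff_single_mul, one_mul, one_mul,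
      sub_neg_eq_add, sub_add_cancel]
    by_cases hm : f.coeff m = 0
    · simp [hm]
    refine if_congr ?_ rfl rfl
    rw [SetLike.mem_coe, ← sum_apply_eq_zero_iff (hsupp m hm), map_sub, sub_eq_zero]
    exact Int.cast_inj

lemma hasLifts_of_not_isCut {g : κ → ℂ[M]} (hUI : (U : Set ℂ[M]) ⊆ I)
    (hU : ∀ w : M →+ ℝ, initialIdeal w I = Ideal.span (initialForm w '' U))
    (hconst : ∀ u ∈ relInt s, initialIdeal u I = J)
    (hg : ∀ i, g i ∈ supportedIn (zeroOn s : Set M)) (hgJ : ∀ i, g i ∈ J)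
    (hsign : ∀ a ∈ exponentDifferences U, ¬IsCut s a) : HasLifts I g (posOn s) := by
  choose m hms hm using fun f : U => exists_single_mul_mem_supportedIn (f := f.1) (s := s)
    fun m m' hm hm' => hsign _ ⟨f, f.2, m, m', hm, hm', rfl⟩
  set F : U → ℂ[M] := fun f => single (-m f) 1 * f.1
  have hFI : ∀ f, F f ∈ I := fun f => I.mul_mem_left _ (hUI f.2)
  have hJ : J ≤ Ideal.span (Set.range fun f => part (zeroOn s : Set M) (F f)) := by
    rw [← hconst _ (latticeToReal_sum_mem_relInt s), hU, Ideal.span_le]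
    rintro _ ⟨f, hf, rfl⟩
    rw [hm ⟨f, hf⟩]
    exact Ideal.mul_mem_left _ _ (Ideal.subset_span ⟨⟨f, hf⟩, rfl⟩)
  intro i
  obtain ⟨c, hc, hsum⟩ := exists_coefficients
    (fun f => supportedIn_mono Set.inter_subset_right (part_mem_supportedIn (hms f)))
    (S := zeroOn s) (fun m z hz => add_mem_zeroOn_iff hz) (hJ (hgJ i)) (hg i)
  refine ⟨∑ f, c f * F f, sum_mem fun f _ => I.mul_mem_left _ (hFI f), ?_⟩
  rw [hsum, ← Finset.sum_sub_distrib]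
  refine sum_mem fun f _ => ?_
  rw [← mul_sub]
  exact mul_mem_supportedIn (hc f) (sub_part_mem_supportedIn (hms f))
    fun a ha b hb => add_mem_posOn (zeroOn_subset_nonnegOn ha) hb

-- Cut the cone successively by the hyperplanes in `H`, until no exponent difference changes sign.
lemma hasLifts_of_forall_mem_or_not_isCut [Finite κ] [Module.Finite ℤ M] {g : κ → ℂ[M]}
    (hUI : (U : Set ℂ[M]) ⊆ I)
    (hU : ∀ w : M →+ ℝ, initialIdeal w I = Ideal.span (initialForm w '' U)) {H : Set M}
    (hH : H.Finite) (s : Finset (M →+ ℤ))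
    (hconst : ∀ u ∈ relInt s, initialIdeal u I = Ideal.span (Set.range g))
    (hg : ∀ i, g i ∈ supportedIn (zeroOn s : Set M))
    (hsign : ∀ a ∈ exponentDifferences U, a ∈ H ∨ ¬IsCut s a) : HasLifts I g (posOn s) := by
  induction H, hH using Set.Finite.induction_on generalizing s with
  | empty =>
    exact hasLifts_of_not_isCut hUI hU hconst hg (fun i => Ideal.subset_span ⟨i, rfl⟩)
      fun a ha => (hsign a ha).resolve_left (Set.notMem_empty a)
  | @insert h H _ _ ih =>
    have piece : ∀ t : Finset (M →+ ℤ),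
        (t : Set (M →+ ℤ)) ⊆ AddSubmonoid.closure (s : Set (M →+ ℤ)) → ¬IsCut t h →
        relInt t ⊆ relInt s → HasLifts I g (posOn t) := by
      intro t hts ht hrel
      refine ih t (fun u hu => hconst u (hrel hu))
        (fun i => supportedIn_mono (zeroOn_anti hts) (hg i)) fun a ha => ?_
      rcases hsign a ha with (rfl | haH) | has
      · exact Or.inr ht
      · exact Or.inl haH
      · exact Or.inr fun hat => has (hat.of_subset_closure hts)
    by_cases hs : IsCut s h
    · exact hs.hasLifts hg (fun u hu => hconst u (hs.relInt_middleCut_subset hu))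
        (piece _ upperCut_subset_closure not_isCut_upperCut hs.relInt_upperCut_subset)
        (piece _ upperCut_subset_closure not_isCut_upperCut_neg hs.neg.relInt_upperCut_subset)
        (piece _ middleCut_subset_closure not_isCut_middleCut hs.relInt_middleCut_subset)
    · exact piece s AddSubmonoid.subset_closure hs subset_rfl

lemma exists_mem_relInt_forall_apply_eq_zero (s : Finset (M →+ ℤ)) :
    ∃ u ∈ relInt s, ∀ m, u m = 0 → m ∈ zeroOn s := by
  obtain ⟨c, hc, h⟩ := exists_pos_forall_sum_mul_eq_zero s
  have hu : ∀ m, (∑ n ∈ s, c n • latticeToReal n) m = 0 → m ∈ zeroOn s := by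
    intro m hm
    rw [AddMonoidHom.finsetSum_apply] at hm
    exact h m hm
  refine ⟨_, ⟨sum_mem fun n hn => ?_, fun m _ => hu m⟩, hu⟩
  exact Submodule.smul_mem _ (⟨c n, (hc n).le⟩ : {c : ℝ // 0 ≤ c})
    (Submodule.subset_span ⟨n, hn, rfl⟩)

lemma exists_single_mul_initialForm_mem_supportedIn {u : M →+ ℝ}
    (hu : ∀ m, u m = 0 → m ∈ zeroOn s) (f : ℂ[M]) :
    ∃ m, single (-m) 1 * initialForm u f ∈ supportedIn (zeroOn s : Set M) := by
  rcases eq_or_ne f 0 with rfl | hf0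
  · exact ⟨0, by simp [initialForm_zero]⟩
  obtain ⟨m₁, -, -, hin⟩ := exists_initialForm_eq_part u hf0
  refine ⟨m₁, fun m hm => hu m ?_⟩
  rw [coeff_single_mul, one_mul, sub_neg_eq_add, hin, coeff_part_ne_zero] at hm
  simpa using hm.1

-- At a general point of the cone, initial forms are homogeneous for the lattice orthogonal to it.
lemma exists_generators_supportedIn_zeroOn
    (hU : ∀ w : M →+ ℝ, initialIdeal w I = Ideal.span (initialForm w '' U))
    (hconst : ∀ u ∈ relInt s, initialIdeal u I = J) :
    ∃ g : U → ℂ[M], (∀ i, g i ∈ supportedIn (zeroOn s : Set M)) ∧ J = Ideal.span (Set.range g) := by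
  obtain ⟨u, hu, hu0⟩ := exists_mem_relInt_forall_apply_eq_zero s
  choose m hm using exists_single_mul_initialForm_mem_supportedIn hu0
  refine ⟨fun f => single (-m f) 1 * initialForm u f, fun f => hm f, ?_⟩
  rw [← hconst u hu, hU]
  apply le_antisymm <;> rw [Ideal.span_le]
  · rintro _ ⟨f, hf, rfl⟩
    have hmul : initialForm u f = single (m f) 1 * (single (-m f) 1 * initialForm u f) := by
      rw [← mul_assoc, AddMonoidAlgebra.single_mul_single, add_neg_cancel, mul_one,
        ← AddMonoidAlgebra.one_def, one_mul]
    rw [hmul]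
    exact Ideal.mul_mem_left _ _ (Ideal.subset_span ⟨⟨f, hf⟩, rfl⟩)
  · rintro _ ⟨f, rfl⟩
    exact Ideal.mul_mem_left _ _ (Ideal.subset_span ⟨f.1, f.2, rfl⟩)

theorem initialIdeal_eq_span_part [Module.Free ℤ M] [Module.Finite ℤ M]
    (hconst : ∀ u ∈ relInt s, initialIdeal u I = J) :
    J = Ideal.span (part (zeroOn s : Set M) '' {f ∈ I | f ∈ supportedIn (nonnegOn s : Set M)}) := by
  obtain ⟨U, hUI, hU⟩ := exists_finset_forall_initialIdeal_eq_span I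
  obtain ⟨g, hg, rfl⟩ := exists_generators_supportedIn_zeroOn hU hconst
  have hlift := hasLifts_of_forall_mem_or_not_isCut hUI hU (finite_exponentDifferences U) s hconst
    hg fun a ha => Or.inl ha
  apply le_antisymm <;> rw [Ideal.span_le]
  · rintro _ ⟨i, rfl⟩
    obtain ⟨f, hf, hfi⟩ := hlift i
    refine Ideal.subset_span
      ⟨f, ⟨hf, mem_supportedIn_nonnegOn_of_sub hg Set.sdiff_subset hfi⟩, ?_⟩
    rw [← sub_eq_zero, ← part_eq_zero hfi Set.disjoint_sdiff_left, map_sub, part_eq_self (hg i)]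
  · rintro _ ⟨f, ⟨hf, hfs⟩, rfl⟩
    exact part_zeroOn_mem hconst hf hfs

end Existence

section Cone

variable {M : Type} [AddCommGroup M] {s : Finset (M →+ ℤ)} {σ : PointedCone ℝ (M →+ ℝ)}

lemma dualMonoid_hull :
    dualMonoid (PointedCone.hull ℝ (latticeToReal '' (s : Set (M →+ ℤ)))) = nonnegOn s := by
  ext m
  refine ⟨fun h n hn => ?_, fun h => mem_dualMonoid_hull _ _ h⟩
  exact Int.cast_nonneg_iff.1
    (h _ (latticeToReal_mem_hull (AddSubmonoid.subset_closure hn)))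

lemma mem_perp_iff {m : M} : m ∈ perp σ ↔ m ∈ dualMonoid σ ∧ -m ∈ dualMonoid σ := by
  constructor
  · exact fun h => ⟨fun w hw => (h w hw).ge, fun w hw => by rw [map_neg, h w hw, neg_zero]⟩
  · rintro ⟨hm, hneg⟩ w hw
    have := hm w hw
    have := hneg w hw
    rw [map_neg] at this
    linarith

lemma perp_hull :
    perp (PointedCone.hull ℝ (latticeToReal '' (s : Set (M →+ ℤ)))) = zeroOn s := by
  ext m
  rw [mem_perp_iff, dualMonoid_hull]
  constructor
  · rintro ⟨hm, hneg⟩ n hn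
    have := hm n hn
    have := hneg n hn
    rw [map_neg] at this
    omega
  · exact fun h => ⟨zeroOn_subset_nonnegOn h, zeroOn_subset_nonnegOn (neg_mem h)⟩

lemma relInt_subset_relInterior :
    relInt s ⊆ relInterior (PointedCone.hull ℝ (latticeToReal '' (s : Set (M →+ ℤ)))) := by
  rintro u ⟨hu, hu0⟩
  refine ⟨hu, ?_⟩
  rintro τ ⟨m, hm, hτ⟩ huτ
  rw [dualMonoid_hull] at hm
  have h0 : m ∈ zeroOn s := hu0 m hm ((hτ u).1 huτ).2
  rw [← perp_hull] at h0
  ext w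
  rw [hτ]
  exact ⟨fun h => h.1, fun h => ⟨h, h0 w h⟩⟩

/-- The ideal of `X̄ ∩ V_σ` in the affine chart `V_σ`, where `X` is the subscheme of the torus
defined by `I`. -/
def chartIdeal (σ : PointedCone ℝ (M →+ ℝ)) (I : Ideal ℂ[M]) : Ideal ℂ[dualMonoid σ] :=
  I.comap (AddMonoidAlgebra.mapDomainAlgHom ℂ ℂ (dualMonoid σ).subtype)

open Classical in
lemma orbitRingMap_single (σ : PointedCone ℝ (M →+ ℝ)) (m : dualMonoid σ) (c : ℂ) :
    orbitRingMap σ (single m c) = if h : (m : M) ∈ perp σ then single ⟨m, h⟩ c else 0 := by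
  rw [orbitRingMap, AddMonoidAlgebra.lift_single]
  by_cases h : (m : M) ∈ perp σ <;> simp [h]

lemma mapDomain_orbitRingMap (σ : PointedCone ℝ (M →+ ℝ)) (f : ℂ[dualMonoid σ]) :
    AddMonoidAlgebra.mapDomainAlgHom ℂ ℂ (perp σ).subtype (orbitRingMap σ f) =
      part (perp σ : Set M) (AddMonoidAlgebra.mapDomainAlgHom ℂ ℂ (dualMonoid σ).subtype f) := by
  induction f using AddMonoidAlgebra.induction_linear with
  | zero => simp
  | add f g hf hg => simp only [map_add, hf, hg]
  | single m c =>
    rw [orbitRingMap_single]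
    split_ifs with h
    · rw [part_eq_self]
      · simp
      · simpa using single_mem_supportedIn (S := (perp σ : Set M)) h c
    · rw [map_zero, part_eq_zero (T := {m.1}) _ (by simpa using h)]
      simpa using single_mem_supportedIn (Set.mem_singleton m.1) c

theorem initialIdeal_eq_map [Module.Free ℤ M] [Module.Finite ℤ M] {I : Ideal ℂ[M]}
    (hσ : IsRationalPolyhedral σ) {w : M →+ ℝ}
    (h : ∀ u ∈ relInterior σ, initialIdeal u I = initialIdeal w I) :
    initialIdeal w I = ((chartIdeal σ I).map (orbitRingMap σ)).map
      (AddMonoidAlgebra.mapDomainAlgHom ℂ ℂ (perp σ).subtype) := by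
  obtain ⟨s, hs⟩ := hσ
  have hdual : dualMonoid σ = nonnegOn s := by rw [hs, dualMonoid_hull]
  have hperp : perp σ = zeroOn s := by rw [hs, perp_hull]
  rw [initialIdeal_eq_span_part fun u hu => h u (hs ▸ relInt_subset_relInterior hu),
    ← hdual, ← hperp]
  change _ = Ideal.map (AddMonoidAlgebra.mapDomainAlgHom ℂ ℂ (perp σ).subtype).toRingHom
    (Ideal.map (orbitRingMap σ).toRingHom (chartIdeal σ I))
  have hsupp : ∀ f, f ∈ supportedIn (dualMonoid σ : Set M) ↔
      f ∈ (AddMonoidAlgebra.mapDomainAlgHom ℂ ℂ (dualMonoid σ).subtype).range := fun f => by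
    rw [range_mapDomainAlgHom_subtype]
    rfl
  rw [Ideal.map_map]
  refine congrArg Ideal.span (Set.ext fun x => ⟨?_, ?_⟩)
  · rintro ⟨f, ⟨hf, hfs⟩, rfl⟩
    obtain ⟨f, rfl⟩ := (hsupp f).1 hfs
    exact ⟨f, hf, mapDomain_orbitRingMap σ f⟩
  · rintro ⟨f, hf, rfl⟩
    exact ⟨_, ⟨hf, (hsupp _).2 ⟨f, rfl⟩⟩, (mapDomain_orbitRingMap σ f).symm⟩

end Cone

/-! ### The splitting of the torus -/

section Splitting

lemma exists_retraction_of_nsmulSaturated {N : Type*} [AddCommGroup N] [Module.Finite ℤ N]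
    {L : AddSubgroup N} (hL : L.toAddSubmonoid.NSMulSaturated) :
    ∃ p : N →+ L, ∀ n : L, p n = n := by
  let L' : Submodule ℤ N := L.toIntSubmodule
  have : Module.IsTorsionFree ℤ (N ⧸ L') := by
    refine Module.isTorsionFree_int_iff_isAddTorsionFree.2 ⟨fun k hk a b hab => ?_⟩
    obtain ⟨a, rfl⟩ := L'.mkQ_surjective a
    obtain ⟨b, rfl⟩ := L'.mkQ_surjective b
    refine (Submodule.Quotient.eq L').2 ((@hL k (a - b) ?_).resolve_left hk)
    rw [smul_sub]
    exact (Submodule.Quotient.eq L').1 hab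
  obtain ⟨q, hq⟩ := Module.projective_lifting_property L'.mkQ LinearMap.id L'.mkQ_surjective
  have hsplit := (LinearMap.exact_subtype_mkQ L').split_tfae L'.subtype_injective L'.mkQ_surjective
  obtain ⟨p, hp⟩ : ∃ p : N →ₗ[ℤ] L', p ∘ₗ L'.subtype = LinearMap.id :=
    (hsplit.out 0 1).1 (Exists.intro q hq)
  exact ⟨p.toAddMonoidHom, fun n => LinearMap.congr_fun hp n⟩

lemma exists_apply_eq_of_dual_dual {M : Type*} [AddCommGroup M] [Module.Free ℤ M]
    [Module.Finite ℤ M] (d : (M →+ ℤ) →+ ℤ) : ∃ m, ∀ n : M →+ ℤ, n m = d n := by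
  let d' : Module.Dual ℤ (Module.Dual ℤ M) :=
    d.toIntLinearMap ∘ₗ (addMonoidHomLequivInt ℤ).symm.toLinearMap
  obtain ⟨m, hm⟩ := (Module.bijective_dual_eval ℤ M).2 d'
  exact ⟨m, fun n => LinearMap.congr_fun hm n.toIntLinearMap⟩

variable {M : Type} [AddCommGroup M] {σ : PointedCone ℝ (M →+ ℝ)}

lemma restrictSpan_apply (m : M) (n : latticeSpan σ) : restrictSpan σ m n = n.1 m := rfl

lemma restrictSpan_eq_zero_iff (hσ : IsRationalPolyhedral σ) {m : M} :
    restrictSpan σ m = 0 ↔ m ∈ perp σ := by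
  constructor
  · intro h
    obtain ⟨s, rfl⟩ := hσ
    rw [perp_hull]
    exact fun n hn => DFunLike.congr_fun h ⟨n, AddSubgroup.subset_closure
      (latticeToReal_mem_hull (AddSubmonoid.subset_closure hn))⟩
  · intro h
    have hle : latticeSpan σ ≤ (AddMonoidHom.eval m).ker :=
      (AddSubgroup.closure_le _).2 fun n hn => Int.cast_eq_zero.1 (h _ hn)
    ext n
    exact hle n.2

lemma exists_eq_sub_of_mem_latticeSpan {n : M →+ ℤ} (hn : n ∈ latticeSpan σ) :
    ∃ a b, latticeToReal a ∈ σ ∧ latticeToReal b ∈ σ ∧ n = a - b := by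
  have hzero : latticeToReal (0 : M →+ ℤ) ∈ σ := latticeToReal_zero (M := M) ▸ zero_mem σ
  induction hn using AddSubgroup.closure_induction with
  | mem a ha => exact ⟨a, 0, ha, hzero, (sub_zero a).symm⟩
  | zero => exact ⟨0, 0, hzero, hzero, (sub_zero 0).symm⟩
  | add _ _ _ _ hx hy =>
    obtain ⟨a, b, ha, hb, rfl⟩ := hx
    obtain ⟨c, d, hc, hd, rfl⟩ := hy
    exact ⟨a + c, b + d, latticeToReal_add a c ▸ add_mem ha hc,
      latticeToReal_add b d ▸ add_mem hb hd, sub_add_sub_comm a b c d⟩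
  | neg _ _ hx =>
    obtain ⟨a, b, ha, hb, rfl⟩ := hx
    exact ⟨b, a, hb, ha, neg_sub a b⟩

lemma latticeToReal_nsmul (k : ℕ) (a : M →+ ℤ) :
    latticeToReal (k • a) = (k : ℝ) • latticeToReal a := by
  ext m
  simp [latticeToReal]

lemma latticeToReal_mem_of_nsmul_mem {k : ℕ} (hk : k ≠ 0) {n : M →+ ℤ}
    (h : latticeToReal (k • n) ∈ σ) : latticeToReal n ∈ σ := by
  have := σ.smul_mem (inv_nonneg.2 k.cast_nonneg) h
  rwa [latticeToReal_nsmul, inv_smul_smul₀ (Nat.cast_ne_zero.2 hk)] at this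

variable (σ) in
lemma nsmulSaturated_latticeSpan : (latticeSpan σ).toAddSubmonoid.NSMulSaturated := by
  intro k n h
  refine or_iff_not_imp_left.2 fun hk => ?_
  obtain ⟨a, b, ha, hb, hab⟩ := exists_eq_sub_of_mem_latticeSpan h
  obtain ⟨l, rfl⟩ := Nat.exists_eq_succ_of_ne_zero hk
  have hmul : latticeToReal ((l + 1) • (n + b)) ∈ σ := by
    have : (l + 1) • (n + b) = a + l • b := by
      rw [smul_add, hab, succ_nsmul]
      abel
    rw [this, latticeToReal_add, latticeToReal_nsmul]
    exact add_mem ha (σ.smul_mem l.cast_nonneg hb)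
  have hnb : latticeToReal (n + b) ∈ σ := latticeToReal_mem_of_nsmul_mem hk hmul
  have hsub : n + b - b ∈ latticeSpan σ :=
    sub_mem (AddSubgroup.subset_closure hnb) (AddSubgroup.subset_closure hb)
  rwa [add_sub_cancel_right] at hsub

variable [Module.Free ℤ M] [Module.Finite ℤ M]

variable (σ) in
lemma restrictSpan_surjective : Function.Surjective (restrictSpan σ) := by
  obtain ⟨p, hp⟩ := exists_retraction_of_nsmulSaturated (nsmulSaturated_latticeSpan σ)
  intro φ
  obtain ⟨m, hm⟩ := exists_apply_eq_of_dual_dual (φ.comp p)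
  refine ⟨m, ?_⟩
  ext n
  rw [restrictSpan_apply, hm, AddMonoidHom.comp_apply, hp]

variable (σ) in
lemma exists_section_restrictSpan :
    ∃ r : (latticeSpan σ →+ ℤ) →+ M, ∀ φ, restrictSpan σ (r φ) = φ := by
  have : Module.Finite ℤ (latticeSpan σ) :=
    inferInstanceAs (Module.Finite ℤ (latticeSpan σ).toIntSubmodule)
  have : Module.Free ℤ (latticeSpan σ) :=
    inferInstanceAs (Module.Free ℤ (latticeSpan σ).toIntSubmodule)
  obtain ⟨r, hr⟩ := Module.projective_lifting_property (restrictSpan σ).toIntLinearMap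
    LinearMap.id (restrictSpan_surjective σ)
  exact ⟨r.toAddMonoidHom, fun φ => LinearMap.congr_fun hr φ⟩

end Splitting

/-! ### Torsors in cartesian monoidal categories -/

section Translation

open scoped MonObj

variable {C : Type*} [Category C]

lemma isSplitEpi_of_isPullback {T O X Q : C} {q : X ⟶ Q} {k : X ⟶ T} {j : Q ⟶ O} {π : T ⟶ O}
    (h : IsPullback q k j π) [IsSplitEpi π] : IsSplitEpi q :=
  .mk' ⟨h.lift (𝟙 Q) (j ≫ section_ π) (by simp), h.lift_fst _ _ _⟩

variable [CartesianMonoidalCategory C]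

lemma isPullback_lift_of_isKernelPair {P X Q : C} {a b : P ⟶ X} {q : X ⟶ Q}
    (h : IsKernelPair q a b) :
    IsPullback (lift a b) (b ≫ q) (q ⊗ₘ q) (lift (𝟙 Q) (𝟙 Q)) := by
  have hfst (c : PullbackCone (q ⊗ₘ q) (lift (𝟙 Q) (𝟙 Q))) :
      c.fst ≫ fst X X ≫ q = c.snd := by
    simpa only [Category.assoc, tensorHom_fst, lift_fst, Category.comp_id]
      using congrArg (· ≫ fst Q Q) c.condition
  have hsnd (c : PullbackCone (q ⊗ₘ q) (lift (𝟙 Q) (𝟙 Q))) :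
      c.fst ≫ snd X X ≫ q = c.snd := by
    simpa only [Category.assoc, tensorHom_snd, lift_snd, Category.comp_id]
      using congrArg (· ≫ snd Q Q) c.condition
  refine ⟨⟨by ext <;> simp [h.w]⟩, ⟨PullbackCone.IsLimit.mk _
    (fun c => h.lift (c.fst ≫ fst X X) (c.fst ≫ snd X X) ?_) (fun c => ?_) (fun c => ?_)
    fun c m hm _ => ?_⟩⟩
  · rw [Category.assoc, Category.assoc, hfst, hsnd]
  · ext <;> simp
  · rw [h.lift_snd_assoc, Category.assoc, hsnd]
  · apply h.hom_ext
    · rw [h.lift_fst, ← hm, Category.assoc, lift_fst]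
    · rw [h.lift_snd, ← hm, Category.assoc, lift_snd]

variable {G T O X Q : C} [GrpObj T] {i : G ⟶ T} {π : T ⟶ O} {k : X ⟶ T} {j : Q ⟶ O} {q : X ⟶ Q}

section Action

variable [MonObj O] [IsMonHom π]

lemma mul_comp_eq_of_comp_eq_one (hiπ : i ≫ π = 1) {S : C} (a : S ⟶ G) (b : S ⟶ T) :
    ((a ≫ i) * b) ≫ π = b ≫ π := by
  rw [MonObj.mul_comp, Category.assoc, hiπ, MonObj.comp_one, one_mul]

/-- Translation by `G` on the preimage `X ⊆ T` of `Q ⊆ O`, if `G` maps to the kernel of `T → O`. -/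
def translation (h : IsPullback q k j π) (hiπ : i ≫ π = 1) : G ⊗ X ⟶ X :=
  h.lift (snd G X ≫ q) ((fst G X ≫ i) * (snd G X ≫ k))
    (by rw [mul_comp_eq_of_comp_eq_one hiπ, Category.assoc, Category.assoc, h.w])

lemma lift_translation_comp (h : IsPullback q k j π) (hiπ : i ≫ π = 1) {S : C} (a : S ⟶ G)
    (b : S ⟶ X) : lift a b ≫ translation h hiπ ≫ k = (a ≫ i) * (b ≫ k) := by
  rw [translation, h.lift_snd, MonObj.comp_mul, lift_fst_assoc, lift_snd_assoc]

lemma translation_comp (h : IsPullback q k j π) (hiπ : i ≫ π = 1) :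
    translation h hiπ ≫ k = (i ⊗ₘ k) ≫ μ := by
  have := lift_translation_comp h hiπ (fst G X) (snd G X)
  rwa [lift_fst_snd, Category.id_comp, Hom.mul_def, lift_fst_comp_snd_comp] at this

lemma translation_comp_quotient (h : IsPullback q k j π) (hiπ : i ≫ π = 1) :
    translation h hiπ ≫ q = snd G X ≫ q := h.lift_fst _ _ _

/-- The action by translation of `G` on `X`. -/
abbrev translationAction [GrpObj G] [IsMonHom i] [Mono k] (h : IsPullback q k j π)
    (hiπ : i ≫ π = 1) : ModObj G X where
  smul := translation h hiπ
  one_smul := by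
    change η ▷ X ≫ translation h hiπ = (λ_ X).hom
    rw [← cancel_mono k, Category.assoc,
      show η ▷ X = lift (fst _ _ ≫ (η : _ ⟶ G)) (snd _ _) by ext <;> simp,
      lift_translation_comp, MonObj.one_eq_one, MonObj.comp_one, MonObj.one_comp, one_mul,
      leftUnitor_hom]
  mul_smul := by
    change μ ▷ X ≫ translation h hiπ = (α_ G G X).hom ≫ G ◁ translation h hiπ ≫ translation h hiπ
    have hmul : (μ : G ⊗ G ⟶ G) ▷ X =
        lift ((fst _ _ ≫ fst _ _) * (fst _ _ ≫ snd _ _)) (snd _ _) := by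
      ext
      · rw [whiskerRight_fst, lift_fst, ← MonObj.comp_mul, Hom.mul_def, lift_fst_snd,
          Category.id_comp]
      · simp
    have hassoc : (α_ G G X).hom ≫ G ◁ translation h hiπ = lift (fst _ _ ≫ fst _ _)
        (lift (fst _ _ ≫ snd _ _) (snd _ _) ≫ translation h hiπ) := by
      ext
      · simp
      · simp only [Category.assoc, whiskerLeft_snd, lift_snd]
        rw [← Category.assoc]
        congr 1
        ext <;> simp
    rw [← cancel_mono k, Category.assoc, hmul, lift_translation_comp, ← Category.assoc, hassoc,
      Category.assoc, lift_translation_comp]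
    simp only [Category.assoc, lift_translation_comp, MonObj.mul_comp, mul_assoc]

end Action

/-- Morphisms `i : G ⟶ T` and `π : T ⟶ O`, with a retraction `t` of `i` and a section `s` of `π`,
that exhibit the monoid object `T` as the product of `G` and `O`. -/
structure IsSplitting [MonObj G] [MonObj O] (i : G ⟶ T) (π : T ⟶ O) (t : T ⟶ G) (s : O ⟶ T) :
    Prop where
  inl_fst : i ≫ t = 𝟙 G
  inl_snd : i ≫ π = 1
  inr_fst : s ≫ t = 1
  inr_snd : s ≫ π = 𝟙 O
  total : (t ≫ i) * (π ≫ s) = 𝟙 T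

namespace IsSplitting

variable {t : T ⟶ G} {s : O ⟶ T}

lemma comp_retraction_comp [MonObj G] [MonObj O] [IsMonHom s] (hT : IsSplitting i π t s) {S : C}
    {x : S ⟶ T} (hx : x ≫ π = 1) : x ≫ t ≫ i = x := by
  have := congrArg (x ≫ ·) hT.total
  rwa [MonObj.comp_mul, reassoc_of% hx, MonObj.one_comp, mul_one, Category.comp_id] at this

lemma isKernelPair_translation [MonObj G] [GrpObj O] [IsMonHom π] [IsMonHom s] [Mono k]
    (hT : IsSplitting i π t s) (h : IsPullback q k j π) :
    IsKernelPair q (translation h hT.inl_snd) (snd G X) := by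
  refine ⟨⟨translation_comp_quotient h hT.inl_snd⟩, ⟨PullbackCone.IsLimit.mk _
    (fun c => lift (((c.fst ≫ k) * (c.snd ≫ k)⁻¹) ≫ t) c.snd) (fun c => ?_)
    (fun c => lift_snd _ _) fun c m hfst hsnd => ?_⟩⟩
  · have hker : ((c.fst ≫ k) * (c.snd ≫ k)⁻¹) ≫ π = 1 := by
      rw [MonObj.mul_comp, GrpObj.inv_comp, Category.assoc, Category.assoc, ← h.w,
        c.condition_assoc, mul_inv_cancel]
    rw [← cancel_mono k, Category.assoc, lift_translation_comp, Category.assoc,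
      hT.comp_retraction_comp hker, inv_mul_cancel_right]
  · ext
    · have hm := lift_translation_comp h hT.inl_snd (m ≫ fst _ _) (m ≫ snd _ _)
      rw [← comp_lift, lift_fst_snd, Category.comp_id, reassoc_of% hfst, hsnd] at hm
      rw [lift_fst, hm, mul_inv_cancel_right, Category.assoc, Category.assoc, hT.inl_fst,
        Category.comp_id]
    · rw [lift_snd, hsnd]

lemma isIso_lift [MonObj G] [MonObj O] [IsMonHom π] [IsMonHom t] [Mono k]
    (hT : IsSplitting i π t s) (h : IsPullback q k j π) : IsIso (lift (k ≫ t) q) := by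
  have hw : snd G Q ≫ j = ((fst G Q ≫ i) * (snd G Q ≫ j ≫ s)) ≫ π := by
    rw [mul_comp_eq_of_comp_eq_one hT.inl_snd, Category.assoc, Category.assoc, hT.inr_snd,
      Category.comp_id]
  refine ⟨h.lift (snd G Q) ((fst G Q ≫ i) * (snd G Q ≫ j ≫ s)) hw, ?_, ?_⟩
  · rw [← cancel_mono k, Category.assoc, h.lift_snd, MonObj.comp_mul, lift_fst_assoc,
      lift_snd_assoc, ← Category.assoc q, h.w, Category.id_comp, Category.assoc, Category.assoc,
      ← MonObj.comp_mul, hT.total, Category.comp_id]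
  · ext
    · rw [Category.assoc, lift_fst, Category.id_comp, ← Category.assoc, h.lift_snd,
        MonObj.mul_comp, Category.assoc, hT.inl_fst, Category.comp_id, Category.assoc,
        Category.assoc, hT.inr_fst, MonObj.comp_one, MonObj.comp_one, mul_one]
    · rw [Category.assoc, lift_snd, Category.id_comp, h.lift_fst]

lemma isSplitEpi [MonObj G] [MonObj O] (hT : IsSplitting i π t s) (h : IsPullback q k j π) :
    IsSplitEpi q :=
  have : IsSplitEpi π := .mk' ⟨s, hT.inr_snd⟩
  isSplitEpi_of_isPullback h

end IsSplitting

end Translation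

section OverBase

variable {G T O X Q : Over base}

lemma surjective_left_of_isSplitEpi (q : X ⟶ Q) [IsSplitEpi q] : Surjective q.left := by
  have : Surjective ((section_ q).left ≫ q.left) := by
    rw [← Over.comp_left, IsSplitEpi.id, Over.id_left]
    infer_instance
  exact Surjective.of_comp (section_ q).left _

lemma isClosedImmersion_lift_of_isKernelPair {P : Over base} {a b : P ⟶ X} {q : X ⟶ Q}
    [IsSeparated Q.hom] (h : IsKernelPair q a b) : IsClosedImmersion (lift a b).left := by
  have : IsClosedImmersion (lift (𝟙 Q) (𝟙 Q)).left :=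
    IsSeparated.isClosedImmersion_diagonal (f := Q.hom)
  exact MorphismProperty.of_isPullback
    ((isPullback_lift_of_isKernelPair h).map (Over.forget base)).flip this

lemma left_of_isIso_lift (P : MorphismProperty Scheme) [P.IsStableUnderBaseChange]
    {p : X ⟶ G} {q : X ⟶ Q} [IsIso (lift p q)] (hG : P G.hom) : P q.left := by
  have hsnd : P (snd G Q).left := by
    refine MorphismProperty.of_isPullback (f' := (fst G Q).left) (f := Q.hom) ?_ hG
    exact IsPullback.of_hasPullback _ _
  have : IsIso (lift p q).left :=
    inferInstanceAs (IsIso ((Over.forget base).map (lift p q)))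
  rw [← lift_snd p q, Over.comp_left]
  exact (P.cancel_left_of_respectsIso _ _).2 hsnd

theorem IsSplitting.exists_isFreeQuotient [GrpObj G] [GrpObj T] [GrpObj O] {i : G ⟶ T}
    [IsMonHom i] {π : T ⟶ O} [IsMonHom π] {t : T ⟶ G} [IsMonHom t] {s : O ⟶ T} [IsMonHom s]
    {k : X ⟶ T} {j : Q ⟶ O} {q : X ⟶ Q} [Mono k] [Flat G.hom] [QuasiCompact G.hom]
    [IsSeparated Q.hom] (hT : IsSplitting i π t s) (h : IsPullback q k j π) :
    ∃ _ : ModObj G X, actionMap G X ≫ k = (i ⊗ₘ k) ≫ MonObj.mul ∧ IsFreeAction G X ∧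
      IsFreeQuotient G q := by
  have hpair := hT.isKernelPair_translation h
  have hiso := hT.isIso_lift h
  have hsplit := hT.isSplitEpi h
  let act := translationAction h hT.inl_snd
  exact ⟨act, translation_comp h hT.inl_snd, isClosedImmersion_lift_of_isKernelPair hpair,
    { flat := left_of_isIso_lift @Flat (p := k ≫ t) ‹_›
      surjective := surjective_left_of_isSplitEpi q
      quasiCompact := left_of_isIso_lift @QuasiCompact (p := k ≫ t) ‹_›
      isPullback := hpair
      isCoequalizer := ⟨hpair.toCoequalizer'⟩ }⟩

end OverBase

/-! ### The closure in the toric variety -/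

section Tori

open scoped MonObj

variable {L L' L'' : Type} [AddCommGroup L] [AddCommGroup L'] [AddCommGroup L'']

lemma torusMap_id : torusMap (AddMonoidHom.id L) = 𝟙 (torus L) := by
  ext1
  change Spec.map (CommRingCat.ofHom _) = 𝟙 _
  rw [show AddMonoidAlgebra.mapDomainAlgHom ℂ ℂ (AddMonoidHom.id L) = AlgHom.id ℂ _ from
    AddMonoidAlgebra.mapDomainAlgHom_id ..]
  exact Spec.map_id _

lemma torusMap_comp (f : L →+ L') (g : L' →+ L'') :
    torusMap (g.comp f) = torusMap g ≫ torusMap f := by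
  ext1
  change Spec.map (CommRingCat.ofHom _) = Spec.map _ ≫ Spec.map _
  rw [← Spec.map_comp, ← CommRingCat.ofHom_comp,
    show AddMonoidAlgebra.mapDomainAlgHom ℂ ℂ (g.comp f) = _ from
    AddMonoidAlgebra.mapDomainAlgHom_comp (R := ℂ) (A := ℂ) f g]
  rfl

-- `Spec` turns the convolution of algebra homomorphisms into the product of points.
lemma torusMap_mul (f g : L →+ L') : torusMap f * torusMap g = torusMap (f + g) := by
  have hmul := (Spec.mapMulEquiv (R := ℂ) (S := ℂ[L]) (T := ℂ[L'])).map_mul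
    (WithConv.toConv (AddMonoidAlgebra.mapDomainAlgHom ℂ ℂ f))
    (WithConv.toConv (AddMonoidAlgebra.mapDomainAlgHom ℂ ℂ g))
  refine hmul.symm.trans (congrArg _ ?_)
  apply WithConv.ofConv_injective
  ext m
  simp [AlgHom.convMul_def]

lemma torusMap_zero : torusMap (0 : L →+ L') = 1 := by
  have := torusMap_mul (0 : L →+ L') 0
  rwa [add_zero, mul_eq_left] at this

instance (f : L →+ L') : IsMonHom (torusMap f) :=
  inferInstanceAs (IsMonHom ((bialgSpec (.of ℂ)).map (.op (CommBialgCat.ofHom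
    (AddMonoidAlgebra.mapDomainBialgHom ℂ f)))).hom)

end Tori

section Kernels

lemma ker_appTop_specMap {A B : CommRingCat.{0}} (φ : A ⟶ B) :
    RingHom.ker (Spec.map φ).appTop.hom =
      (RingHom.ker φ.hom).comap (Scheme.ΓSpecIso A).hom.hom := by
  rw [RingHom.comap_ker, ← CommRingCat.hom_comp, ← Scheme.ΓSpecIso_naturality,
    CommRingCat.hom_comp, ← RingHom.comap_ker, (RingHom.injective_iff_ker_eq_bot _).1
    (ConcreteCategory.bijective_of_isIso (Scheme.ΓSpecIso B).hom).1, RingHom.ker]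

lemma ker_specMap_congr {A B B' : CommRingCat.{0}} (φ : A ⟶ B) (φ' : A ⟶ B')
    (h : RingHom.ker φ.hom = RingHom.ker φ'.hom) : (Spec.map φ).ker = (Spec.map φ').ker := by
  rw [Scheme.ker_of_isAffine, Scheme.ker_of_isAffine, ker_appTop_specMap, ker_appTop_specMap, h]

variable {A B C : Type} [CommRing A] [CommRing B] [CommRing C]

lemma isPushout_quotient (ψ : A →+* C) (I : Ideal A) :
    IsPushout (CommRingCat.ofHom ψ) (CommRingCat.ofHom (Ideal.Quotient.mk I))
      (CommRingCat.ofHom (Ideal.Quotient.mk (I.map ψ)))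
      (CommRingCat.ofHom (Ideal.quotientMap (I.map ψ) ψ Ideal.le_comap_map)) := by
  have hle (c : PushoutCocone (CommRingCat.ofHom ψ) (CommRingCat.ofHom (Ideal.Quotient.mk I))) :
      I.map ψ ≤ RingHom.ker c.inl.hom := by
    refine Ideal.map_le_iff_le_comap.2 fun y hy => ?_
    have hinl : c.inl.hom (ψ y) = c.inr.hom (Ideal.Quotient.mk I y) :=
      congrArg (fun f => f.hom y) c.condition
    rw [Ideal.mem_comap, RingHom.mem_ker, hinl, Ideal.Quotient.eq_zero_iff_mem.2 hy, map_zero]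
  refine ⟨⟨?_⟩, ⟨PushoutCocone.IsColimit.mk _
    (fun c => CommRingCat.ofHom (Ideal.Quotient.lift (I.map ψ) c.inl.hom (hle c)))
    (fun c => ?_) (fun c => ?_) fun c m hinl _ => ?_⟩⟩
  · ext x
    simp
  · ext x
    rfl
  · ext x
    exact congrArg (fun f => f.hom x) c.condition
  · ext x
    exact congrArg (fun f => f.hom x) hinl

lemma isClosedImmersion_specMap_mk (I : Ideal A) :
    IsClosedImmersion (Spec.map (CommRingCat.ofHom (Ideal.Quotient.mk I))) :=
  IsClosedImmersion.spec_of_surjective _ Ideal.Quotient.mk_surjective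

lemma comap_ker_specMap (φ : A →+* B) (ψ : A →+* C) :
    (Spec.map (CommRingCat.ofHom φ)).ker.comap (Spec.map (CommRingCat.ofHom ψ)) =
      (Spec.map (CommRingCat.ofHom (Ideal.Quotient.mk ((RingHom.ker φ).map ψ)))).ker := by
  have := isClosedImmersion_specMap_mk (RingHom.ker φ)
  have hP := isPullback_SpecMap_of_isPushout _ _ _ _ (isPushout_quotient ψ (RingHom.ker φ))
  rw [ker_specMap_congr (CommRingCat.ofHom φ)
    (CommRingCat.ofHom (Ideal.Quotient.mk (RingHom.ker φ))) (by simp [Ideal.mk_ker]),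
    ← Scheme.IdealSheafData.ker_fst_of_isClosedImmersion, ← hP.isoPullback_hom_fst,
    Scheme.Hom.ker_comp_of_isIso]

lemma comap_ker_comp_of_isOpenImmersion {X V Y : Scheme.{0}} (f : X ⟶ V) (c : V ⟶ Y)
    [IsOpenImmersion c] [QuasiCompact (f ≫ c)] : (f ≫ c).ker.comap c = f.ker := by
  have hP : IsPullback f (𝟙 X) c (f ≫ c) := by
    refine ⟨⟨by simp⟩, ⟨PullbackCone.IsLimit.mk _ (fun s => s.snd) (fun s => ?_)
      (fun s => Category.comp_id _) fun s m _ h => ?_⟩⟩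
    · rw [← cancel_mono c, s.condition, Category.assoc]
    · rw [← h, Category.comp_id]
  ext1
  funext U
  rw [Scheme.IdealSheafData.ideal_comap_of_isOpenImmersion,
    Scheme.ker_ideal_of_isPullback_of_isOpenImmersion _ _ _ _ hP]

lemma comap_ker_specMap_comp (φ : A →+* B) (ψ : A →+* C) {Y : Scheme.{0}}
    (c : Spec (.of A) ⟶ Y) [IsOpenImmersion c]
    (_ : QuasiCompact (Spec.map (CommRingCat.ofHom φ) ≫ c)) :
    (Spec.map (CommRingCat.ofHom φ) ≫ c).ker.comap (Spec.map (CommRingCat.ofHom ψ) ≫ c) =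
      (Spec.map (CommRingCat.ofHom (Ideal.Quotient.mk ((RingHom.ker φ).map ψ)))).ker := by
  rw [Scheme.IdealSheafData.comap_comp, comap_ker_comp_of_isOpenImmersion, comap_ker_specMap]

end Kernels

section Closure

variable {M : Type} [AddCommGroup M] (F : Fan M) (I : Ideal ℂ[M]) (σ : F.cones)

instance : IsOpenImmersion (chartToToric F σ) :=
  inferInstanceAs (IsOpenImmersion (colimit.ι (chartDiagram F) σ))

lemma specMap_mapDomain_comp_chartMap {σ τ : PointedCone ℝ (M →+ ℝ)} (h : σ ≤ τ) :
    Spec.map (CommRingCat.ofHom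
        (AddMonoidAlgebra.mapDomainAlgHom ℂ ℂ (dualMonoid σ).subtype).toRingHom) ≫ chartMap h =
      Spec.map (CommRingCat.ofHom
        (AddMonoidAlgebra.mapDomainAlgHom ℂ ℂ (dualMonoid τ).subtype).toRingHom) := by
  rw [chartMap, ← Spec.map_comp, ← CommRingCat.ofHom_comp]
  congr 2
  exact congrArg AlgHom.toRingHom (AddMonoidAlgebra.mapDomainAlgHom_comp (R := ℂ) (A := ℂ)
    (AddSubmonoid.inclusion (dualMonoid_anti h)) (dualMonoid σ).subtype).symm

lemma chartMap_comp_chartToToric {σ τ : F.cones} (h : σ ≤ τ) :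
    chartMap h ≫ chartToToric F τ = chartToToric F σ :=
  colimit.w (chartDiagram F) (homOfLE h)

lemma torusToToric_eq : torusToToric F = Spec.map (CommRingCat.ofHom
    (AddMonoidAlgebra.mapDomainAlgHom ℂ ℂ (dualMonoid σ.1).subtype).toRingHom) ≫
      chartToToric F σ := by
  have hle : (⟨⊥, F.zero_mem⟩ : F.cones) ≤ σ := show ⊥ ≤ σ.1 from bot_le
  rw [torusToToric, ← chartMap_comp_chartToToric F hle]
  exact (Category.assoc _ _ _).symm.trans
    (congrArg (· ≫ chartToToric F σ) (specMap_mapDomain_comp_chartMap hle))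

lemma subschemeToToric_eq : subschemeToToric F I =
    Spec.map (CommRingCat.ofHom ((Ideal.Quotient.mk I).comp
      (AddMonoidAlgebra.mapDomainAlgHom ℂ ℂ (dualMonoid σ.1).subtype).toRingHom)) ≫
        chartToToric F σ := by
  rw [CommRingCat.ofHom_comp, Spec.map_comp, Category.assoc]
  exact congrArg ((subschemeι I).left ≫ ·) (torusToToric_eq F σ)

instance : IsClosedImmersion (toricClosureι F I) :=
  inferInstanceAs (IsClosedImmersion (subschemeToToric F I).imageι)

instance : IsClosedImmersion (closureInterOrbitι F I σ).left :=
  inferInstanceAs (IsClosedImmersion (pullback.snd (toricClosureι F I) (orbitToToric F σ)))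

instance : IsClosedImmersion (subschemeι I).left :=
  isClosedImmersion_specMap_mk I

instance : Mono (subschemeι I) :=
  (Over.forget base).mono_of_mono_map (inferInstanceAs (Mono (subschemeι I).left))

-- `X` is noetherian; `Y_Σ` itself need not be, since a fan may have infinitely many cones.
lemma quasiCompact_subschemeToToric [Module.Finite ℤ M] :
    QuasiCompact (subschemeToToric F I) := by
  have : AddMonoid.FG M := AddGroup.fg_iff_addMonoid_fg.1 (Module.Finite.iff_addGroup_fg.1 ‹_›)
  have : IsNoetherianRing ℂ[M] := Algebra.FiniteType.isNoetherianRing ℂ _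
  have : IsNoetherianRing (CommRingCat.of (ℂ[M] ⧸ I)) :=
    inferInstanceAs (IsNoetherianRing (ℂ[M] ⧸ I))
  have : IsNoetherian (subscheme I).left :=
    inferInstanceAs (IsNoetherian (Spec (CommRingCat.of (ℂ[M] ⧸ I))))
  infer_instance

lemma ker_closureInterOrbitι_eq_comap : (closureInterOrbitι F I σ).left.ker =
    (subschemeToToric F I).ker.comap (orbitToToric F σ) := by
  have hker : (toricClosureι F I).ker = (subschemeToToric F I).ker :=
    Scheme.IdealSheafData.ker_subschemeι _
  rw [← hker, ← Scheme.IdealSheafData.ker_fst_of_isClosedImmersion,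
    ← Scheme.Hom.ker_comp_of_isIso (pullbackSymmetry _ _).hom, pullbackSymmetry_hom_comp_fst]
  rfl

lemma ker_closureInterOrbitι [Module.Finite ℤ M] :
    (closureInterOrbitι F I σ).left.ker = (Spec.map (CommRingCat.ofHom
      (Ideal.Quotient.mk ((chartIdeal σ.1 I).map (orbitRingMap σ.1).toRingHom)))).ker := by
  have := quasiCompact_subschemeToToric F I
  have hchart : chartIdeal σ.1 I = RingHom.ker ((Ideal.Quotient.mk I).comp
      (AddMonoidAlgebra.mapDomainAlgHom ℂ ℂ (dualMonoid σ.1).subtype).toRingHom) := by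
    rw [← RingHom.comap_ker, Ideal.mk_ker]
    rfl
  rw [subschemeToToric_eq F I σ] at this
  rw [ker_closureInterOrbitι_eq_comap, subschemeToToric_eq F I σ, hchart]
  exact comap_ker_specMap_comp _ _ _ this

variable {J : Ideal ℂ[M]}

lemma comap_ker_closureInterOrbitι [Module.Finite ℤ M]
    (hJ : J = ((chartIdeal σ.1 I).map (orbitRingMap σ.1)).map
      (AddMonoidAlgebra.mapDomainAlgHom ℂ ℂ (perp σ.1).subtype)) :
    (closureInterOrbitι F I σ).left.ker.comap (torusToOrbit σ.1).left =
      (subschemeι J).left.ker := by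
  rw [ker_closureInterOrbitι]
  refine (comap_ker_specMap _ _).trans ?_
  rw [Ideal.mk_ker, hJ]
  rfl

lemma exists_isPullback_closureInterOrbit [Module.Finite ℤ M]
    (hJ : J = ((chartIdeal σ.1 I).map (orbitRingMap σ.1)).map
      (AddMonoidAlgebra.mapDomainAlgHom ℂ ℂ (perp σ.1).subtype)) :
    ∃ q : subscheme J ⟶ closureInterOrbit F I σ,
      IsPullback q (subschemeι J) (closureInterOrbitι F I σ) (torusToOrbit σ.1) := by
  have hker := comap_ker_closureInterOrbitι F I σ hJ
  have hle : (closureInterOrbitι F I σ).left.ker ≤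
      ((subschemeι J).left ≫ (torusToOrbit σ.1).left).ker := by
    rw [← Scheme.IdealSheafData.map_ker, Scheme.IdealSheafData.le_map_iff_comap_le, hker]
  have hfac := IsClosedImmersion.lift_fac _ _ hle
  have hP := isPullback_of_isClosedImmersion (subschemeι J).left (closureInterOrbitι F I σ).left
    (IsClosedImmersion.lift _ _ hle) (torusToOrbit σ.1).left hfac.symm hker
  let q : subscheme J ⟶ closureInterOrbit F I σ := Over.homMk (IsClosedImmersion.lift _ _ hle) (by
    rw [← Over.w (closureInterOrbitι F I σ), reassoc_of% hfac, Over.w, Over.w])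
  refine ⟨q, IsPullback.of_map (Over.forget base) ?_ hP.flip⟩
  ext1
  exact hfac

end Closure

section Quotient

open scoped MonObj

variable {M : Type} [AddCommGroup M] {σ : PointedCone ℝ (M →+ ℝ)}

instance (σ : PointedCone ℝ (M →+ ℝ)) : IsMonHom (subtorusι σ) :=
  inferInstanceAs (IsMonHom (torusMap (restrictSpan σ)))

instance (σ : PointedCone ℝ (M →+ ℝ)) : IsMonHom (torusToOrbit σ) :=
  inferInstanceAs (IsMonHom (torusMap (perp σ).subtype))

instance (A : Type) [CommRing A] [Algebra ℂ A] : IsAffineHom (affine A).hom :=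
  inferInstanceAs (IsAffineHom (Spec.map (CommRingCat.ofHom (algebraMap ℂ A))))

instance (A : Type) [CommRing A] [Algebra ℂ A] : Flat (affine A).hom :=
  Flat.SpecMap_iff.2 (RingHom.flat_algebraMap_iff.2 inferInstance)

lemma isSplitting_torusMap {L K P : Type} [AddCommGroup L] [AddCommGroup K] [AddCommGroup P]
    {f : L →+ K} {i : P →+ L} {r : K →+ L} {ρ : L →+ P} (hfi : f.comp i = 0)
    (hfr : f.comp r = .id K) (hρi : ρ.comp i = .id P) (hρr : ρ.comp r = 0)
    (hsum : r.comp f + i.comp ρ = .id L) :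
    IsSplitting (torusMap f) (torusMap i) (torusMap r) (torusMap ρ) where
  inl_fst := by rw [← torusMap_comp, hfr, torusMap_id]
  inl_snd := by rw [← torusMap_comp, hfi, torusMap_zero]
  inr_fst := by rw [← torusMap_comp, hρr, torusMap_zero]
  inr_snd := by rw [← torusMap_comp, hρi, torusMap_id]
  total := by rw [← torusMap_comp, ← torusMap_comp, torusMap_mul, hsum, torusMap_id]

variable [Module.Free ℤ M] [Module.Finite ℤ M]

lemma exists_isSplitting_subtorusι (hσ : IsRationalPolyhedral σ) :
    ∃ (r : (latticeSpan σ →+ ℤ) →+ M) (ρ : M →+ perp σ),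
      IsSplitting (subtorusι σ) (torusToOrbit σ) (torusMap r) (torusMap ρ) := by
  obtain ⟨r, hr⟩ := exists_section_restrictSpan σ
  have hmem (m : M) : m - r (restrictSpan σ m) ∈ perp σ :=
    (restrictSpan_eq_zero_iff hσ).1 (by rw [map_sub, hr, sub_self])
  have hperp (m : perp σ) : restrictSpan σ m = 0 := (restrictSpan_eq_zero_iff hσ).2 m.2
  let ρ : M →+ perp σ := (AddMonoidHom.id M - r.comp (restrictSpan σ)).codRestrict (perp σ) hmem
  have hρ (m : M) : (ρ m : M) = m - r (restrictSpan σ m) := rfl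
  refine ⟨r, ρ, isSplitting_torusMap (AddMonoidHom.ext hperp) (AddMonoidHom.ext hr) ?_ ?_ ?_⟩
  · refine AddMonoidHom.ext fun m => Subtype.ext ?_
    simp [hρ, hperp]
  · refine AddMonoidHom.ext fun φ => Subtype.ext ?_
    simp [hρ, hr]
  · ext m
    simp [hρ]

theorem exists_isFreeQuotient_of_isPullback (hσ : IsRationalPolyhedral σ) {X Q : Over base}
    {k : X ⟶ torus M} {j : Q ⟶ orbit σ} {q : X ⟶ Q} [Mono k] [IsClosedImmersion j.left]
    (h : IsPullback q k j (torusToOrbit σ)) :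
    ∃ _ : ModObj (subtorus σ) X, actionMap (subtorus σ) X ≫ k = (subtorusι σ ⊗ₘ k) ≫ MonObj.mul ∧
      IsFreeAction (subtorus σ) X ∧ IsFreeQuotient (subtorus σ) q := by
  have : IsSeparated Q.hom := by
    rw [← Over.w j]
    infer_instance
  obtain ⟨r, ρ, hT⟩ := exists_isSplitting_subtorusι hσ
  exact hT.exists_isFreeQuotient h

end Quotient

end TropicalToric

end

theorem corollaryC_general {M : Type} [AddCommGroup M] [Module.Free ℤ M] [Module.Finite ℤ M]
    (I : Ideal (AddMonoidAlgebra ℂ M)) (F : Fan M)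
    (σ : F.cones) (w : M →+ ℝ)
    (hw : ∀ u ∈ relInterior σ.1, initialIdeal u I = initialIdeal w I) :
    ∃ (_ : ModObj (subtorus σ.1) (initialScheme w I))
      (q : initialScheme w I ⟶ closureInterOrbit F I σ),
      actionMap (subtorus σ.1) (initialScheme w I) ≫ subschemeι (initialIdeal w I) =
        (subtorusι σ.1 ⊗ₘ subschemeι (initialIdeal w I)) ≫ MonObj.mul (X := torus M) ∧
      IsFreeAction (subtorus σ.1) (initialScheme w I) ∧
      q ≫ closureInterOrbitι F I σ = subschemeι (initialIdeal w I) ≫ torusToOrbit σ.1 ∧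
      IsFreeQuotient (subtorus σ.1) q := by
  obtain ⟨q, hq⟩ := exists_isPullback_closureInterOrbit F I σ
    (initialIdeal_eq_map (F.rational σ σ.2) hw)
  obtain ⟨act, hact, hfree, hquot⟩ := exists_isFreeQuotient_of_isPullback (F.rational σ σ.2) hq
  exact ⟨act, q, hact, hfree, hq.w, hquot⟩

theorem corollaryC {M : Type} [AddCommGroup M] [Module.Free ℤ M] [Module.Finite ℤ M]
    (I : Ideal (AddMonoidAlgebra ℂ M)) (F : Fan M)
    (hF : ∀ σ ∈ F.cones, ∀ u ∈ relInterior σ, ∀ w ∈ relInterior σ,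
      initialIdeal u I = initialIdeal w I)
    (σ : F.cones) (w : M →+ ℝ) (hw : w ∈ relInterior σ.1) :
    ∃ (_ : ModObj (subtorus σ.1) (initialScheme w I))
      (q : initialScheme w I ⟶ closureInterOrbit F I σ),
      actionMap (subtorus σ.1) (initialScheme w I) ≫ subschemeι (initialIdeal w I) =
        (subtorusι σ.1 ⊗ₘ subschemeι (initialIdeal w I)) ≫ MonObj.mul (X := torus M) ∧
      IsFreeAction (subtorus σ.1) (initialScheme w I) ∧
      q ≫ closureInterOrbitι F I σ = subschemeι (initialIdeal w I) ≫ torusToOrbit σ.1 ∧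
      IsFreeQuotient (subtorus σ.1) q :=
  corollaryC_general I F σ w fun u hu => hF σ σ.2 u hu w hw
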